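/- Fix a finite $n\ge 3$; identify $n$ with $\{0,\dots,n-1\}$. \textbf{Algebras.} $L_{Df_n}$ is the signature $\{+,-,0,1\}\cup\{c_i: i<n\}$ ($c_i$ unary), and $L_{PEA_n}$ adds constants $d_{ij}$ ($i,j<n$) and unary symbols $s_\sigma$ ($\sigma:n\to n$). A polyadic equality set algebra is $\wp({}^nU)$ ($U\neq\emptyset$) with the boolean operations, $c_iX=\{x: \exists y\in X\,\forall j\ne i\; y_j=x_j\}$, $d_{ij}=\{x: x_i=x_j\}$, $s_\sigma X=\{x: x\circ\sigma\in X\}$. A diagonal-free cylindric set algebra is $\wp(\prod_{i<n}U_i)$ ($U_i\ne\emptyset$) with the boolean operations and $c_iX=\{x: \exists y\in X\,\forall j\ne i\; y_j=x_j\}$. $\mathsf{RPEA}_n$ (resp. $\mathsf{RDf}_n$) is the class of $L_{PEA_n}$-algebras (resp. $L_{Df_n}$-algebras) isomorphic to a subalgebra of a product of such set algebras; its members are called representable. \textbf{Algebras from graphs.} Graphs are undirected and loop-free. For a graph $\Gamma$ with node set $V$ and edge relation $E$, $\Gamma\times n$ is the graph on $V\times n$ in which $(x,i),(y,j)$ are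 adjacent iff $E(x,y)$ or $i\neq j$. Let $S(\Gamma)$ be the set of pairs $(K,\sim)$ with $\sim$ an equivalence relation on $n$ and $K:n\to\Gamma\times n$ a partial map such that: if $|n/{\sim}|=n$, then $K$ is total and its image is not independent; if $|n/{\sim}|=n-1$, with $\{i,j\}$ the unique class of size $2$, then $\operatorname{dom}K=\{i,j\}$ and $K(i)=K(j)$; and otherwise $K=\emptyset$. Call $\sim$ \emph{$i$-distinguishing} if no two distinct $j,k\in n\setminus\{i\}$ satisfy $j\sim k$. Write $(K,\sim)\equiv_i(K',\sim')$ if $K(i),K'(i)$ are both undefined or are defined and equal, and $\sim,\sim'$ agree on $n\setminus\{i\}$. For $\sigma:n\to n$ let $(K,\sim)^\sigma=(K^\sigma,\sim^\sigma)$, where $i\sim^\sigma j$ iff $\sigma(i)\sim\sigma(j)$, and $K^\sigma(i)$ is defined iff $\sim^\sigma$ is $i$-distinguishing, in which case $K^\sigma(i)=K(j)$ for the unique $j\notin\sigma[n\setminus\{i\}]$. $\mathcal A(\Gamma)$ is the $L_{PEA_n}$-algebra $\wp(S(\Gamma))$ with the boolean operations, $d_{ij}=\{(K,\sim): i\sim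 j\}$, $c_iX=\{\kappa:\exists\kappa'\in X\;\kappa'\equiv_i\kappa\}$, $s_\sigma X=\{\kappa:\kappa^\sigma\in X\}$. \textbf{Three-sorted structures.} $L_{AGS}$ has sorts $\mathcal A,\mathcal G,\mathcal B$; the operations of $L_{PEA_n}$ on $\mathcal A$; the operations $+,-,0,1$ on $\mathcal B$; binary relations $E,H$ on $\mathcal G$; a relation $\in$ between $\mathcal G$ and $\mathcal B$; and unary functions $R_i:\mathcal A\to\mathcal B$, $S_i:\mathcal B\to\mathcal A$ ($i<n$). For a graph $\Gamma$, $M(\Gamma)=(\mathcal A(\Gamma),\Gamma\times n,\wp(\Gamma\times n))$, with $E$ the edge relation of $\Gamma\times n$; $H((x,i),(y,j))$ iff $i=j$; $\in$ membership; and, with $F_i=\prod\{-d_{jk}: j<k<n,\ j,k\ne i\}$, $R_i(a)=\{K(i):(K,\sim)\in F_i\cdot a\}$ and $S_i(B)=\{(K,\sim)\in F_i: K(i)\in B\}$. An $L_{AGS}$-sentence is \emph{$\mathcal A$-universal} if it has the form $\forall x_1\cdots x_m{:}\mathcal A\;\varphi$, where $\varphi$ has no quantifier over the sort $\mathcal A$.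 \textbf{Theories.} $\mathcal U$ is the set of all $\mathcal A$-universal sentences true in $M(\Gamma)$ for every graph $\Gamma$. $\Phi=\{\phi_m: m<\omega\}$, where $\phi_m$ says that there are $m$ pairwise distinct elements of $\mathcal B$. $\Theta=\{\theta_k:k<\omega\}$, where $$\theta_k=\forall B_0\dots B_{k-1}{:}\mathcal B\,\Big(\sum_{i<k}B_i=1\to\exists p,q{:}\mathcal G\,\big(E(p,q)\wedge\bigvee_{i<k}(p\in B_i\wedge q\in B_i)\big)\Big)$$ (``$\mathcal G$ has infinite chromatic number in the sense of $\mathcal B$''). Let $\Delta$ be any first-order axiomatisation of $\mathsf{RDf}_n$ and $\Pi$ any universal axiomatisation of $\mathsf{RPEA}_n$, both regarded as $L_{AGS}$-theories about the sort $\mathcal A$. \textbf{Theorem.} $\mathcal U\cup\Phi\cup\Delta\models\Theta$, and $\mathcal U\cup\Theta\models\Pi$. That is, for every model $M=(\mathcal A,\mathcal G,\mathcal B)$ of $\mathcal U$: if $\mathcal B$ is infinite and the $L_{Df_n}$-reduct of $\mathcal A$ is representable, then $M\models\Theta$; and if $M\models\Theta$, then $\mathcal A\in\mathsf{RPEA}_n$.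 -/

import Mathlib

open FirstOrder

namespace AlgGraph

universe u v

/-! ## Signatures of algebras -/

/-- Function symbols `0, 1, +, -` of boolean algebras, indexed by arity. -/
inductive BAFunc : ℕ → Type
  | zero : BAFunc 0
  | one : BAFunc 0
  | add : BAFunc 2
  | neg : BAFunc 1

/-- Function symbols of `n`-dimensional diagonal-free cylindric-type algebras:
the boolean ones and the cylindrifications. -/
inductive DfFunc (n : ℕ) : ℕ → Type
  | bool {k : ℕ} (f : BAFunc k) : DfFunc n k
  | cyl (i : Fin n) : DfFunc n 1

/-- Function symbols of `n`-dimensional polyadic equality-type algebras: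
the diagonal-free ones, the diagonals, and a substitution for every `σ : n → n`. -/
inductive PeaFunc (n : ℕ) : ℕ → Type
  | df {k : ℕ} (f : DfFunc n k) : PeaFunc n k
  | diag (i j : Fin n) : PeaFunc n 0
  | subst (σ : Fin n → Fin n) : PeaFunc n 1

/-- The signature of boolean algebras. -/
def LBA : FirstOrder.Language.{0, 0} := ⟨BAFunc, fun _ => Empty⟩

/-- The signature of `n`-dimensional diagonal-free cylindric algebras. -/
def LDf (n : ℕ) : FirstOrder.Language.{0, 0} := ⟨DfFunc n, fun _ => Empty⟩

/-- The signature of `n`-dimensional polyadic equality algebras. -/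
def LPea (n : ℕ) : FirstOrder.Language.{0, 0} := ⟨PeaFunc n, fun _ => Empty⟩

/-- The inclusion of signatures, along which diagonal-free reducts are taken. -/
def dfToPea (n : ℕ) : LDf n →ᴸ LPea n where
  onFunction := fun _ f => PeaFunc.df f
  onRelation := fun _ r => r

/-- The boolean operations on the subsets of `X`. -/
def setBAOp {X : Type u} : {k : ℕ} → BAFunc k → (Fin k → Set X) → Set X
  | _, .zero, _ => ∅
  | _, .one, _ => Set.univ
  | _, .add, x => x 0 ∪ x 1
  | _, .neg, x => (x 0)ᶜ

/-! ## Set algebras and representability -/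

/-- Cylindrification `Cᵢ X` on the subsets of `∏ₖ U k`. -/
def cylSet {n : ℕ} {U : Fin n → Type v} (i : Fin n) (X : Set (∀ k, U k)) : Set (∀ k, U k) :=
  {x | ∃ y ∈ X, ∀ j, j ≠ i → y j = x j}

/-- The diagonal-free operations on the subsets of `∏ₖ U k`. -/
def dfSetOp {n : ℕ} {U : Fin n → Type v} :
    {k : ℕ} → DfFunc n k → (Fin k → Set (∀ l, U l)) → Set (∀ l, U l)
  | _, .bool f, x => setBAOp f x
  | _, .cyl i, x => cylSet i (x 0)

/-- The polyadic equality operations on the subsets of `ⁿU`. -/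
def peaSetOp {n : ℕ} {U : Type v} :
    {k : ℕ} → PeaFunc n k → (Fin k → Set (Fin n → U)) → Set (Fin n → U)
  | _, .df f, x => dfSetOp f x
  | _, .diag i j, _ => {y | y i = y j}
  | _, .subst σ, x => {y | y ∘ σ ∈ x 0}

/-- The diagonal-free cylindric set algebra with unit `∏ₖ U k`. -/
instance dfSetAlgebra {n : ℕ} (U : Fin n → Type v) : (LDf n).Structure (Set (∀ k, U k)) where
  funMap := fun f x => dfSetOp f x
  RelMap := fun r _ => r.elim

/-- The polyadic equality set algebra with unit `ⁿU`. -/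
instance peaSetAlgebra {n : ℕ} (U : Type v) : (LPea n).Structure (Set (Fin n → U)) where
  funMap := fun f x => peaSetOp f x
  RelMap := fun r _ => r.elim

/-- The direct product of a family of `L`-structures. -/
@[reducible] def prodStructure (L : FirstOrder.Language.{0, 0}) {I : Type v} (X : I → Type v)
    [∀ i, L.Structure (X i)] : L.Structure (∀ i, X i) where
  funMap := fun f x i => FirstOrder.Language.Structure.funMap f (fun k => x k i)
  RelMap := fun r x => ∀ i, FirstOrder.Language.Structure.RelMap r (fun k => x k i)

/-- `A` is a representable diagonal-free cylindric algebra: it embeds into (that is, it is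
isomorphic to a subalgebra of) a product of diagonal-free cylindric set algebras. -/
def IsRDf (n : ℕ) (A : Type v) [(LDf n).Structure A] : Prop :=
  ∃ (I : Type v) (U : I → Fin n → Type v), (∀ i k, Nonempty (U i k)) ∧
    letI := prodStructure (LDf n) (fun i => Set (∀ k, U i k))
    Nonempty (A ↪[LDf n] (∀ i, Set (∀ k, U i k)))

/-- `A` is a representable polyadic equality algebra: it embeds into (that is, it is
isomorphic to a subalgebra of) a product of polyadic equality set algebras. -/
def IsRPEA (n : ℕ) (A : Type v) [(LPea n).Structure A] : Prop :=
  ∃ (I : Type v) (U : I → Type v), (∀ i, Nonempty (U i)) ∧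
    letI := prodStructure (LPea n) (fun i => Set (Fin n → U i))
    Nonempty (A ↪[LPea n] (∀ i, Set (Fin n → U i)))

/-- The diagonal-free reduct of the polyadic equality-type algebra `A` is representable. -/
def HasRepresentableDfReduct (n : ℕ) (A : Type v) [(LPea n).Structure A] : Prop :=
  letI := (dfToPea n).reduct A
  IsRDf n A

/-- The first-order theory `T` axiomatises the class of representable diagonal-free
cylindric algebras. -/
def AxiomatisesRDf (n : ℕ) (T : (LDf n).Theory) : Prop :=
  ∀ (A : Type v) [(LDf n).Structure A], A ⊨ T ↔ IsRDf n A

/-- The first-order theory `T` axiomatises the class of representable polyadic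
equality algebras. -/
def AxiomatisesRPEA (n : ℕ) (T : (LPea n).Theory) : Prop :=
  ∀ (A : Type v) [(LPea n).Structure A], A ⊨ T ↔ IsRPEA n A

/-! ## Three-sorted structures -/

/-- Structures with sorts `A` (algebra), `G` (graph), `B` (boolean algebra) for the signature of
algebra-graph systems. No axioms are imposed. -/
structure AGSStructure (n : ℕ) where
  A : Type v
  G : Type v
  B : Type v
  [algA : (LPea n).Structure A]
  [algB : LBA.Structure B]
  edge : G → G → Prop
  same : G → G → Prop
  mem : G → B → Prop
  R : Fin n → A → B
  S : Fin n → B → A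

attribute [instance] AGSStructure.algA AGSStructure.algB

/-- The three sorts. -/
inductive AGSSort
  | alg
  | graph
  | bool

/-- The domain of a sort. -/
def AGSStructure.carrier {n : ℕ} (M : AGSStructure.{v} n) : AGSSort → Type v
  | .alg => M.A
  | .graph => M.G
  | .bool => M.B

/-- Terms, with `a`, `g`, `b` variables of the respective sorts. -/
inductive AGSTerm (n a g b : ℕ) : AGSSort → Type
  | varA (i : Fin a) : AGSTerm n a g b .alg
  | varG (i : Fin g) : AGSTerm n a g b .graph
  | varB (i : Fin b) : AGSTerm n a g b .bool
  | funA {k : ℕ} (f : (LPea n).Functions k) (ts : Fin k → AGSTerm n a g b .alg) :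
      AGSTerm n a g b .alg
  | funB {k : ℕ} (f : LBA.Functions k) (ts : Fin k → AGSTerm n a g b .bool) :
      AGSTerm n a g b .bool
  | R (i : Fin n) (t : AGSTerm n a g b .alg) : AGSTerm n a g b .bool
  | S (i : Fin n) (t : AGSTerm n a g b .bool) : AGSTerm n a g b .alg

/-- The value of a term under an assignment of the variables. -/
def AGSTerm.realize {n a g b : ℕ} (M : AGSStructure.{v} n)
    (x : Fin a → M.A) (p : Fin g → M.G) (y : Fin b → M.B) :
    {s : AGSSort} → AGSTerm n a g b s → M.carrier s
  | _, .varA i => x i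
  | _, .varG i => p i
  | _, .varB i => y i
  | _, .funA f ts => FirstOrder.Language.Structure.funMap (M := M.A) f (fun k => (ts k).realize M x p y)
  | _, .funB f ts => FirstOrder.Language.Structure.funMap (M := M.B) f (fun k => (ts k).realize M x p y)
  | _, .R i t => M.R i (t.realize M x p y)
  | _, .S i t => M.S i (t.realize M x p y)

/-- First-order formulas in which the free variables are `a` variables of the algebra sort, `g` of
the graph sort and `b` of the boolean sort. A quantifier binds the last variable of its sort. -/
inductive AGSFormula (n : ℕ) : ℕ → ℕ → ℕ → Type
  | bot {a g b : ℕ} : AGSFormula n a g b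
  | eq {a g b : ℕ} (s : AGSSort) (t₁ t₂ : AGSTerm n a g b s) : AGSFormula n a g b
  | edge {a g b : ℕ} (t₁ t₂ : AGSTerm n a g b .graph) : AGSFormula n a g b
  | same {a g b : ℕ} (t₁ t₂ : AGSTerm n a g b .graph) : AGSFormula n a g b
  | mem {a g b : ℕ} (t₁ : AGSTerm n a g b .graph) (t₂ : AGSTerm n a g b .bool) : AGSFormula n a g b
  | imp {a g b : ℕ} (φ ψ : AGSFormula n a g b) : AGSFormula n a g b
  | allA {a g b : ℕ} (φ : AGSFormula n (a + 1) g b) : AGSFormula n a g b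
  | allG {a g b : ℕ} (φ : AGSFormula n a (g + 1) b) : AGSFormula n a g b
  | allB {a g b : ℕ} (φ : AGSFormula n a g (b + 1)) : AGSFormula n a g b

/-- Sentences. -/
abbrev AGSSentence (n : ℕ) : Type := AGSFormula n 0 0 0

/-- Satisfaction of a formula under an assignment of the free variables. -/
def AGSFormula.Realize {n : ℕ} (M : AGSStructure.{v} n) : {a g b : ℕ} → AGSFormula n a g b →
    (Fin a → M.A) → (Fin g → M.G) → (Fin b → M.B) → Prop
  | _, _, _, .bot, _, _, _ => False
  | _, _, _, .eq _ t₁ t₂, x, p, y => t₁.realize M x p y = t₂.realize M x p y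
  | _, _, _, .edge t₁ t₂, x, p, y => M.edge (t₁.realize M x p y) (t₂.realize M x p y)
  | _, _, _, .same t₁ t₂, x, p, y => M.same (t₁.realize M x p y) (t₂.realize M x p y)
  | _, _, _, .mem t₁ t₂, x, p, y => M.mem (t₁.realize M x p y) (t₂.realize M x p y)
  | _, _, _, .imp φ ψ, x, p, y => φ.Realize M x p y → ψ.Realize M x p y
  | _, _, _, .allA φ, x, p, y => ∀ z : M.A, φ.Realize M (Fin.snoc (α := fun _ => M.A) x z) p y
  | _, _, _, .allG φ, x, p, y => ∀ z : M.G, φ.Realize M x (Fin.snoc (α := fun _ => M.G) p z) y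
  | _, _, _, .allB φ, x, p, y => ∀ z : M.B, φ.Realize M x p (Fin.snoc (α := fun _ => M.B) y z)

/-- `M` satisfies the sentence `φ`. -/
def AGSStructure.Satisfies {n : ℕ} (M : AGSStructure.{v} n) (φ : AGSSentence n) : Prop :=
  φ.Realize M Fin.elim0 Fin.elim0 Fin.elim0

/-- `M` is a model of the theory `T`. -/
def AGSStructure.Models {n : ℕ} (M : AGSStructure.{v} n) (T : Set (AGSSentence n)) : Prop :=
  ∀ φ ∈ T, M.Satisfies φ

/-- Semantic consequence between theories: every model of `T` is a model of `T'`. -/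
def Entails {n : ℕ} (T T' : Set (AGSSentence n)) : Prop :=
  ∀ M : AGSStructure.{v} n, M.Models T → M.Models T'

/-! Derived connectives. -/

namespace AGSFormula

variable {n a g b : ℕ}

def neg (φ : AGSFormula n a g b) : AGSFormula n a g b := φ.imp .bot

def and (φ ψ : AGSFormula n a g b) : AGSFormula n a g b := (φ.imp ψ.neg).neg

def or (φ ψ : AGSFormula n a g b) : AGSFormula n a g b := φ.neg.imp ψ

def exG (φ : AGSFormula n a (g + 1) b) : AGSFormula n a g b := φ.neg.allG.neg

def exB (φ : AGSFormula n a g (b + 1)) : AGSFormula n a g b := φ.neg.allB.neg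

/-- Conjunction of a list of formulas. -/
def conj (l : List (AGSFormula n a g b)) : AGSFormula n a g b := l.foldr and (neg .bot)

/-- Disjunction of a list of formulas. -/
def disj (l : List (AGSFormula n a g b)) : AGSFormula n a g b := l.foldr or .bot

/-- Universal quantification over all the variables of the boolean sort. -/
def allsB : {k : ℕ} → AGSFormula n a g k → AGSFormula n a g 0
  | 0, φ => φ
  | _ + 1, φ => allsB φ.allB

/-- Existential quantification over all the variables of the boolean sort. -/
def exsB : {k : ℕ} → AGSFormula n a g k → AGSFormula n a g 0
  | 0, φ => φ
  | _ + 1, φ => exsB φ.exB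

/-- The formula contains no quantifier over the algebra sort. -/
def NoAlgQuantifier : {a g b : ℕ} → AGSFormula n a g b → Prop
  | _, _, _, .bot => True
  | _, _, _, .eq _ _ _ => True
  | _, _, _, .edge _ _ => True
  | _, _, _, .same _ _ => True
  | _, _, _, .mem _ _ => True
  | _, _, _, .imp φ ψ => φ.NoAlgQuantifier ∧ ψ.NoAlgQuantifier
  | _, _, _, .allA _ => False
  | _, _, _, .allG φ => φ.NoAlgQuantifier
  | _, _, _, .allB φ => φ.NoAlgQuantifier

/-- Formulas of the form `∀ x₁ … xₘ` (of the algebra sort) followed by a formula without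
quantifiers over the algebra sort. -/
inductive IsAlgUniversal : {a g b : ℕ} → AGSFormula n a g b → Prop
  | of_noAlgQuantifier {a g b : ℕ} {φ : AGSFormula n a g b} (h : φ.NoAlgQuantifier) :
      IsAlgUniversal φ
  | allA {a g b : ℕ} {φ : AGSFormula n (a + 1) g b} (h : IsAlgUniversal φ) :
      IsAlgUniversal φ.allA

end AGSFormula

/-! ## Atom structures and algebras from graphs -/

/-- The equivalence relation `r` on `n` is `i`-distinguishing. -/
def IsDist {n : ℕ} (r : Setoid (Fin n)) (i : Fin n) : Prop :=
  ∀ j k : Fin n, j ≠ i → k ≠ i → j ≠ k → ¬ r j k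

/-- The graph `Γ × n`: `n` copies of `Γ` with all possible edges between distinct copies. -/
def copies {V : Type u} (Γ : SimpleGraph V) (n : ℕ) : SimpleGraph (V × Fin n) where
  Adj p q := Γ.Adj p.1 q.1 ∨ p.2 ≠ q.2
  symm := ⟨fun _ _ h => h.imp (fun h => h.symm) (fun h => h.symm)⟩
  loopless := ⟨fun p h => h.elim (fun h => Γ.loopless.irrefl p.1 h) (fun h => h rfl)⟩

/-- The set `S(Γ)` of pairs `(K, ∼)`, where `K` is a partial map from `n` to `Γ × n` and `∼` is an
equivalence relation on `n`. -/
@[ext]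
structure Atom (n : ℕ) {V : Type u} (Γ : SimpleGraph V) where
  K : Fin n → Option (V × Fin n)
  rel : Setoid (Fin n)
  dom_of_card : Nat.card (Quotient rel) = n → ∀ i, (K i).isSome
  not_indep_of_card : Nat.card (Quotient rel) = n →
    ∃ i j p q, K i = some p ∧ K j = some q ∧ (copies Γ n).Adj p q
  of_card_add_one : Nat.card (Quotient rel) + 1 = n →
    ∀ i j, i < j → rel i j → (∀ k, (K k).isSome ↔ k = i ∨ k = j) ∧ K i = K j
  of_card_lt : Nat.card (Quotient rel) + 1 < n → ∀ i, K i = none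

section Substitution

variable {n : ℕ}

theorem card_le_of_isDist {r : Setoid (Fin n)} {i : Fin n} (h : IsDist r i) :
    n ≤ Nat.card (Quotient r) + 1 := by
  classical
  have hinj : Function.Injective
      (fun k : {k : Fin n // k ≠ i} => (Quotient.mk r k.1 : Quotient r)) := by
    intro j k hjk
    by_contra hne
    exact h j k j.2 k.2 (fun e => hne (Subtype.ext e)) (Quotient.exact hjk)
  have := Nat.card_le_card_of_injective _ hinj
  have h2 : Nat.card {k : Fin n // k ≠ i} + 1 = n := by
    rw [Nat.card_eq_fintype_card, Fintype.card_subtype_compl]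
    simp
    have := i.pos
    omega
  omega

theorem card_le_self (r : Setoid (Fin n)) : Nat.card (Quotient r) ≤ n := by
  have := Nat.card_le_card_of_surjective (Quotient.mk r) Quotient.mk_surjective
  simpa using this

theorem card_eq_iff (r : Setoid (Fin n)) :
    Nat.card (Quotient r) = n ↔ ∀ i j, r i j → i = j := by
  constructor
  · intro h i j hij
    have hb := (Function.Surjective.bijective_of_nat_card_le
      (f := Quotient.mk r) Quotient.mk_surjective (by simp [h]))
    exact hb.1 (Quotient.sound hij)
  · intro h
    have hb : Function.Bijective (Quotient.mk r) :=
      ⟨fun i j hij => h i j (Quotient.exact hij), Quotient.mk_surjective⟩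
    simpa using (Nat.card_eq_of_bijective _ hb).symm

theorem isDist_of_card {r : Setoid (Fin n)} (h : Nat.card (Quotient r) + 1 = n)
    {i j : Fin n} (hij : i ≠ j) (hr : r i j) : IsDist r i := by
  classical
  have hs : Function.Surjective
      (fun k : {k : Fin n // k ≠ i} => (Quotient.mk r k.1 : Quotient r)) := by
    intro q
    obtain ⟨k, rfl⟩ := Quotient.mk_surjective q
    by_cases hk : k = i
    · subst hk
      exact ⟨⟨j, hij.symm⟩, Quotient.sound (r.symm hr)⟩
    · exact ⟨⟨k, hk⟩, rfl⟩
  have h2 : Nat.card {k : Fin n // k ≠ i} + 1 = n := by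
    rw [Nat.card_eq_fintype_card, Fintype.card_subtype_compl]
    simp
    have := i.pos
    omega
  have hb := hs.bijective_of_nat_card_le (by omega)
  intro k l hk hl hkl hr'
  exact hkl (congrArg Subtype.val (@hb.1 ⟨k, hk⟩ ⟨l, hl⟩ (Quotient.sound hr')))

theorem exists_pair_of_card {r : Setoid (Fin n)} (h : Nat.card (Quotient r) + 1 = n) :
    ∃ i j, i < j ∧ r i j := by
  have h1 : ¬ Nat.card (Quotient r) = n := by omega
  rw [card_eq_iff] at h1
  push Not at h1
  obtain ⟨i, j, hr, hne⟩ := h1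
  rcases lt_or_gt_of_ne hne with hlt | hlt
  · exact ⟨i, j, hlt, hr⟩
  · exact ⟨j, i, hlt, r.symm hr⟩

variable {V : Type u} {Γ : SimpleGraph V}

/-- `K` is defined on `i` exactly if `∼` is `i`-distinguishing. -/
theorem Atom.isSome_iff (κ : Atom n Γ) (i : Fin n) : (κ.K i).isSome ↔ IsDist κ.rel i := by
  rcases lt_trichotomy (Nat.card (Quotient κ.rel) + 1) n with h | h | h
  · rw [κ.of_card_lt h i]
    simp only [Option.isSome_none, Bool.false_eq_true, false_iff]
    intro hd
    have := card_le_of_isDist hd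
    omega
  · obtain ⟨j, k, hjk, hr⟩ := exists_pair_of_card h
    rw [(κ.of_card_add_one h j k hjk hr).1 i]
    constructor
    · rintro (rfl | rfl)
      · exact isDist_of_card h hjk.ne hr
      · exact isDist_of_card h hjk.ne' (κ.rel.symm hr)
    · intro hd
      by_contra hne
      push Not at hne
      exact hd j k hne.1.symm hne.2.symm hjk.ne hr
  · have h' : Nat.card (Quotient κ.rel) = n := by
      have := card_le_self κ.rel
      omega
    refine ⟨fun _ j k _ _ hne hr => hne ((card_eq_iff _).1 h' j k hr), fun _ => κ.dom_of_card h' i⟩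

theorem Atom.K_eq_of_rel (κ : Atom n Γ) {i j : Fin n} (h : κ.rel i j) : κ.K i = κ.K j := by
  by_cases hij : i = j
  · rw [hij]
  · rcases lt_trichotomy (Nat.card (Quotient κ.rel) + 1) n with hc | hc | hc
    · rw [κ.of_card_lt hc i, κ.of_card_lt hc j]
    · rcases lt_or_gt_of_ne hij with hlt | hlt
      · exact (κ.of_card_add_one hc i j hlt h).2
      · exact (κ.of_card_add_one hc j i hlt (κ.rel.symm h)).2.symm
    · have h' : Nat.card (Quotient κ.rel) = n := by
        have := card_le_self κ.rel
        omega
      exact absurd ((card_eq_iff _).1 h' i j h) hij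

theorem exists_missing (σ : Fin n → Fin n) (i : Fin n) :
    ∃ j, ∀ k, k ≠ i → σ k ≠ j := by
  classical
  by_contra hcon
  push Not at hcon
  have hs : Function.Surjective (fun k : {k : Fin n // k ≠ i} => σ k.1) := by
    intro j
    obtain ⟨k, hk, hkj⟩ := hcon j
    exact ⟨⟨k, hk⟩, hkj⟩
  have h1 := Nat.card_le_card_of_surjective _ hs
  have h2 : Nat.card {k : Fin n // k ≠ i} + 1 = n := by
    rw [Nat.card_eq_fintype_card, Fintype.card_subtype_compl]
    simp
    have := i.pos
    omega
  simp only [Nat.card_eq_fintype_card, Fintype.card_fin] at h1 h2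
  omega

/-- An element `j ∉ σ[n ∖ {i}]`; it is unique if `σ` is injective on `n ∖ {i}`. -/
noncomputable def missing (σ : Fin n → Fin n) (i : Fin n) : Fin n :=
  Classical.choose (exists_missing σ i)

theorem missing_spec (σ : Fin n → Fin n) (i k : Fin n) (hk : k ≠ i) : σ k ≠ missing σ i :=
  Classical.choose_spec (exists_missing σ i) k hk

theorem missing_unique {σ : Fin n → Fin n} {i : Fin n}
    (hσ : ∀ j k, j ≠ i → k ≠ i → σ j = σ k → j = k) {l : Fin n}
    (hl : ∀ k, k ≠ i → σ k ≠ l) : l = missing σ i := by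
  classical
  have hinj : Function.Injective (fun k => if k = i then l else σ k) := by
    intro j k hjk
    by_cases hj : j = i <;> by_cases hk : k = i <;> simp only [hj, hk, if_true, if_false] at hjk ⊢
    · exact absurd hjk.symm (hl k hk)
    · exact absurd hjk (hl j hj)
    · exact hσ j k hj hk hjk
  obtain ⟨k, hk⟩ := (Finite.surjective_of_injective hinj) (missing σ i)
  by_cases hki : k = i
  · simpa [hki] using hk
  · simp only [hki, if_false] at hk
    exact absurd hk (missing_spec σ i k hki)

theorem missing_of_injective {σ : Fin n → Fin n} (hσ : Function.Injective σ) (i : Fin n) :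
    missing σ i = σ i :=
  (missing_unique (fun _ _ _ _ h => hσ h) (fun _ hk h => hk (hσ h))).symm

/-- If `∼^σ` is `i`-distinguishing then `∼` is `j`-distinguishing for the `j` with
`j ∉ σ[n ∖ {i}]`. -/
theorem isDist_missing {r : Setoid (Fin n)} {σ : Fin n → Fin n} {i : Fin n}
    (h : IsDist (r.comap σ) i) : IsDist r (missing σ i) := by
  have hσ : ∀ j k, j ≠ i → k ≠ i → σ j = σ k → j = k := by
    intro j k hj hk hjk
    by_contra hne
    exact h j k hj hk hne (by rw [Setoid.comap_rel, hjk])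
  have hex : ∀ l, l ≠ missing σ i → ∃ k, k ≠ i ∧ σ k = l := by
    intro l hl
    by_contra hcon
    push Not at hcon
    exact hl (missing_unique hσ hcon)
  intro j k hj hk hjk hr
  obtain ⟨j', hj', rfl⟩ := hex j hj
  obtain ⟨k', hk', rfl⟩ := hex k hk
  exact h j' k' hj' hk' (fun e => hjk (by rw [e])) hr

/-- The map `K^σ`: it is defined at `i` iff `∼^σ` is `i`-distinguishing, and then its value is
`K j` for the unique `j ∉ σ[n ∖ {i}]`. -/
noncomputable def Atom.substK (κ : Atom n Γ) (σ : Fin n → Fin n) (i : Fin n) :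
    Option (V × Fin n) :=
  open Classical in if IsDist (κ.rel.comap σ) i then κ.K (missing σ i) else none

theorem Atom.substK_isSome (κ : Atom n Γ) (σ : Fin n → Fin n) (i : Fin n) :
    (κ.substK σ i).isSome ↔ IsDist (κ.rel.comap σ) i := by
  unfold Atom.substK
  by_cases h : IsDist (κ.rel.comap σ) i
  · simp only [h, if_true, iff_true]
    exact (κ.isSome_iff _).2 (isDist_missing h)
  · simp [h]

/-- The atom `(K, ∼)^σ = (K^σ, ∼^σ)`, where `i ∼^σ j` iff `σ i ∼ σ j`. -/
noncomputable def Atom.subst (κ : Atom n Γ) (σ : Fin n → Fin n) : Atom n Γ where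
  K := κ.substK σ
  rel := κ.rel.comap σ
  dom_of_card h i := by
    rw [Atom.substK_isSome]
    exact fun j k _ _ hne hr => hne ((card_eq_iff _).1 h j k hr)
  not_indep_of_card h := by
    have hinj : Function.Injective σ := fun i j hij =>
      (card_eq_iff _).1 h i j (by rw [Setoid.comap_rel, hij])
    have hsurj : Function.Surjective σ := Finite.surjective_of_injective hinj
    have hdist : ∀ i, IsDist (κ.rel.comap σ) i :=
      fun i j k _ _ hne hr => hne ((card_eq_iff _).1 h j k hr)
    have hκ : Nat.card (Quotient κ.rel) = n := by
      rw [card_eq_iff]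
      intro i j hij
      obtain ⟨i', rfl⟩ := hsurj i
      obtain ⟨j', rfl⟩ := hsurj j
      rw [(card_eq_iff _).1 h i' j' hij]
    obtain ⟨i, j, p, q, hi, hj, hpq⟩ := κ.not_indep_of_card hκ
    obtain ⟨i', rfl⟩ := hsurj i
    obtain ⟨j', rfl⟩ := hsurj j
    refine ⟨i', j', p, q, ?_, ?_, hpq⟩
    · simp only [Atom.substK, hdist i', if_true, missing_of_injective hinj, hi]
    · simp only [Atom.substK, hdist j', if_true, missing_of_injective hinj, hj]
  of_card_add_one h i j hij hr := by
    have hdi : IsDist (κ.rel.comap σ) i := isDist_of_card h hij.ne hr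
    have hdj : IsDist (κ.rel.comap σ) j := isDist_of_card h hij.ne' (Setoid.symm' _ hr)
    refine ⟨fun k => ?_, ?_⟩
    · rw [Atom.substK_isSome]
      constructor
      · intro hd
        by_contra hne
        push Not at hne
        exact hd i j hne.1.symm hne.2.symm hij.ne hr
      · rintro (rfl | rfl)
        · exact hdi
        · exact hdj
    · simp only [Atom.substK, hdi, hdj, if_true]
      have hσi : ∀ k l, k ≠ i → l ≠ i → σ k = σ l → k = l := by
        intro k l hk hl hkl
        by_contra hne
        exact hdi k l hk hl hne (by rw [Setoid.comap_rel, hkl])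
      have hσj : ∀ k l, k ≠ j → l ≠ j → σ k = σ l → k = l := by
        intro k l hk hl hkl
        by_contra hne
        exact hdj k l hk hl hne (by rw [Setoid.comap_rel, hkl])
      by_cases hs : σ i = σ j
      · congr 1
        refine missing_unique hσj ?_
        intro k hk
        by_cases hki : k = i
        · rw [hki, hs]
          exact missing_spec σ i j hij.ne'
        · exact missing_spec σ i k hki
      · have hinj : Function.Injective σ := by
          intro k l hkl
          by_cases hk : k = i
          · by_cases hl : l = i
            · rw [hk, hl]
            · by_cases hlj : l = j
              · exact absurd (by rw [← hk, hkl, hlj]) hs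
              · exact hσj k l (by rw [hk]; exact hij.ne) hlj hkl
          · by_cases hl : l = i
            · by_cases hkj : k = j
              · exact absurd (by rw [← hl, ← hkl, hkj]) hs
              · exact hσj k l hkj (by rw [hl]; exact hij.ne) hkl
            · exact hσi k l hk hl hkl
        rw [missing_of_injective hinj, missing_of_injective hinj]
        exact κ.K_eq_of_rel hr
  of_card_lt h i := by
    rw [← Option.not_isSome_iff_eq_none, Atom.substK_isSome]
    intro hd
    have := card_le_of_isDist hd
    omega

end Substitution

section GraphAlgebra

variable {n : ℕ} {V : Type u} {Γ : SimpleGraph V}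

/-- The equivalence relation `≡ᵢ` on `S(Γ)`: equal values (or both undefined) at `i`, and equal
restrictions of `∼` to `n ∖ {i}`. -/
def Atom.Equiv (i : Fin n) (κ κ' : Atom n Γ) : Prop :=
  κ.K i = κ'.K i ∧ ∀ j k, j ≠ i → k ≠ i → (κ.rel j k ↔ κ'.rel j k)

/-- The operations of the polyadic equality-type algebra of subsets of `S(Γ)`. -/
def graphAlgOp : {k : ℕ} → PeaFunc n k → (Fin k → Set (Atom n Γ)) → Set (Atom n Γ)
  | _, .df (.bool f), x => setBAOp f x
  | _, .df (.cyl i), x => {κ | ∃ κ' ∈ x 0, Atom.Equiv i κ' κ}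
  | _, .diag i j, _ => {κ | κ.rel i j}
  | _, .subst σ, x => {κ | κ.subst σ ∈ x 0}

/-- The polyadic equality-type algebra `𝒜(Γ)`. -/
instance graphAlgebra : (LPea n).Structure (Set (Atom n Γ)) where
  funMap := fun f x => graphAlgOp f x
  RelMap := fun r _ => r.elim

/-- The boolean algebra of all subsets of `X`. -/
instance powersetAlgebra (X : Type u) : LBA.Structure (Set X) where
  funMap := fun f x => setBAOp f x
  RelMap := fun r _ => r.elim

/-- The element `Fᵢ = ∏ {-dⱼₖ | j < k < n, j ≠ i, k ≠ i}` of `𝒜(Γ)`. -/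
def distElement (Γ : SimpleGraph V) (i : Fin n) : Set (Atom n Γ) :=
  {κ | ∀ j k, j < k → j ≠ i → k ≠ i → ¬ κ.rel j k}

/-- The three-sorted structure `M(Γ) = (𝒜(Γ), Γ × n, ℘(Γ × n))`. -/
def graphSystem (n : ℕ) {V : Type u} (Γ : SimpleGraph V) : AGSStructure.{u} n where
  A := Set (Atom n Γ)
  G := V × Fin n
  B := Set (V × Fin n)
  edge := (copies Γ n).Adj
  same p q := p.2 = q.2
  mem p X := p ∈ X
  R i a := {p | ∃ κ ∈ distElement Γ i ∩ a, κ.K i = some p}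
  S i X := {κ | κ ∈ distElement Γ i ∧ ∃ p ∈ X, κ.K i = some p}

end GraphAlgebra

/-! ## Theories -/

/-- The theory `𝒰` of algebra-graph systems: the sentences, universal in the algebra sort, that
are true in `M(Γ)` for all graphs `Γ`. -/
def theoryU (n : ℕ) : Set (AGSSentence n) :=
  {φ | φ.IsAlgUniversal ∧ ∀ (V : Type u) (Γ : SimpleGraph V), (graphSystem n Γ).Satisfies φ}

/-- The term `0` of the boolean sort. -/
def zeroB {n a g b : ℕ} : AGSTerm n a g b .bool := .funB (k := 0) BAFunc.zero Fin.elim0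

/-- The term `1` of the boolean sort. -/
def oneB {n a g b : ℕ} : AGSTerm n a g b .bool := .funB (k := 0) BAFunc.one Fin.elim0

/-- The term `s + t` of the boolean sort. -/
def addB {n a g b : ℕ} (s t : AGSTerm n a g b .bool) : AGSTerm n a g b .bool :=
  .funB (k := 2) BAFunc.add ![s, t]

/-- The term `∑_{i < k} Bᵢ`. -/
def sumB {n a g : ℕ} (k : ℕ) : AGSTerm n a g k .bool :=
  (List.finRange k).foldr (fun i t => addB (.varB i) t) zeroB

/-- The sentence `φₘ`: there are `m` distinct elements of the boolean sort. -/
def phi (n m : ℕ) : AGSSentence n :=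
  AGSFormula.exsB (k := m) (AGSFormula.conj
    ((List.finRange m ×ˢ List.finRange m).filter (fun ij => ij.1 < ij.2) |>.map
      (fun ij => (AGSFormula.eq .bool (.varB ij.1) (.varB ij.2)).neg)))

/-- The theory `Φ`, expressing that the boolean sort is infinite. -/
def theoryPhi (n : ℕ) : Set (AGSSentence n) := Set.range (phi n)

/-- The sentence `θₖ`: whenever `B₀ + ⋯ + B_{k-1} = 1`, there are `p, q` in the graph sort with
`E(p, q)` and `p, q ∈ Bᵢ` for some `i < k`. -/
def theta (n k : ℕ) : AGSSentence n :=
  AGSFormula.allsB (k := k) ((AGSFormula.eq .bool (sumB k) oneB).imp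
    (AGSFormula.exG (AGSFormula.exG ((AGSFormula.edge (.varG 0) (.varG 1)).and
      (AGSFormula.disj ((List.finRange k).map (fun i =>
        (AGSFormula.mem (.varG 0) (.varB i)).and (AGSFormula.mem (.varG 1) (.varB i)))))))))

/-- The theory `Θ`: the graph has infinite chromatic number in the sense of the boolean sort. -/
def theoryTheta (n : ℕ) : Set (AGSSentence n) := Set.range (theta n)

/-! First-order formulas about polyadic equality-type or diagonal-free algebras, regarded as
formulas about the algebra sort. -/

/-- A term of the signature of polyadic equality algebras as a term of the algebra sort. -/
def termToAGS {n k : ℕ} : (LPea n).Term (Empty ⊕ Fin k) → AGSTerm n k 0 0 .alg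
  | .var (Sum.inl e) => e.elim
  | .var (Sum.inr i) => .varA i
  | .func f ts => .funA f (fun l => termToAGS (ts l))

/-- A formula of the signature of polyadic equality algebras as one about the algebra sort. -/
def formulaToAGS {n : ℕ} : {k : ℕ} → (LPea n).BoundedFormula Empty k → AGSFormula n k 0 0
  | _, .falsum => .bot
  | _, .equal t₁ t₂ => .eq .alg (termToAGS t₁) (termToAGS t₂)
  | _, .rel r _ => Empty.elim r
  | _, .imp φ ψ => .imp (formulaToAGS φ) (formulaToAGS ψ)
  | _, .all φ => .allA (formulaToAGS φ)

/-- A theory of polyadic equality algebras regarded as a theory about the algebra sort. -/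
def peaTheoryToAGS {n : ℕ} (T : (LPea n).Theory) : Set (AGSSentence n) :=
  (fun φ : (LPea n).Sentence => formulaToAGS φ) '' T

/-- A theory of diagonal-free algebras regarded as a theory about the algebra sort. -/
def dfTheoryToAGS {n : ℕ} (T : (LDf n).Theory) : Set (AGSSentence n) :=
  peaTheoryToAGS ((dfToPea n).onTheory T)

end AlgGraph

universe u v

/-! Only a universal prefix of algebra variables is available, so every fact about `M` is obtained
from all the `M(Γ)` by `transfer`. The facts that carry the proof: each `S i` embeds the boolean
sort into the algebra; an independent `B` gives `∏ S i B = 0`, while nodes `p i ∈ B i` that span an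
edge give `∏ S i (B i) ≠ 0`; below `d_ij` an element is determined by its `i`-cylindrification.

Representability forces infinite chromatic number. A fixed string of cylindrifications carries every
nonzero element to 1, so a representation in a product can be cut down to one factor
(`exists_isDfRep`). There the diagonals are merely relations between different bases, but they yield
a set `Q` of points on which `d_ij` means equality (`exists_points`). A finite `Q` would leave only
finitely many candidates for `S 0 B`, so `Q` is infinite. Finitely many independent `D j` covering
the graph would colour the tuples of `n - 1` distinct points. By Ramsey's theorem, in the form of
iterated ultrafilters, some `n`-tuple has all its facets of one colour `D j`, and it would lie in
the image of `∏ S i (D j) = 0`.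

Infinite chromatic number gives representability. An ultrafilter `s` of the algebra behaves like an
atom `(K, ∼)`: it has an equality type, and at each distinguished `i` a colour `{B | S i B ∈ s}`, an
ultrafilter of the boolean sort. Agreement of the colour at `i` and of the type off `i` governs
`cᵢ`, and any colours of which two are joined by edges come from an ultrafilter. The chromatic
hypothesis passes to each of the `n` copies, so each carries a wild colour, all of whose elements
contain edges.

A representation is then a set of points with a coherent labelling of the `n`-tuples by
ultrafilters. The points are formal solutions of one-point extension requests, all adjoined at once.
Labels are found by first colouring the sets of `n - 1` points (`Frame.bd`): the colour is forced if
a request prescribes it, and otherwise wild, on a copy avoided by all forced colours with the same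
youngest point. A point forces colours on only `n - 1` facets through it, and there are `n` copies,
so such a copy exists (`Frame.exists_freeCopy`); hence every injective tuple of valid points has a
label (`Frame.exists_adm`). The extension property `Frame.IsLabelling.exists_update` takes care of
the cylindrifications. -/

namespace AlgGraph

universe w

/-! ## Operations of a three-sorted structure and the corresponding terms -/

namespace AGSStructure

variable {n : ℕ} (M : AGSStructure.{w} n)

def zero : M.A := FirstOrder.Language.Structure.funMap (L := LPea n) (n := 0) (.df (.bool .zero)) ![]

def one : M.A := FirstOrder.Language.Structure.funMap (L := LPea n) (n := 0) (.df (.bool .one)) ![]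

def add (a b : M.A) : M.A :=
  FirstOrder.Language.Structure.funMap (L := LPea n) (n := 2) (.df (.bool .add)) ![a, b]

def neg (a : M.A) : M.A :=
  FirstOrder.Language.Structure.funMap (L := LPea n) (n := 1) (.df (.bool .neg)) ![a]

def cyl (i : Fin n) (a : M.A) : M.A :=
  FirstOrder.Language.Structure.funMap (L := LPea n) (n := 1) (.df (.cyl i)) ![a]

def diag (i j : Fin n) : M.A :=
  FirstOrder.Language.Structure.funMap (L := LPea n) (n := 0) (.diag i j) ![]

def subst (σ : Fin n → Fin n) (a : M.A) : M.A :=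
  FirstOrder.Language.Structure.funMap (L := LPea n) (n := 1) (.subst σ) ![a]

def mul (a b : M.A) : M.A := M.neg (M.add (M.neg a) (M.neg b))

/-- The product of a list-indexed family of elements of the algebra sort. -/
def prod {ι : Type} (l : List ι) (f : ι → M.A) : M.A := l.foldr (fun i a => M.mul (f i) a) M.one

/-- Cylindrification along a list of coordinates. -/
def cyls (l : List (Fin n)) (a : M.A) : M.A := l.foldr M.cyl a

def bzero : M.B := FirstOrder.Language.Structure.funMap (L := LBA) (n := 0) BAFunc.zero ![]

def bone : M.B := FirstOrder.Language.Structure.funMap (L := LBA) (n := 0) BAFunc.one ![]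

def badd (a b : M.B) : M.B :=
  FirstOrder.Language.Structure.funMap (L := LBA) (n := 2) BAFunc.add ![a, b]

def bneg (a : M.B) : M.B :=
  FirstOrder.Language.Structure.funMap (L := LBA) (n := 1) BAFunc.neg ![a]

end AGSStructure

namespace AGSTerm

variable {n a g b : ℕ}

def zero : AGSTerm n a g b .alg := .funA (k := 0) (.df (.bool .zero)) ![]

def one : AGSTerm n a g b .alg := .funA (k := 0) (.df (.bool .one)) ![]

def add (s t : AGSTerm n a g b .alg) : AGSTerm n a g b .alg :=
  .funA (k := 2) (.df (.bool .add)) ![s, t]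

def neg (t : AGSTerm n a g b .alg) : AGSTerm n a g b .alg :=
  .funA (k := 1) (.df (.bool .neg)) ![t]

def cyl (i : Fin n) (t : AGSTerm n a g b .alg) : AGSTerm n a g b .alg :=
  .funA (k := 1) (.df (.cyl i)) ![t]

def diag (i j : Fin n) : AGSTerm n a g b .alg := .funA (k := 0) (.diag i j) ![]

def subst (σ : Fin n → Fin n) (t : AGSTerm n a g b .alg) : AGSTerm n a g b .alg :=
  .funA (k := 1) (.subst σ) ![t]

def mul (s t : AGSTerm n a g b .alg) : AGSTerm n a g b .alg := neg (add (neg s) (neg t))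

def prod {ι : Type} (l : List ι) (f : ι → AGSTerm n a g b .alg) : AGSTerm n a g b .alg :=
  l.foldr (fun i t => mul (f i) t) one

def cyls (l : List (Fin n)) (t : AGSTerm n a g b .alg) : AGSTerm n a g b .alg := l.foldr cyl t

def bneg (t : AGSTerm n a g b .bool) : AGSTerm n a g b .bool := .funB (k := 1) BAFunc.neg ![t]

variable (M : AGSStructure.{w} n) (x : Fin a → M.A) (p : Fin g → M.G) (y : Fin b → M.B)

@[simp] theorem realize_varA (i : Fin a) :
    (varA i : AGSTerm n a g b .alg).realize M x p y = x i := rfl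

@[simp] theorem realize_varG (i : Fin g) :
    (varG i : AGSTerm n a g b .graph).realize M x p y = p i := rfl

@[simp] theorem realize_varB (i : Fin b) :
    (varB i : AGSTerm n a g b .bool).realize M x p y = y i := rfl

@[simp] theorem realize_R (i : Fin n) (t : AGSTerm n a g b .alg) :
    (R i t).realize M x p y = M.R i (t.realize M x p y) := rfl

@[simp] theorem realize_S (i : Fin n) (t : AGSTerm n a g b .bool) :
    (S i t).realize M x p y = M.S i (t.realize M x p y) := rfl

@[simp] theorem realize_zero : (zero : AGSTerm n a g b .alg).realize M x p y = M.zero :=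
  congrArg (FirstOrder.Language.Structure.funMap (L := LPea n) (M := M.A) _) (Subsingleton.elim _ _)

@[simp] theorem realize_one : (one : AGSTerm n a g b .alg).realize M x p y = M.one :=
  congrArg (FirstOrder.Language.Structure.funMap (L := LPea n) (M := M.A) _) (Subsingleton.elim _ _)

@[simp] theorem realize_diag (i j : Fin n) :
    (diag i j : AGSTerm n a g b .alg).realize M x p y = M.diag i j :=
  congrArg (FirstOrder.Language.Structure.funMap (L := LPea n) (M := M.A) _) (Subsingleton.elim _ _)

@[simp] theorem realize_add (s t : AGSTerm n a g b .alg) :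
    (add s t).realize M x p y = M.add (s.realize M x p y) (t.realize M x p y) :=
  congrArg (FirstOrder.Language.Structure.funMap (L := LPea n) (M := M.A) _)
    (funext fun k => by fin_cases k <;> rfl)

@[simp] theorem realize_neg (t : AGSTerm n a g b .alg) :
    (neg t).realize M x p y = M.neg (t.realize M x p y) :=
  congrArg (FirstOrder.Language.Structure.funMap (L := LPea n) (M := M.A) _)
    (funext fun k => by fin_cases k; rfl)

@[simp] theorem realize_cyl (i : Fin n) (t : AGSTerm n a g b .alg) :
    (cyl i t).realize M x p y = M.cyl i (t.realize M x p y) :=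
  congrArg (FirstOrder.Language.Structure.funMap (L := LPea n) (M := M.A) _)
    (funext fun k => by fin_cases k; rfl)

@[simp] theorem realize_subst (σ : Fin n → Fin n) (t : AGSTerm n a g b .alg) :
    (subst σ t).realize M x p y = M.subst σ (t.realize M x p y) :=
  congrArg (FirstOrder.Language.Structure.funMap (L := LPea n) (M := M.A) _)
    (funext fun k => by fin_cases k; rfl)

@[simp] theorem realize_mul (s t : AGSTerm n a g b .alg) :
    (mul s t).realize M x p y = M.mul (s.realize M x p y) (t.realize M x p y) := by
  simp only [mul, realize_neg, realize_add]
  rfl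

@[simp] theorem realize_prod {ι : Type} (l : List ι) (f : ι → AGSTerm n a g b .alg) :
    (prod l f).realize M x p y = M.prod l fun i => (f i).realize M x p y := by
  induction l with
  | nil => exact realize_one M x p y
  | cons i l ih => exact (realize_mul M x p y (f i) (prod l f)).trans (by rw [ih]; rfl)

@[simp] theorem realize_cyls (l : List (Fin n)) (t : AGSTerm n a g b .alg) :
    (cyls l t).realize M x p y = M.cyls l (t.realize M x p y) := by
  induction l with
  | nil => rfl
  | cons i l ih => exact (realize_cyl M x p y i (cyls l t)).trans (by rw [ih]; rfl)

@[simp] theorem realize_zeroB : (zeroB : AGSTerm n a g b .bool).realize M x p y = M.bzero :=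
  congrArg (FirstOrder.Language.Structure.funMap (L := LBA) (M := M.B) _) (Subsingleton.elim _ _)

@[simp] theorem realize_oneB : (oneB : AGSTerm n a g b .bool).realize M x p y = M.bone :=
  congrArg (FirstOrder.Language.Structure.funMap (L := LBA) (M := M.B) _) (Subsingleton.elim _ _)

@[simp] theorem realize_addB (s t : AGSTerm n a g b .bool) :
    (addB s t).realize M x p y = M.badd (s.realize M x p y) (t.realize M x p y) :=
  congrArg (FirstOrder.Language.Structure.funMap (L := LBA) (M := M.B) _)
    (funext fun k => by fin_cases k <;> rfl)

@[simp] theorem realize_bneg (t : AGSTerm n a g b .bool) :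
    (bneg t).realize M x p y = M.bneg (t.realize M x p y) :=
  congrArg (FirstOrder.Language.Structure.funMap (L := LBA) (M := M.B) _)
    (funext fun k => by fin_cases k; rfl)

@[simp] theorem realize_sumB (k : ℕ) (y : Fin k → M.B) :
    (sumB k : AGSTerm n a g k .bool).realize M x p y =
      (List.finRange k).foldr (fun i t => M.badd (y i) t) M.bzero := by
  unfold sumB
  induction List.finRange k with
  | nil => exact realize_zeroB M x p y
  | cons i l ih =>
    simp only [List.foldr_cons, realize_addB, realize_varB, ih]
    rfl

end AGSTerm

/-! ## Satisfaction of formulas -/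

namespace AGSFormula

variable {n a g b : ℕ} (M : AGSStructure.{w} n)
variable (x : Fin a → M.A) (p : Fin g → M.G) (y : Fin b → M.B)

@[simp] theorem realize_bot : (bot : AGSFormula n a g b).Realize M x p y ↔ False := Iff.rfl

@[simp] theorem realize_eq_alg (t₁ t₂ : AGSTerm n a g b .alg) :
    (eq .alg t₁ t₂).Realize M x p y ↔ @Eq M.A (t₁.realize M x p y) (t₂.realize M x p y) := Iff.rfl

@[simp] theorem realize_eq_bool (t₁ t₂ : AGSTerm n a g b .bool) :
    (eq .bool t₁ t₂).Realize M x p y ↔ @Eq M.B (t₁.realize M x p y) (t₂.realize M x p y) := Iff.rfl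

@[simp] theorem realize_edge (t₁ t₂ : AGSTerm n a g b .graph) :
    (edge t₁ t₂).Realize M x p y ↔ M.edge (t₁.realize M x p y) (t₂.realize M x p y) := Iff.rfl

@[simp] theorem realize_same (t₁ t₂ : AGSTerm n a g b .graph) :
    (same t₁ t₂).Realize M x p y ↔ M.same (t₁.realize M x p y) (t₂.realize M x p y) := Iff.rfl

@[simp] theorem realize_mem (t₁ : AGSTerm n a g b .graph) (t₂ : AGSTerm n a g b .bool) :
    (mem t₁ t₂).Realize M x p y ↔ M.mem (t₁.realize M x p y) (t₂.realize M x p y) := Iff.rfl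

@[simp] theorem realize_imp (φ ψ : AGSFormula n a g b) :
    (imp φ ψ).Realize M x p y ↔ (φ.Realize M x p y → ψ.Realize M x p y) := Iff.rfl

@[simp] theorem realize_allG (φ : AGSFormula n a (g + 1) b) :
    (allG φ).Realize M x p y ↔ ∀ q : M.G, φ.Realize M x (Fin.snoc (α := fun _ => M.G) p q) y :=
  Iff.rfl

@[simp] theorem realize_allB (φ : AGSFormula n a g (b + 1)) :
    (allB φ).Realize M x p y ↔ ∀ z : M.B, φ.Realize M x p (Fin.snoc (α := fun _ => M.B) y z) :=
  Iff.rfl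

@[simp] theorem realize_neg (φ : AGSFormula n a g b) :
    φ.neg.Realize M x p y ↔ ¬ φ.Realize M x p y := Iff.rfl

@[simp] theorem realize_and (φ ψ : AGSFormula n a g b) :
    (φ.and ψ).Realize M x p y ↔ φ.Realize M x p y ∧ ψ.Realize M x p y := by
  simp [AGSFormula.and]

@[simp] theorem realize_or (φ ψ : AGSFormula n a g b) :
    (φ.or ψ).Realize M x p y ↔ φ.Realize M x p y ∨ ψ.Realize M x p y := by
  simp [AGSFormula.or, or_iff_not_imp_left]

@[simp] theorem realize_exG (φ : AGSFormula n a (g + 1) b) :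
    (exG φ).Realize M x p y ↔ ∃ q : M.G, φ.Realize M x (Fin.snoc (α := fun _ => M.G) p q) y := by
  simp [exG]

@[simp] theorem realize_exB (φ : AGSFormula n a g (b + 1)) :
    (exB φ).Realize M x p y ↔ ∃ z : M.B, φ.Realize M x p (Fin.snoc (α := fun _ => M.B) y z) := by
  simp [exB]

@[simp] theorem realize_conj (l : List (AGSFormula n a g b)) :
    (conj l).Realize M x p y ↔ ∀ φ ∈ l, φ.Realize M x p y := by
  induction l with
  | nil => simp [conj]
  | cons φ l ih =>
    rw [List.forall_mem_cons, ← ih]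
    exact realize_and M x p y φ (conj l)

@[simp] theorem realize_disj (l : List (AGSFormula n a g b)) :
    (disj l).Realize M x p y ↔ ∃ φ ∈ l, φ.Realize M x p y := by
  induction l with
  | nil => simp [disj]
  | cons φ l ih =>
    rw [List.exists_mem_cons_iff, ← ih]
    exact realize_or M x p y φ (disj l)

theorem realize_conj_map {ι : Type} (l : List ι) (f : ι → AGSFormula n a g b) :
    (conj (l.map f)).Realize M x p y ↔ ∀ i ∈ l, (f i).Realize M x p y := by
  rw [realize_conj, List.forall_mem_map]

theorem realize_disj_map {ι : Type} (l : List ι) (f : ι → AGSFormula n a g b) :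
    (disj (l.map f)).Realize M x p y ↔ ∃ i ∈ l, (f i).Realize M x p y := by
  simp

/-- Universal quantification over all the variables of the algebra sort. -/
def allsA : {k : ℕ} → AGSFormula n k g b → AGSFormula n 0 g b
  | 0, φ => φ
  | _ + 1, φ => allsA φ.allA

/-- Universal quantification over all the variables of the graph sort. -/
def allsG : {k : ℕ} → AGSFormula n a k b → AGSFormula n a 0 b
  | 0, φ => φ
  | _ + 1, φ => allsG φ.allG

theorem forall_snoc_iff {α : Type*} {k : ℕ} (P : (Fin (k + 1) → α) → Prop) :
    (∀ y, ∀ z, P (Fin.snoc (α := fun _ => α) y z)) ↔ ∀ y, P y :=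
  ⟨fun h y => by simpa using h (Fin.init y) (y (Fin.last k)), fun h _ _ => h _⟩

theorem exists_snoc_iff {α : Type*} {k : ℕ} (P : (Fin (k + 1) → α) → Prop) :
    (∃ y, ∃ z, P (Fin.snoc (α := fun _ => α) y z)) ↔ ∃ y, P y := by
  have := forall_snoc_iff fun y => ¬ P y
  rw [← not_iff_not]
  simpa using this

theorem realize_allsA (p : Fin g → M.G) (y : Fin b → M.B) (x₀ : Fin 0 → M.A) :
    ∀ {k : ℕ} (φ : AGSFormula n k g b), φ.allsA.Realize M x₀ p y ↔ ∀ x, φ.Realize M x p y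
  | 0, φ => ⟨fun h x => by rwa [Subsingleton.elim x x₀], fun h => h x₀⟩
  | _ + 1, φ => (realize_allsA p y x₀ φ.allA).trans (forall_snoc_iff fun x => φ.Realize M x p y)

theorem realize_allsG (x : Fin a → M.A) (y : Fin b → M.B) (p₀ : Fin 0 → M.G) :
    ∀ {k : ℕ} (φ : AGSFormula n a k b), φ.allsG.Realize M x p₀ y ↔ ∀ p, φ.Realize M x p y
  | 0, φ => ⟨fun h x => by rwa [Subsingleton.elim x p₀], fun h => h p₀⟩
  | _ + 1, φ => (realize_allsG x y p₀ φ.allG).trans (forall_snoc_iff fun p => φ.Realize M x p y)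

@[simp] theorem realize_allsB (x : Fin a → M.A) (p : Fin g → M.G) (y₀ : Fin 0 → M.B) :
    ∀ {k : ℕ} (φ : AGSFormula n a g k), φ.allsB.Realize M x p y₀ ↔ ∀ y, φ.Realize M x p y
  | 0, φ => ⟨fun h x => by rwa [Subsingleton.elim x y₀], fun h => h y₀⟩
  | _ + 1, φ => (realize_allsB x p y₀ φ.allB).trans (forall_snoc_iff fun y => φ.Realize M x p y)

@[simp] theorem realize_exsB (x : Fin a → M.A) (p : Fin g → M.G) (y₀ : Fin 0 → M.B) :
    ∀ {k : ℕ} (φ : AGSFormula n a g k), φ.exsB.Realize M x p y₀ ↔ ∃ y, φ.Realize M x p y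
  | 0, φ => ⟨fun h => ⟨_, h⟩, fun ⟨y, h⟩ => by rwa [Subsingleton.elim y₀ y]⟩
  | _ + 1, φ => (realize_exsB x p y₀ φ.exB).trans (by
      simp only [realize_exB]
      exact exists_snoc_iff fun y => φ.Realize M x p y)

@[simp] theorem noAlg_bot : (bot : AGSFormula n a g b).NoAlgQuantifier := trivial

@[simp] theorem noAlg_eq (s : AGSSort) (t₁ t₂ : AGSTerm n a g b s) :
    (eq s t₁ t₂).NoAlgQuantifier := trivial

@[simp] theorem noAlg_edge (t₁ t₂ : AGSTerm n a g b .graph) :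
    (edge t₁ t₂).NoAlgQuantifier := trivial

@[simp] theorem noAlg_same (t₁ t₂ : AGSTerm n a g b .graph) :
    (same t₁ t₂).NoAlgQuantifier := trivial

@[simp] theorem noAlg_mem (t₁ : AGSTerm n a g b .graph) (t₂ : AGSTerm n a g b .bool) :
    (mem t₁ t₂).NoAlgQuantifier := trivial

@[simp] theorem noAlg_imp (φ ψ : AGSFormula n a g b) :
    (imp φ ψ).NoAlgQuantifier ↔ φ.NoAlgQuantifier ∧ ψ.NoAlgQuantifier := Iff.rfl

@[simp] theorem noAlg_allG (φ : AGSFormula n a (g + 1) b) :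
    (allG φ).NoAlgQuantifier ↔ φ.NoAlgQuantifier := Iff.rfl

@[simp] theorem noAlg_allB (φ : AGSFormula n a g (b + 1)) :
    (allB φ).NoAlgQuantifier ↔ φ.NoAlgQuantifier := Iff.rfl

@[simp] theorem noAlg_neg (φ : AGSFormula n a g b) :
    φ.neg.NoAlgQuantifier ↔ φ.NoAlgQuantifier := by simp [AGSFormula.neg]

@[simp] theorem noAlg_and (φ ψ : AGSFormula n a g b) :
    (φ.and ψ).NoAlgQuantifier ↔ φ.NoAlgQuantifier ∧ ψ.NoAlgQuantifier := by simp [AGSFormula.and]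

@[simp] theorem noAlg_or (φ ψ : AGSFormula n a g b) :
    (φ.or ψ).NoAlgQuantifier ↔ φ.NoAlgQuantifier ∧ ψ.NoAlgQuantifier := by simp [AGSFormula.or]

@[simp] theorem noAlg_exG (φ : AGSFormula n a (g + 1) b) :
    φ.exG.NoAlgQuantifier ↔ φ.NoAlgQuantifier := by simp [exG]

@[simp] theorem noAlg_exB (φ : AGSFormula n a g (b + 1)) :
    φ.exB.NoAlgQuantifier ↔ φ.NoAlgQuantifier := by simp [exB]

@[simp] theorem noAlg_conj (l : List (AGSFormula n a g b)) :
    (conj l).NoAlgQuantifier ↔ ∀ φ ∈ l, φ.NoAlgQuantifier := by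
  induction l with
  | nil => simp [conj]
  | cons φ l ih =>
    rw [List.forall_mem_cons, ← ih]
    exact noAlg_and φ (conj l)

@[simp] theorem noAlg_disj (l : List (AGSFormula n a g b)) :
    (disj l).NoAlgQuantifier ↔ ∀ φ ∈ l, φ.NoAlgQuantifier := by
  induction l with
  | nil => simp [disj]
  | cons φ l ih =>
    rw [List.forall_mem_cons, ← ih]
    exact noAlg_or φ (disj l)

@[simp] theorem noAlg_allsG : ∀ {k : ℕ} (φ : AGSFormula n a k b),
    φ.allsG.NoAlgQuantifier ↔ φ.NoAlgQuantifier
  | 0, _ => Iff.rfl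
  | _ + 1, φ => noAlg_allsG φ.allG

@[simp] theorem noAlg_allsB : ∀ {k : ℕ} (φ : AGSFormula n a g k),
    φ.allsB.NoAlgQuantifier ↔ φ.NoAlgQuantifier
  | 0, _ => Iff.rfl
  | _ + 1, φ => noAlg_allsB φ.allB

@[simp] theorem noAlg_exsB : ∀ {k : ℕ} (φ : AGSFormula n a g k),
    φ.exsB.NoAlgQuantifier ↔ φ.NoAlgQuantifier
  | 0, _ => Iff.rfl
  | _ + 1, φ => (noAlg_exsB φ.exB).trans (noAlg_exB φ)

theorem isAlgUniversal_allsA : ∀ {k : ℕ} {φ : AGSFormula n k g b},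
    φ.IsAlgUniversal → φ.allsA.IsAlgUniversal
  | 0, _, h => h
  | _ + 1, φ, h => isAlgUniversal_allsA (φ := φ.allA) (.allA h)

/-- The order of the three closures matters: the algebra variables end up outermost, as an
`𝒜`-universal sentence requires. -/
theorem satisfies_closure (φ : AGSFormula n a g b) :
    M.Satisfies φ.allsB.allsG.allsA ↔ ∀ x p y, φ.Realize M x p y := by
  simp only [AGSStructure.Satisfies, realize_allsA, realize_allsG, realize_allsB]

end AGSFormula

/-- A formula without quantifiers over the algebra sort that is satisfied by all assignments in
all the structures `M(Γ)` is satisfied by all assignments in the models of `𝒰`. -/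
theorem transfer {n a g b : ℕ} {M : AGSStructure.{v} n} (hM : M.Models (theoryU.{u} n))
    (φ : AGSFormula n a g b) (hφ : φ.NoAlgQuantifier)
    (h : ∀ (V : Type u) (Γ : SimpleGraph V) x p y, φ.Realize (graphSystem n Γ) x p y)
    (x : Fin a → M.A) (p : Fin g → M.G) (y : Fin b → M.B) : φ.Realize M x p y := by
  exact (φ.satisfies_closure M).1 (hM _ ⟨AGSFormula.isAlgUniversal_allsA
    (.of_noAlgQuantifier (by simpa using hφ)), fun V Γ =>
      (φ.satisfies_closure _).2 (h V Γ)⟩) x p y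

end AlgGraph

namespace AlgGraph

universe w

/-! ## Atoms -/

section Atoms

variable {n : ℕ} {V : Type u} {Γ : SimpleGraph V}

theorem isDist_congr {r s : Setoid (Fin n)} {i : Fin n}
    (h : ∀ j k, j ≠ i → k ≠ i → (r j k ↔ s j k)) : IsDist r i ↔ IsDist s i :=
  forall_congr' fun j => forall_congr' fun k => forall_congr' fun hj => forall_congr' fun hk => by
    rw [h j k hj hk]

/-- If `j ≠ k` are equivalent, the relation can only be `i`-distinguishing for `i = j, k`. -/
theorem IsDist.eq_or_eq {r : Setoid (Fin n)} {i j k : Fin n} (h : IsDist r i) (hjk : j ≠ k)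
    (hr : r j k) : i = j ∨ i = k := by
  by_contra hne
  push Not at hne
  exact h j k hne.1.symm hne.2.symm hjk hr

/-- A map with `i`-distinguishing kernel is injective off `i`. -/
theorem injOn_of_isDist {r : Setoid (Fin n)} {σ : Fin n → Fin n} {i : Fin n}
    (h : IsDist (r.comap σ) i) (j k : Fin n) (hj : j ≠ i) (hk : k ≠ i) (hjk : σ j = σ k) :
    j = k := by
  by_contra hne
  exact h j k hj hk hne (by rw [Setoid.comap_rel, hjk])

theorem missing_id (i : Fin n) : missing id i = i :=
  missing_of_injective Function.injective_id i

theorem missing_comp {σ τ : Fin n → Fin n} {i : Fin n}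
    (h : ∀ j k, j ≠ i → k ≠ i → σ (τ j) = σ (τ k) → j = k) :
    missing σ (missing τ i) = missing (σ ∘ τ) i :=
  missing_unique h fun k hk => missing_spec σ _ _ (missing_spec τ i k hk)

theorem missing_update_id (i j : Fin n) : missing (Function.update id i j) i = i :=
  (missing_unique (fun k l hk hl => by simp [hk, hl]) fun k hk => by simp [hk]).symm

theorem Atom.isDist_of_K {κ : Atom n Γ} {i : Fin n} {p : V × Fin n} (h : κ.K i = some p) :
    IsDist κ.rel i := (κ.isSome_iff i).1 (by simp [h])

theorem Atom.K_eq_none {κ : Atom n Γ} {i : Fin n} (h : ¬ IsDist κ.rel i) : κ.K i = none := by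
  rw [← κ.isSome_iff i] at h
  simpa using h

theorem Atom.exists_K {κ : Atom n Γ} {i : Fin n} (h : IsDist κ.rel i) : ∃ p, κ.K i = some p :=
  Option.isSome_iff_exists.1 ((κ.isSome_iff i).2 h)

theorem Atom.Equiv.refl (i : Fin n) (κ : Atom n Γ) : Atom.Equiv i κ κ :=
  ⟨rfl, fun _ _ _ _ => Iff.rfl⟩

theorem Atom.Equiv.trans {i : Fin n} {κ κ' κ'' : Atom n Γ} (h : Atom.Equiv i κ κ')
    (h' : Atom.Equiv i κ' κ'') : Atom.Equiv i κ κ'' :=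
  ⟨h.1.trans h'.1, fun j k hj hk => (h.2 j k hj hk).trans (h'.2 j k hj hk)⟩

theorem Atom.Equiv.symm {i : Fin n} {κ κ' : Atom n Γ} (h : Atom.Equiv i κ κ') :
    Atom.Equiv i κ' κ :=
  ⟨h.1.symm, fun j k hj hk => (h.2 j k hj hk).symm⟩

theorem mem_distElement {i : Fin n} {κ : Atom n Γ} : κ ∈ distElement Γ i ↔ IsDist κ.rel i := by
  refine ⟨fun h j k hj hk hjk hr => ?_, fun h j k hjk hj hk => h j k hj hk hjk.ne⟩
  rcases lt_or_gt_of_ne hjk with hlt | hlt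
  · exact h j k hlt hj hk hr
  · exact h k j hlt hk hj (κ.rel.symm hr)

/-- The substitution that sends `i` to `j` and fixes the rest misses `i` off `i`, so it keeps the
node at `i`. It is the standard witness that `i` can be made equal to `j` within an `≡ᵢ`-class. -/
theorem Atom.subst_update_equiv (κ : Atom n Γ) (i j : Fin n) :
    Atom.Equiv i (κ.subst (Function.update id i j)) κ := by
  have hrel : ∀ k l, k ≠ i → l ≠ i →
      ((κ.rel.comap (Function.update id i j)) k l ↔ κ.rel k l) := by
    intro k l hk hl
    simp [Setoid.comap_rel, hk, hl]
  refine ⟨?_, hrel⟩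
  change κ.substK _ i = _
  by_cases h : IsDist κ.rel i
  · rw [Atom.substK, if_pos ((isDist_congr hrel).2 h), missing_update_id i j]
  · rw [Atom.substK, if_neg (fun h' => h ((isDist_congr hrel).1 h')), Atom.K_eq_none h]

theorem Atom.subst_update_rel (κ : Atom n Γ) {i : Fin n} (j k : Fin n) (hk : k ≠ i) :
    (κ.subst (Function.update id i j)).rel i k ↔ κ.rel j k := by
  change (κ.rel.comap _) i k ↔ _
  simp [Setoid.comap_rel, hk]

/-- If `i ∼ j`, then `∼` is recovered from its restriction off `i`, and `K` is defined at most at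
`i` and `j`, with equal values. -/
theorem Atom.eq_of_equiv {κ κ' : Atom n Γ} {i j : Fin n} (hij : i ≠ j) (h : κ.rel i j)
    (h' : κ'.rel i j) (he : Atom.Equiv i κ κ') : κ = κ' := by
  have hrel : κ.rel = κ'.rel := by
    have hred : ∀ (r : Setoid (Fin n)), r i j → ∀ k l,
        (r k l ↔ r (if k = i then j else k) (if l = i then j else l)) := by
      intro r hr k l
      by_cases hk : k = i <;> by_cases hl : l = i <;> simp only [hk, hl, if_true, if_false]
      · exact ⟨fun _ => r.refl _, fun _ => r.refl _⟩
      · exact ⟨fun h => r.trans (r.symm hr) h, fun h => r.trans hr h⟩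
      · exact ⟨fun h => r.trans h hr, fun h => r.trans h (r.symm hr)⟩
    ext k l
    rw [hred κ.rel h, hred κ'.rel h']
    exact he.2 _ _ (by split_ifs with hk; exacts [hij.symm, hk])
      (by split_ifs with hk; exacts [hij.symm, hk])
  refine Atom.ext (funext fun k => ?_) hrel
  by_cases hk : IsDist κ.rel k
  · rcases hk.eq_or_eq hij h with rfl | rfl
    · exact he.1
    · rw [← κ.K_eq_of_rel h, ← κ'.K_eq_of_rel h', he.1]
  · rw [Atom.K_eq_none hk, Atom.K_eq_none (hrel ▸ hk)]

theorem Atom.subst_id (κ : Atom n Γ) : κ.subst id = κ := by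
  refine Atom.ext (funext fun i => ?_) rfl
  change κ.substK id i = _
  by_cases h : IsDist κ.rel i
  · rw [Atom.substK, if_pos (by exact h), missing_id]
  · rw [Atom.substK, if_neg (by exact h), Atom.K_eq_none h]

theorem Atom.subst_subst (κ : Atom n Γ) (σ τ : Fin n → Fin n) :
    (κ.subst σ).subst τ = κ.subst (σ ∘ τ) := by
  refine Atom.ext (funext fun i => ?_) rfl
  change (κ.subst σ).substK τ i = κ.substK (σ ∘ τ) i
  by_cases h : IsDist (κ.rel.comap (σ ∘ τ)) i
  · have h' : IsDist ((κ.rel.comap σ).comap τ) i := h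
    rw [Atom.substK, if_pos (by exact h), Atom.substK, if_pos h]
    change κ.substK σ _ = _
    rw [Atom.substK, if_pos (isDist_missing h'), missing_comp]
    exact injOn_of_isDist h
  · rw [Atom.substK, if_neg (by exact h), Atom.substK, if_neg h]

theorem Atom.K_subst_eq_some {κ : Atom n Γ} {σ : Fin n → Fin n} {i : Fin n} {p : V × Fin n} :
    (κ.subst σ).K i = some p ↔ IsDist (κ.rel.comap σ) i ∧ κ.K (missing σ i) = some p := by
  change κ.substK σ i = _ ↔ _
  unfold Atom.substK
  split_ifs with h <;> simp [h]

/-- The atom with distinct coordinates given by a non-independent sequence of nodes. -/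
def Atom.ofNodes (c : Fin n → V × Fin n) (hc : ∃ i j, (copies Γ n).Adj (c i) (c j)) :
    Atom n Γ where
  K i := some (c i)
  rel := ⊥
  dom_of_card _ _ := rfl
  not_indep_of_card _ := by
    obtain ⟨i, j, h⟩ := hc
    exact ⟨i, j, _, _, rfl, rfl, h⟩
  of_card_add_one h := by
    have : Nat.card (Quotient (⊥ : Setoid (Fin n))) = n := (card_eq_iff _).2 fun _ _ h => h
    omega
  of_card_lt h := by
    have : Nat.card (Quotient (⊥ : Setoid (Fin n))) = n := (card_eq_iff _).2 fun _ _ h => h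
    omega

/-- One class is fewer than `n - 1` because `n ≥ 3`, so `K` is empty. This single atom is the hub
through which all atoms are connected. -/
theorem Atom.ext_of_rel_eq_top (hn : 3 ≤ n) {κ κ' : Atom n Γ} (h : ∀ i j, κ.rel i j)
    (h' : ∀ i j, κ'.rel i j) : κ = κ' := by
  have key : ∀ (r : Setoid (Fin n)), (∀ i j, r i j) → Nat.card (Quotient r) + 1 < n := by
    intro r hr
    have : Subsingleton (Quotient r) :=
      ⟨fun a b => Quotient.inductionOn₂ a b fun i j => Quotient.sound (hr i j)⟩
    have := Finite.card_le_one_iff_subsingleton (α := Quotient r) |>.2 this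
    omega
  refine Atom.ext (funext fun i => ?_) (Setoid.ext fun i j => iff_of_true (h i j) (h' i j))
  rw [κ.of_card_lt (key _ h), κ'.of_card_lt (key _ h')]

/-- An atom with a given node at a given coordinate. -/
theorem Atom.exists_K_eq (hn : 3 ≤ n) (i : Fin n) (p : V × Fin n) :
    ∃ κ : Atom n Γ, κ.K i = some p := by
  -- Distinct copies are completely joined, so a node on another copy supplies the edge needed in
  -- the image of `K`, even if `Γ` has none.
  obtain ⟨l, hl⟩ : ∃ l : Fin n, l ≠ p.2 :=
    Fintype.exists_ne_of_one_lt_card (by simp; omega) _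
  obtain ⟨j, hj⟩ : ∃ j : Fin n, j ≠ i :=
    Fintype.exists_ne_of_one_lt_card (by simp; omega) _
  exact ⟨.ofNodes (Function.update (fun _ => p) j (p.1, l))
    ⟨j, i, Or.inr (by simpa [hj.symm] using hl)⟩, by simp [Atom.ofNodes, hj.symm]⟩

/-- `κ'` can be reached from `κ` by changing the coordinates of `l`, the last one first. -/
def Atom.Path : List (Fin n) → Atom n Γ → Atom n Γ → Prop
  | [], κ, κ' => κ = κ'
  | i :: l, κ, κ' => ∃ κ'', Atom.Path l κ κ'' ∧ Atom.Equiv i κ'' κ'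

theorem Atom.Path.append {l l' : List (Fin n)} {κ κ' κ'' : Atom n Γ} (h : Atom.Path l' κ κ')
    (h' : Atom.Path l κ' κ'') : Atom.Path (l ++ l') κ κ'' := by
  induction l generalizing κ'' with
  | nil => obtain rfl := h'; exact h
  | cons i l ih =>
    obtain ⟨μ, h1, h2⟩ := h'
    exact ⟨μ, ih h1, h2⟩

theorem Atom.Path.reverse {l : List (Fin n)} {κ κ' : Atom n Γ} (h : Atom.Path l κ κ') :
    Atom.Path l.reverse κ' κ := by
  induction l generalizing κ' with
  | nil => exact Eq.symm h
  | cons i l ih =>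
    obtain ⟨μ, h1, h2⟩ := h
    rw [List.reverse_cons]
    exact Atom.Path.append ⟨κ', rfl, h2.symm⟩ (ih h1)

theorem Atom.exists_path (κ : Atom n Γ) (z : Fin n) (l : List (Fin n)) :
    ∃ κ', Atom.Path l κ κ' ∧ ∀ i ∈ l, κ'.rel i z := by
  induction l with
  | nil => exact ⟨κ, rfl, by simp⟩
  | cons i l ih =>
    obtain ⟨κ', hp, hr⟩ := ih
    by_cases hi : i = z
    · subst hi
      refine ⟨κ', ⟨κ', hp, .refl _ _⟩, fun j hj => ?_⟩
      rcases List.mem_cons.1 hj with rfl | hj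
      exacts [κ'.rel.refl _, hr j hj]
    · refine ⟨_, ⟨κ', hp, (κ'.subst_update_equiv i z).symm⟩, fun j hj => ?_⟩
      by_cases hji : j = i
      · subst hji
        exact (κ'.subst_update_rel z z (Ne.symm hi)).2 (κ'.rel.refl _)
      · exact ((κ'.subst_update_equiv i z).2 j z hji (Ne.symm hi)).2
          (hr j ((List.mem_cons.1 hj).resolve_left hji))

/-- The list of coordinates along which cylindrification takes nonzero elements to the unit. -/
def allCoords (n : ℕ) : List (Fin n) := (List.finRange n).reverse ++ List.finRange n

/-- Collapse all coordinates of `κ` onto one, which leads to the hub, and undo the same collapse for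
`κ'`. -/
theorem Atom.path_allCoords (hn : 3 ≤ n) (κ κ' : Atom n Γ) : Atom.Path (allCoords n) κ κ' := by
  obtain ⟨μ, h1, h2⟩ := κ.exists_path ⟨0, by omega⟩ (List.finRange n)
  obtain ⟨μ', h1', h2'⟩ := κ'.exists_path ⟨0, by omega⟩ (List.finRange n)
  have : μ = μ' := by
    apply Atom.ext_of_rel_eq_top hn
    · exact fun i j => μ.rel.trans (h2 i (by simp)) (μ.rel.symm (h2 j (by simp)))
    · exact fun i j => μ'.rel.trans (h2' i (by simp)) (μ'.rel.symm (h2' j (by simp)))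
  subst this
  exact h1.append h1'.reverse

end Atoms

/-! ## The structures `M(Γ)` -/

section GraphSystem

variable {n : ℕ} {V : Type u} {Γ : SimpleGraph V}

/-- The atom `κ` is below the element `X` of `𝒜(Γ)`. -/
def Atom.Below (κ : Atom n Γ) (X : (graphSystem n Γ).A) : Prop :=
  @Membership.mem (Atom n Γ) (Set (Atom n Γ)) _ X κ

/-- The node `p` is the value of `κ` at `i`. -/
def Atom.HasNode (κ : Atom n Γ) (i : Fin n) (p : (graphSystem n Γ).G) : Prop :=
  κ.K i = some p

theorem Atom.HasNode.isDist {κ : Atom n Γ} {i : Fin n} {p : (graphSystem n Γ).G}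
    (h : κ.HasNode i p) : IsDist κ.rel i := Atom.isDist_of_K h

theorem Atom.HasNode.unique {κ : Atom n Γ} {i : Fin n} {p q : (graphSystem n Γ).G}
    (h : κ.HasNode i p) (h' : κ.HasNode i q) : p = q :=
  Option.some_injective (V × Fin n) (Eq.trans (Eq.symm h) h')

theorem Atom.HasNode.congr {κ κ' : Atom n Γ} {i j : Fin n} {p : (graphSystem n Γ).G}
    (h : κ.HasNode i p) (he : κ.K i = κ'.K j) : κ'.HasNode j p := Eq.trans (Eq.symm he) h

theorem Atom.exists_hasNode {κ : Atom n Γ} {i : Fin n} (h : IsDist κ.rel i) :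
    ∃ p, κ.HasNode i p := Atom.exists_K h

theorem graph_ext {X Y : (graphSystem n Γ).A} (h : ∀ κ : Atom n Γ, κ.Below X ↔ κ.Below Y) :
    X = Y := Set.ext (α := Atom n Γ) h

theorem graph_bext {X Y : (graphSystem n Γ).B}
    (h : ∀ p, (graphSystem n Γ).mem p X ↔ (graphSystem n Γ).mem p Y) : X = Y :=
  Set.ext (α := V × Fin n) h

section

variable {κ : Atom n Γ}

@[simp] theorem below_add {X Y : (graphSystem n Γ).A} :
    κ.Below ((graphSystem n Γ).add X Y) ↔ κ.Below X ∨ κ.Below Y := Iff.rfl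

@[simp] theorem below_neg {X : (graphSystem n Γ).A} :
    κ.Below ((graphSystem n Γ).neg X) ↔ ¬ κ.Below X := Iff.rfl

@[simp] theorem below_zero : κ.Below (graphSystem n Γ).zero ↔ False := Iff.rfl

@[simp] theorem below_one : κ.Below (graphSystem n Γ).one ↔ True := iff_true_intro trivial

@[simp] theorem below_mul {X Y : (graphSystem n Γ).A} :
    κ.Below ((graphSystem n Γ).mul X Y) ↔ κ.Below X ∧ κ.Below Y := by
  simp [AGSStructure.mul]

@[simp] theorem below_diag {i j : Fin n} :
    κ.Below ((graphSystem n Γ).diag i j) ↔ κ.rel i j := Iff.rfl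

@[simp] theorem below_cyl {i : Fin n} {X : (graphSystem n Γ).A} :
    κ.Below ((graphSystem n Γ).cyl i X) ↔ ∃ κ' : Atom n Γ, κ'.Below X ∧ Atom.Equiv i κ' κ :=
  Iff.rfl

@[simp] theorem below_subst {σ : Fin n → Fin n} {X : (graphSystem n Γ).A} :
    κ.Below ((graphSystem n Γ).subst σ X) ↔ (κ.subst σ).Below X := Iff.rfl

@[simp] theorem below_S {i : Fin n} {X : (graphSystem n Γ).B} :
    κ.Below ((graphSystem n Γ).S i X) ↔ ∃ p, (graphSystem n Γ).mem p X ∧ κ.HasNode i p :=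
  and_iff_right_of_imp fun ⟨_, _, hp⟩ => mem_distElement.2 (Atom.isDist_of_K hp)

@[simp] theorem below_prod {ι : Type} {l : List ι} {f : ι → (graphSystem n Γ).A} :
    κ.Below ((graphSystem n Γ).prod l f) ↔ ∀ i ∈ l, κ.Below (f i) := by
  induction l with
  | nil => exact iff_of_true trivial (by simp)
  | cons X l ih =>
    rw [List.forall_mem_cons, ← ih]
    exact below_mul

@[simp] theorem below_cyls {l : List (Fin n)} {X : (graphSystem n Γ).A} :
    κ.Below ((graphSystem n Γ).cyls l X) ↔ ∃ κ' : Atom n Γ, κ'.Below X ∧ Atom.Path l κ' κ := by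
  induction l generalizing κ with
  | nil => exact ⟨fun h => ⟨κ, h, rfl⟩, fun ⟨μ, h, (h' : μ = κ)⟩ => h' ▸ h⟩
  | cons i l ih =>
    refine below_cyl.trans ?_
    constructor
    · rintro ⟨μ, h, he⟩
      obtain ⟨κ', h, hp⟩ := ih.1 h
      exact ⟨κ', h, μ, hp, he⟩
    · rintro ⟨κ', h, μ, hp, he⟩
      exact ⟨μ, ih.2 ⟨κ', h, hp⟩, he⟩

end

variable {p q : (graphSystem n Γ).G}

@[simp] theorem graph_mem_R {i : Fin n} {X : (graphSystem n Γ).A} :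
    (graphSystem n Γ).mem p ((graphSystem n Γ).R i X) ↔
      ∃ κ : Atom n Γ, κ.Below X ∧ κ.HasNode i p := by
  constructor
  · rintro ⟨κ, ⟨_, h⟩, hp⟩
    exact ⟨κ, h, hp⟩
  · rintro ⟨κ, h, hp⟩
    exact ⟨κ, ⟨mem_distElement.2 hp.isDist, h⟩, hp⟩

@[simp] theorem graph_mem_badd {X Y : (graphSystem n Γ).B} :
    (graphSystem n Γ).mem p ((graphSystem n Γ).badd X Y) ↔
      (graphSystem n Γ).mem p X ∨ (graphSystem n Γ).mem p Y := Iff.rfl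

@[simp] theorem graph_mem_bneg {X : (graphSystem n Γ).B} :
    (graphSystem n Γ).mem p ((graphSystem n Γ).bneg X) ↔ ¬ (graphSystem n Γ).mem p X := Iff.rfl

@[simp] theorem graph_mem_bzero : (graphSystem n Γ).mem p (graphSystem n Γ).bzero ↔ False := Iff.rfl

@[simp] theorem graph_mem_bone : (graphSystem n Γ).mem p (graphSystem n Γ).bone ↔ True :=
  iff_true_intro trivial

end GraphSystem

end AlgGraph

namespace AlgGraph

universe w

/-! ## Properties of the models of `𝒰` -/

namespace AGSStructure

variable {n : ℕ} {M : AGSStructure.{v} n}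

/-- Identities valid in all the structures `M(Γ)` are valid in the models of `𝒰`. -/
theorem identity {a b : ℕ} (hM : M.Models (theoryU.{u} n)) (t₁ t₂ : AGSTerm n a 0 b .alg)
    (h : ∀ (V : Type u) (Γ : SimpleGraph V) x p y (κ : Atom n Γ),
      κ.Below (t₁.realize (graphSystem n Γ) x p y) ↔ κ.Below (t₂.realize (graphSystem n Γ) x p y))
    (x : Fin a → M.A) (y : Fin b → M.B) :
    @Eq M.A (t₁.realize M x ![] y) (t₂.realize M x ![] y) :=
  transfer hM (.eq .alg t₁ t₂) trivial (fun V Γ x p y => graph_ext (h V Γ x p y)) x ![] y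

/-! ### Boolean identities of the algebra sort -/

theorem add_comm (hM : M.Models (theoryU.{u} n)) (a b : M.A) : M.add a b = M.add b a := by
  simpa using identity hM (.add (.varA 0) (.varA 1)) (.add (.varA 1) (.varA 0))
    (by intros; simp; tauto) ![a, b] ![]

theorem add_assoc (hM : M.Models (theoryU.{u} n)) (a b c : M.A) :
    M.add (M.add a b) c = M.add a (M.add b c) := by
  simpa using identity hM (.add (.add (.varA 0) (.varA 1)) (.varA 2))
    (.add (.varA 0) (.add (.varA 1) (.varA 2))) (by intros; simp; tauto) ![a, b, c] ![]

theorem mul_comm (hM : M.Models (theoryU.{u} n)) (a b : M.A) : M.mul a b = M.mul b a := by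
  simpa using identity hM (.mul (.varA 0) (.varA 1)) (.mul (.varA 1) (.varA 0))
    (by intros; simp; tauto) ![a, b] ![]

theorem mul_assoc (hM : M.Models (theoryU.{u} n)) (a b c : M.A) :
    M.mul (M.mul a b) c = M.mul a (M.mul b c) := by
  simpa using identity hM (.mul (.mul (.varA 0) (.varA 1)) (.varA 2))
    (.mul (.varA 0) (.mul (.varA 1) (.varA 2))) (by intros; simp; tauto) ![a, b, c] ![]

theorem add_mul_self (hM : M.Models (theoryU.{u} n)) (a b : M.A) : M.add a (M.mul a b) = a := by
  simpa using identity hM (.add (.varA 0) (.mul (.varA 0) (.varA 1))) (.varA 0)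
    (by intros; simp; tauto) ![a, b] ![]

theorem mul_add_self (hM : M.Models (theoryU.{u} n)) (a b : M.A) : M.mul a (M.add a b) = a := by
  simpa using identity hM (.mul (.varA 0) (.add (.varA 0) (.varA 1))) (.varA 0)
    (by intros; simp; tauto) ![a, b] ![]

/-- Here and below an inequality `x ≤ y` is coded as the equation `x + y = y`, which is the order of
`distribLattice`. -/
theorem add_distrib (hM : M.Models (theoryU.{u} n)) (a b c : M.A) :
    M.add (M.mul (M.add a b) (M.add a c)) (M.add a (M.mul b c)) = M.add a (M.mul b c) := by
  simpa using identity hM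
    (.add (.mul (.add (.varA 0) (.varA 1)) (.add (.varA 0) (.varA 2)))
      (.add (.varA 0) (.mul (.varA 1) (.varA 2))))
    (.add (.varA 0) (.mul (.varA 1) (.varA 2))) (by intros; simp; tauto) ![a, b, c] ![]

theorem mul_neg (hM : M.Models (theoryU.{u} n)) (a : M.A) : M.mul a (M.neg a) = M.zero := by
  simpa using identity hM (.mul (.varA 0) (.neg (.varA 0))) .zero (by intros; simp) ![a] ![]

theorem add_neg (hM : M.Models (theoryU.{u} n)) (a : M.A) : M.add a (M.neg a) = M.one := by
  simpa using identity hM (.add (.varA 0) (.neg (.varA 0))) .one (by intros; simp; tauto) ![a] ![]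

theorem add_one (hM : M.Models (theoryU.{u} n)) (a : M.A) : M.add a M.one = M.one := by
  simpa using identity hM (.add (.varA 0) .one) .one (by intros; simp) ![a] ![]

theorem zero_add (hM : M.Models (theoryU.{u} n)) (a : M.A) : M.add M.zero a = a := by
  simpa using identity hM (.add .zero (.varA 0)) (.varA 0) (by intros; simp) ![a] ![]

/-! ### Cylindrifications and diagonals -/

theorem le_cyl (hM : M.Models (theoryU.{u} n)) (i : Fin n) (a : M.A) :
    M.add a (M.cyl i a) = M.cyl i a := by
  simpa using identity hM (.add (.varA 0) (.cyl i (.varA 0))) (.cyl i (.varA 0)) (by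
    intro V Γ x p y κ
    simp only [AGSTerm.realize_add, AGSTerm.realize_cyl, AGSTerm.realize_varA, below_add, or_iff_right_iff_imp]
    exact fun h => ⟨κ, h, .refl _ _⟩) ![a] ![]

theorem cyl_zero (hM : M.Models (theoryU.{u} n)) (i : Fin n) : M.cyl i M.zero = M.zero := by
  simpa using identity hM (.cyl i .zero) .zero (by intros; simp) ![] ![]

theorem cyl_mul_cyl (hM : M.Models (theoryU.{u} n)) (i : Fin n) (a b : M.A) :
    M.cyl i (M.mul a (M.cyl i b)) = M.mul (M.cyl i a) (M.cyl i b) := by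
  simpa using identity hM (.cyl i (.mul (.varA 0) (.cyl i (.varA 1))))
    (.mul (.cyl i (.varA 0)) (.cyl i (.varA 1))) (by
    intro V Γ x p y κ
    simp only [AGSTerm.realize_mul, AGSTerm.realize_cyl, AGSTerm.realize_varA, below_mul, below_cyl]
    constructor
    · rintro ⟨κ', ⟨h, κ'', h', he'⟩, he⟩
      exact ⟨⟨κ', h, he⟩, κ'', h', he'.trans he⟩
    · rintro ⟨⟨κ', h, he⟩, κ'', h', he'⟩
      exact ⟨κ', ⟨h, κ'', h', he'.trans he.symm⟩, he⟩) ![a, b] ![]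

theorem diag_self (hM : M.Models (theoryU.{u} n)) (i : Fin n) : M.diag i i = M.one := by
  simpa using identity hM (.diag i i) .one (by
    intro V Γ x p y κ
    simp) ![] ![]

theorem diag_symm (hM : M.Models (theoryU.{u} n)) (i j : Fin n) : M.diag i j = M.diag j i := by
  simpa using identity hM (.diag i j) (.diag j i) (by
    intro V Γ x p y κ
    simpa using ⟨κ.rel.symm, κ.rel.symm⟩) ![] ![]

theorem diag_trans (hM : M.Models (theoryU.{u} n)) (i j k : Fin n) :
    M.add (M.mul (M.diag i j) (M.diag j k)) (M.diag i k) = M.diag i k := by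
  simpa using identity hM (.add (.mul (.diag i j) (.diag j k)) (.diag i k)) (.diag i k) (by
    intro V Γ x p y κ
    simpa using κ.rel.trans) ![] ![]

theorem cyl_diag_of_ne (hM : M.Models (theoryU.{u} n)) {i j k : Fin n} (hi : i ≠ k) (hj : j ≠ k) :
    M.cyl k (M.diag i j) = M.diag i j := by
  simpa using identity hM (.cyl k (.diag i j)) (.diag i j) (by
    intro V Γ x p y κ
    simp only [AGSTerm.realize_cyl, AGSTerm.realize_diag, below_cyl, below_diag]
    exact ⟨fun ⟨κ', h, he⟩ => (he.2 i j hi hj).1 h, fun h => ⟨κ, h, .refl _ _⟩⟩) ![] ![]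

theorem cyl_diag_mul_diag (hM : M.Models (theoryU.{u} n)) {i j k : Fin n} (hi : i ≠ j)
    (hk : k ≠ j) : M.cyl j (M.mul (M.diag i j) (M.diag j k)) = M.diag i k := by
  simpa using identity hM (.cyl j (.mul (.diag i j) (.diag j k))) (.diag i k) (by
    intro V Γ x p y κ
    simp only [AGSTerm.realize_cyl, AGSTerm.realize_mul, AGSTerm.realize_diag, below_mul, below_cyl,
      below_diag]
    constructor
    · rintro ⟨κ', ⟨h, h'⟩, he⟩
      exact (he.2 i k hi hk).1 (κ'.rel.trans h h')
    · intro h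
      -- The witness substitutes `i` for `j`.
      exact ⟨_, ⟨Setoid.symm' _ ((κ.subst_update_rel i i hi).2 (κ.rel.refl i)),
        (κ.subst_update_rel i k hk).2 h⟩, κ.subst_update_equiv j i⟩) ![] ![]

theorem cyl_diag (hM : M.Models (theoryU.{u} n)) {i j : Fin n} (hij : j ≠ i) :
    M.cyl i (M.diag i j) = M.one := by
  simpa using identity hM (.cyl i (.diag i j)) .one (by
    intro V Γ x p y κ
    simp only [AGSTerm.realize_cyl, AGSTerm.realize_diag, AGSTerm.realize_one, below_cyl,
      below_diag, below_one, iff_true]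
    exact ⟨_, (κ.subst_update_rel j j hij).2 (κ.rel.refl j), κ.subst_update_equiv i j⟩) ![] ![]

/-- An element is determined on `d_ij` by its `i`-cylindrification. -/
theorem diag_mul_cyl_le (hM : M.Models (theoryU.{u} n)) {i j : Fin n} (hij : i ≠ j) (a : M.A) :
    M.add (M.mul (M.diag i j) (M.cyl i (M.mul (M.diag i j) a))) a = a := by
  simpa using identity hM
    (.add (.mul (.diag i j) (.cyl i (.mul (.diag i j) (.varA 0)))) (.varA 0)) (.varA 0) (by
    intro V Γ x p y κ
    simp only [AGSTerm.realize_cyl, AGSTerm.realize_mul, AGSTerm.realize_add, AGSTerm.realize_diag,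
      AGSTerm.realize_varA, below_mul, below_cyl, below_add, below_diag, or_iff_right_iff_imp]
    rintro ⟨h, κ', ⟨h', ha⟩, he⟩
    exact κ'.eq_of_equiv hij h' h he ▸ ha) ![a] ![]

/-- Any two atoms are joined by a path along `allCoords n`. Because the path is uniform, this form
of simplicity is a universal sentence and survives in all models of `𝒰`. -/
theorem eq_zero_or_cyls_eq_one (hM : M.Models (theoryU.{u} n)) (hn : 3 ≤ n) (a : M.A) :
    a = M.zero ∨ M.cyls (allCoords n) a = M.one := by
  simpa using transfer hM (a := 1) (g := 0) (b := 0)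
    (.or (.eq .alg (.varA 0) .zero) (.eq .alg (.cyls (allCoords n) (.varA 0)) .one)) (by simp) (by
    intro V Γ x p y
    simp only [AGSFormula.realize_or, AGSFormula.realize_eq_alg, AGSTerm.realize_varA,
      AGSTerm.realize_cyls, AGSTerm.realize_zero, AGSTerm.realize_one]
    rw [or_iff_not_imp_left]
    intro h
    have : ∃ κ : Atom n Γ, κ.Below (x 0) := by
      by_contra hne
      push Not at hne
      exact h (graph_ext fun κ => by simpa using hne κ)
    obtain ⟨κ, hκ⟩ := this
    exact graph_ext fun κ' => by
      simpa using ⟨κ, hκ, κ.path_allCoords hn κ'⟩) ![a] ![] ![]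

/-! ### Substitutions -/

theorem subst_add (hM : M.Models (theoryU.{u} n)) (σ : Fin n → Fin n) (a b : M.A) :
    M.subst σ (M.add a b) = M.add (M.subst σ a) (M.subst σ b) := by
  simpa using identity hM (.subst σ (.add (.varA 0) (.varA 1)))
    (.add (.subst σ (.varA 0)) (.subst σ (.varA 1))) (by intros; simp) ![a, b] ![]

theorem subst_neg (hM : M.Models (theoryU.{u} n)) (σ : Fin n → Fin n) (a : M.A) :
    M.subst σ (M.neg a) = M.neg (M.subst σ a) := by
  simpa using identity hM (.subst σ (.neg (.varA 0))) (.neg (.subst σ (.varA 0)))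
    (by intros; simp) ![a] ![]

theorem subst_subst (hM : M.Models (theoryU.{u} n)) (σ τ : Fin n → Fin n) (a : M.A) :
    M.subst σ (M.subst τ a) = M.subst (σ ∘ τ) a := by
  simpa using identity hM (.subst σ (.subst τ (.varA 0))) (.subst (σ ∘ τ) (.varA 0))
    (by intros; simp [Atom.subst_subst]) ![a] ![]

theorem subst_id (hM : M.Models (theoryU.{u} n)) (a : M.A) : M.subst id a = a := by
  simpa using identity hM (.subst id (.varA 0)) (.varA 0) (by intros; simp [Atom.subst_id]) ![a] ![]

theorem subst_diag (hM : M.Models (theoryU.{u} n)) (σ : Fin n → Fin n) (i j : Fin n) :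
    M.subst σ (M.diag i j) = M.diag (σ i) (σ j) := by
  simpa using identity hM (.subst σ (.diag i j)) (.diag (σ i) (σ j)) (by
    intros
    simp only [AGSTerm.realize_subst, AGSTerm.realize_diag, below_subst, below_diag]
    rfl) ![] ![]

/-! ### The maps `R` and `S` -/

theorem S_badd (hM : M.Models (theoryU.{u} n)) (i : Fin n) (B C : M.B) :
    M.S i (M.badd B C) = M.add (M.S i B) (M.S i C) := by
  simpa using identity hM (.S i (addB (.varB 0) (.varB 1))) (.add (.S i (.varB 0)) (.S i (.varB 1)))
    (by
      intro V Γ x p y κ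
      simp only [AGSTerm.realize_S, AGSTerm.realize_addB, AGSTerm.realize_add, AGSTerm.realize_varB,
        below_add, below_S, graph_mem_badd, or_and_right, exists_or]) ![] ![B, C]

/-- Together with `S_badd`: `S i` is a boolean homomorphism onto its image relative to the unit `S i
1`, since a node at `i` is unique when it exists. -/
theorem S_bneg (hM : M.Models (theoryU.{u} n)) (i : Fin n) (B : M.B) :
    M.S i (M.bneg B) = M.mul (M.S i M.bone) (M.neg (M.S i B)) := by
  simpa using identity hM (.S i (.bneg (.varB 0))) (.mul (.S i oneB) (.neg (.S i (.varB 0)))) (by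
    intro V Γ x p y κ
    simp only [AGSTerm.realize_S, AGSTerm.realize_bneg, AGSTerm.realize_mul, AGSTerm.realize_neg,
      AGSTerm.realize_oneB, AGSTerm.realize_varB, below_mul, below_neg, below_S, graph_mem_bneg,
      graph_mem_bone, true_and]
    constructor
    · rintro ⟨q, h, hq⟩
      exact ⟨⟨q, hq⟩, fun ⟨q', h', hq'⟩ => h (hq'.unique hq ▸ h')⟩
    · rintro ⟨⟨q, hq⟩, h⟩
      exact ⟨q, fun h' => h ⟨q, h', hq⟩, hq⟩) ![] ![B]

theorem S_mul_diag (hM : M.Models (theoryU.{u} n)) {i j k : Fin n} (hj : j ≠ i) (hk : k ≠ i)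
    (hjk : j ≠ k) (B : M.B) : M.mul (M.S i B) (M.diag j k) = M.zero := by
  simpa using identity hM (.mul (.S i (.varB 0)) (.diag j k)) .zero (by
    intro V Γ x p y κ
    simp only [AGSTerm.realize_S, AGSTerm.realize_mul, AGSTerm.realize_diag, AGSTerm.realize_zero,
      AGSTerm.realize_varB, below_mul, below_S, below_diag, below_zero, iff_false]
    rintro ⟨⟨q, _, hq⟩, h⟩
    exact hq.isDist j k hj hk hjk h) ![] ![B]

/-- The pairs of distinct coordinates different from `i`. -/
def pairsOff (i : Fin n) : List (Fin n × Fin n) :=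
  (List.finRange n ×ˢ List.finRange n).filter fun jk => jk.1 ≠ i ∧ jk.2 ≠ i ∧ jk.1 ≠ jk.2

theorem mem_pairsOff {i : Fin n} {jk : Fin n × Fin n} :
    jk ∈ pairsOff i ↔ jk.1 ≠ i ∧ jk.2 ≠ i ∧ jk.1 ≠ jk.2 := by
  simp only [pairsOff, List.mem_filter, decide_eq_true_eq, and_iff_right_iff_imp]
  exact fun _ => List.mem_product.2 ⟨List.mem_finRange _, List.mem_finRange _⟩

/-- With `S_mul_diag` this identifies `S i 1` with `Fᵢ`: a node at `i` exists exactly when the type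
is `i`-distinguishing. -/
theorem prod_neg_diag_le (hM : M.Models (theoryU.{u} n)) (i : Fin n) :
    M.add (M.prod (pairsOff i) fun jk => M.neg (M.diag jk.1 jk.2)) (M.S i M.bone) =
      M.S i M.bone := by
  simpa using identity hM
    (.add (.prod (pairsOff i) fun jk => .neg (.diag jk.1 jk.2)) (.S i oneB)) (.S i oneB) (by
    intro V Γ x p y κ
    simp only [AGSTerm.realize_add, AGSTerm.realize_S, AGSTerm.realize_prod, AGSTerm.realize_oneB,
      below_add, below_S, graph_mem_bone, true_and, or_iff_right_iff_imp]
    intro h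
    refine Atom.exists_hasNode fun j k hj hk hjk hr => ?_
    have := below_prod.1 h (j, k) (mem_pairsOff.2 ⟨hj, hk, hjk⟩)
    simp only [AGSTerm.realize_neg, AGSTerm.realize_diag, below_neg, below_diag] at this
    exact this hr) ![] ![]

theorem diag_mul_S_le (hM : M.Models (theoryU.{u} n)) (i j : Fin n) (B : M.B) :
    M.add (M.mul (M.diag i j) (M.S i B)) (M.S j B) = M.S j B := by
  simpa using identity hM (.add (.mul (.diag i j) (.S i (.varB 0))) (.S j (.varB 0)))
    (.S j (.varB 0)) (by
    intro V Γ x p y κ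
    simp only [AGSTerm.realize_add, AGSTerm.realize_S, AGSTerm.realize_mul, AGSTerm.realize_diag,
      AGSTerm.realize_varB, below_add, below_mul, below_S, below_diag, or_iff_right_iff_imp]
    rintro ⟨h, q, hq, hK⟩
    exact ⟨q, hq, hK.congr (κ.K_eq_of_rel h)⟩) ![] ![B]

theorem cyl_S (hM : M.Models (theoryU.{u} n)) (i : Fin n) (B : M.B) :
    M.cyl i (M.S i B) = M.S i B := by
  simpa using identity hM (.cyl i (.S i (.varB 0))) (.S i (.varB 0)) (by
    intro V Γ x p y κ
    simp only [AGSTerm.realize_cyl, AGSTerm.realize_S, AGSTerm.realize_varB, below_cyl, below_S]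
    exact ⟨fun ⟨κ', ⟨q, hq, hK⟩, he⟩ => ⟨q, hq, hK.congr he.1⟩, fun h => ⟨κ, h, .refl _ _⟩⟩)
    ![] ![B]

/-- On `Fᵢ` all types are discrete off `i`, so `≡ᵢ` reduces to having the same node at `i`.
Cylindrification there is computed in the boolean sort. -/
theorem S_R (hM : M.Models (theoryU.{u} n)) (i : Fin n) (a : M.A) :
    M.S i (M.R i a) = M.mul (M.S i M.bone) (M.cyl i a) := by
  simpa using identity hM (.S i (.R i (.varA 0))) (.mul (.S i oneB) (.cyl i (.varA 0))) (by
    intro V Γ x p y κ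
    simp only [AGSTerm.realize_cyl, AGSTerm.realize_S, AGSTerm.realize_R, AGSTerm.realize_varA,
      AGSTerm.realize_mul, AGSTerm.realize_oneB, below_mul, below_cyl, below_S, graph_mem_R,
      graph_mem_bone, true_and]
    constructor
    · rintro ⟨q, ⟨κ', h, hq'⟩, hq⟩
      refine ⟨⟨q, hq⟩, κ', h, Eq.trans hq' (Eq.symm hq), fun j k hj hk => ?_⟩
      by_cases hjk : j = k
      · exact hjk ▸ iff_of_true (κ'.rel.refl _) (κ.rel.refl _)
      · exact iff_of_false (hq'.isDist j k hj hk hjk) (hq.isDist j k hj hk hjk)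
    · rintro ⟨⟨q, hq⟩, κ', h, he⟩
      exact ⟨q, ⟨κ', h, hq.congr he.1.symm⟩, hq⟩) ![a] ![]

theorem subst_S (hM : M.Models (theoryU.{u} n)) (σ : Fin n → Fin n) (i : Fin n) (B : M.B) :
    M.subst σ (M.S i B) = M.mul (M.subst σ (M.S i M.bone)) (M.S (missing σ i) B) := by
  simpa using identity hM (.subst σ (.S i (.varB 0)))
    (.mul (.subst σ (.S i oneB)) (.S (missing σ i) (.varB 0))) (by
    intro V Γ x p y κ
    simp only [AGSTerm.realize_subst, AGSTerm.realize_S, AGSTerm.realize_varB,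
      AGSTerm.realize_mul, AGSTerm.realize_oneB, below_mul, below_subst, below_S,
      graph_mem_bone, true_and]
    have key : ∀ q, (κ.subst σ).HasNode i q ↔
        IsDist (κ.rel.comap σ) i ∧ κ.HasNode (missing σ i) q := fun q => Atom.K_subst_eq_some
    simp only [key]
    constructor
    · rintro ⟨q, h, hd, hq⟩
      exact ⟨⟨q, hd, hq⟩, q, h, hq⟩
    · rintro ⟨⟨q', hd, _⟩, q, h, hq⟩
      exact ⟨q, h, hd, hq⟩) ![] ![B]

/-- Every node occurs at coordinate `i` of some atom. -/
theorem S_injective (hM : M.Models (theoryU.{u} n)) (hn : 3 ≤ n) (i : Fin n) :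
    Function.Injective (M.S i) := fun B C h => by
  have := transfer hM (a := 0) (g := 0) (b := 2)
    (.imp (.eq .alg (.S i (.varB 0)) (.S i (.varB 1))) (.eq .bool (.varB 0) (.varB 1))) (by simp)
    (by
      intro V Γ x p y
      simp only [AGSFormula.realize_imp, AGSFormula.realize_eq_alg, AGSFormula.realize_eq_bool,
        AGSTerm.realize_S, AGSTerm.realize_varB]
      intro h
      refine graph_bext fun q => ?_
      obtain ⟨κ, hκ⟩ := Atom.exists_K_eq (Γ := Γ) hn i q
      have key : ∀ Y, κ.Below ((graphSystem n Γ).S i Y) ↔ (graphSystem n Γ).mem q Y := by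
        intro Y
        rw [below_S]
        exact ⟨fun ⟨q', h, hq⟩ => Atom.HasNode.unique (κ := κ) (i := i) hq hκ ▸ h,
          fun h => ⟨q, h, hκ⟩⟩
      rw [← key, ← key, h]) ![] ![] ![B, C]
  simpa using this (by simpa using h)

/-- An atom below the product has nodes at all coordinates. As `n ≥ 3`, an identification `i ∼ j`
would leave a third coordinate without a node, so the type is discrete, and then the image of `K`
must contain an edge. -/
theorem prod_S_eq_zero (hM : M.Models (theoryU.{u} n)) (hn : 3 ≤ n) {B : M.B}
    (hB : ∀ p q, M.mem p B → M.mem q B → ¬ M.edge p q) :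
    M.prod (List.finRange n) (fun i => M.S i B) = M.zero := by
  have := transfer hM (a := 0) (g := 0) (b := 1)
    (.imp (.allG (.allG (.imp (.mem (.varG 0) (.varB 0)) (.imp (.mem (.varG 1) (.varB 0))
      (.neg (.edge (.varG 0) (.varG 1)))))))
      (.eq .alg (.prod (List.finRange n) fun i => .S i (.varB 0)) .zero)) (by simp)
    (by
      intro V Γ x p y
      simp only [AGSFormula.realize_imp, AGSFormula.realize_eq_alg, AGSFormula.realize_allG,
        AGSFormula.realize_mem, AGSFormula.realize_neg, AGSFormula.realize_edge,
        AGSTerm.realize_S, AGSTerm.realize_varB, AGSTerm.realize_varG, AGSTerm.realize_prod,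
        AGSTerm.realize_zero]
      intro h
      refine graph_ext fun κ => ?_
      simp only [below_prod, below_zero, iff_false]
      intro hκ
      have hK : ∀ i, ∃ q, (graphSystem n Γ).mem q (y 0) ∧ κ.HasNode i q := fun i =>
        below_S.1 (hκ i (by simp))
      have hcard : Nat.card (Quotient κ.rel) = n := by
        rw [card_eq_iff]
        intro i j hij
        by_contra hne
        obtain ⟨k, hk⟩ : ∃ k, k ∉ ({i, j} : Finset (Fin n)) := by
          by_contra hcon
          push Not at hcon
          have := Finset.card_le_card (fun k _ => hcon k : (Finset.univ : Finset (Fin n)) ⊆ _)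
          have := Finset.card_le_two (a := i) (b := j)
          simp at *
          omega
        simp only [Finset.mem_insert, Finset.mem_singleton, not_or] at hk
        obtain ⟨q, _, hq⟩ := hK k
        exact hq.isDist i j (Ne.symm hk.1) (Ne.symm hk.2) hne hij
      obtain ⟨i, j, r, s, hr, hs, hrs⟩ := κ.not_indep_of_card hcard
      obtain ⟨q, hq, hi⟩ := hK i
      obtain ⟨q', hq', hj⟩ := hK j
      obtain rfl : q = r := hi.unique hr
      obtain rfl : q' = s := hj.unique hs
      exact h q q' hq hq' hrs) ![] ![] ![B]
  simpa using this (by simpa using hB)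

/-- The nodes `p i` are themselves the values of an atom; a single edge among them suffices. -/
theorem prod_S_ne_zero (hM : M.Models (theoryU.{u} n)) (B : Fin n → M.B) (p : Fin n → M.G)
    (hp : ∀ i, M.mem (p i) (B i)) {i j : Fin n} (hij : M.edge (p i) (p j)) :
    M.prod (List.finRange n) (fun i => M.S i (B i)) ≠ M.zero := by
  have := transfer hM (a := 0) (g := n) (b := n)
    (.imp (.conj ((List.finRange n).map fun i => .mem (.varG i) (.varB i)))
      (.imp (.edge (.varG i) (.varG j))
      (.neg (.eq .alg (.prod (List.finRange n) fun i => .S i (.varB i)) .zero)))) (by simp)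
    (by
      intro V Γ x p y
      simp only [AGSFormula.realize_imp, AGSFormula.realize_eq_alg, AGSFormula.realize_conj,
        AGSFormula.realize_neg, AGSFormula.realize_edge,
        AGSTerm.realize_varG, AGSTerm.realize_prod,
        AGSTerm.realize_zero, List.forall_mem_map, AGSFormula.realize_mem]
      intro h he h0
      let κ : Atom n Γ := .ofNodes p ⟨i, j, he⟩
      have hκ : κ.Below ((graphSystem n Γ).prod (List.finRange n)
          fun i => (graphSystem n Γ).S i (y i)) := by
        rw [below_prod]
        intro k _
        exact below_S.2 ⟨p k, h k (by simp), rfl⟩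
      simp only [AGSTerm.realize_S, AGSTerm.realize_varB] at h0
      rw [h0] at hκ
      exact hκ) ![] p B
  simpa using this (by simpa using hp) (by simpa using hij)

/-- The element describing the restriction of the equality type `r` to the coordinates other
than `i`. -/
def typeOff (M : AGSStructure.{v} n) (r : Setoid (Fin n)) [DecidableRel r] (i : Fin n) : M.A :=
  M.prod (pairsOff i) fun jk =>
    if r jk.1 jk.2 then M.diag jk.1 jk.2 else M.neg (M.diag jk.1 jk.2)

/-- The term whose value is `typeOff`. -/
def _root_.AlgGraph.AGSTerm.typeOff {a g b : ℕ} (r : Setoid (Fin n)) [DecidableRel r] (i : Fin n) :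
    AGSTerm n a g b .alg :=
  .prod (pairsOff i) fun jk =>
    if r jk.1 jk.2 then .diag jk.1 jk.2 else .neg (.diag jk.1 jk.2)

theorem _root_.AlgGraph.AGSTerm.realize_typeOff {a g b : ℕ} (N : AGSStructure.{w} n)
    (x : Fin a → N.A) (p : Fin g → N.G) (y : Fin b → N.B) (r : Setoid (Fin n)) [DecidableRel r]
    (i : Fin n) :
    (AGSTerm.typeOff r i : AGSTerm n a g b .alg).realize N x p y = N.typeOff r i := by
  simp only [AGSTerm.typeOff, AGSTerm.realize_prod]
  unfold AGSStructure.typeOff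
  congr 1
  funext jk
  by_cases h : r jk.1 jk.2
  · rw [if_pos h, if_pos h]
    exact AGSTerm.realize_diag N x p y _ _
  · rw [if_neg h, if_neg h]
    exact (AGSTerm.realize_neg N x p y _).trans (by rw [AGSTerm.realize_diag])

theorem below_typeOff {V : Type u} {Γ : SimpleGraph V} {κ : Atom n Γ} {r : Setoid (Fin n)}
    [DecidableRel r] {i : Fin n} : κ.Below ((graphSystem n Γ).typeOff r i) ↔
      ∀ j k, j ≠ i → k ≠ i → (κ.rel j k ↔ r j k) := by
  simp only [typeOff, below_prod, mem_pairsOff, Prod.forall]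
  refine forall_congr' fun j => forall_congr' fun k => ?_
  by_cases hjk : j = k
  · subst hjk
    simp only [ne_eq, not_true_eq_false, and_false, false_imp_iff, true_iff]
    exact fun _ _ => iff_of_true (κ.rel.refl _) (r.refl _)
  · by_cases h : r j k <;> simp [h, hjk]

theorem cyl_typeOff (hM : M.Models (theoryU.{u} n)) (r : Setoid (Fin n)) [DecidableRel r]
    (i : Fin n) : M.cyl i (M.typeOff r i) = M.typeOff r i := by
  simpa [AGSTerm.realize_typeOff] using identity hM (.cyl i (.typeOff r i)) (.typeOff r i) (by
    intro V Γ x p y κ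
    simp only [AGSTerm.realize_typeOff, AGSTerm.realize_cyl, below_cyl, below_typeOff]
    exact ⟨fun ⟨κ', h, he⟩ j k hj hk => (he.2 j k hj hk).symm.trans (h j k hj hk),
      fun h => ⟨κ, h, .refl _ _⟩⟩) ![] ![]

/-- The counterpart of `S_R` outside `Fᵢ`: no node is defined at `i`, so an `≡ᵢ`-class consists of
all atoms with a given type off `i`. -/
theorem typeOff_le_cyl (hM : M.Models (theoryU.{u} n)) (r : Setoid (Fin n)) [DecidableRel r]
    (i : Fin n) (hr : ¬ IsDist r i) (a : M.A) : M.mul a (M.typeOff r i) = M.zero ∨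
      M.add (M.typeOff r i) (M.cyl i a) = M.cyl i a := by
  simpa [AGSTerm.realize_typeOff] using transfer hM (a := 1) (g := 0) (b := 0)
    (.or (.eq .alg (.mul (.varA 0) (.typeOff r i)) .zero)
      (.eq .alg (.add (.typeOff r i) (.cyl i (.varA 0))) (.cyl i (.varA 0)))) (by simp) (by
    intro V Γ x p y
    simp only [AGSFormula.realize_or, AGSFormula.realize_eq_alg, AGSTerm.realize_varA,
      AGSTerm.realize_mul, AGSTerm.realize_cyl, AGSTerm.realize_add, AGSTerm.realize_zero,
      AGSTerm.realize_typeOff]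
    rw [or_iff_not_imp_left]
    intro h
    have : ∃ κ : Atom n Γ, κ.Below (x 0) ∧ κ.Below ((graphSystem n Γ).typeOff r i) := by
      by_contra hne
      exact h (graph_ext fun κ => by simpa using fun h1 h2 => hne ⟨κ, h1, h2⟩)
    obtain ⟨κ, hκ, hκr⟩ := this
    refine graph_ext fun κ' => ?_
    simp only [below_add, below_cyl, or_iff_right_iff_imp]
    intro hκ'r
    rw [below_typeOff] at hκr hκ'r
    refine ⟨κ, hκ, ?_, fun j k hj hk => (hκr j k hj hk).trans (hκ'r j k hj hk).symm⟩
    rw [Atom.K_eq_none (fun h => hr ((isDist_congr hκr).1 h)),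
      Atom.K_eq_none (fun h => hr ((isDist_congr hκ'r).1 h))]) ![a] ![] ![]

end AGSStructure

end AlgGraph

namespace AlgGraph

universe w

namespace AGSStructure

variable {n : ℕ} {M : AGSStructure.{v} n}

/-! ### The boolean sort and the graph sort -/

/-- The elements of the boolean sort behave as sets of elements of the graph sort. -/
structure IsSetLike (M : AGSStructure.{v} n) : Prop where
  mem_badd : ∀ p B C, M.mem p (M.badd B C) ↔ M.mem p B ∨ M.mem p C
  mem_bneg : ∀ p B, M.mem p (M.bneg B) ↔ ¬ M.mem p B
  not_mem_bzero : ∀ p, ¬ M.mem p M.bzero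
  mem_bone : ∀ p, M.mem p M.bone
  ext : ∀ B C, (∀ p, M.mem p B ↔ M.mem p C) → B = C

theorem isSetLike_graphSystem {V : Type u} (Γ : SimpleGraph V) : (graphSystem n Γ).IsSetLike where
  mem_badd _ _ _ := Iff.rfl
  mem_bneg _ _ := Iff.rfl
  not_mem_bzero _ h := h
  mem_bone _ := trivial
  ext _ _ := graph_bext

theorem isSetLike (hM : M.Models (theoryU.{u} n)) : M.IsSetLike where
  mem_badd p B C := by
    have := transfer hM (a := 0) (g := 1) (b := 2)
      (.and (.imp (.mem (.varG 0) (addB (.varB 0) (.varB 1)))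
          (.or (.mem (.varG 0) (.varB 0)) (.mem (.varG 0) (.varB 1))))
        (.imp (.or (.mem (.varG 0) (.varB 0)) (.mem (.varG 0) (.varB 1)))
          (.mem (.varG 0) (addB (.varB 0) (.varB 1))))) (by simp)
      (by intro V Γ x p y; simp) ![] ![p] ![B, C]
    simp only [AGSFormula.realize_and, AGSFormula.realize_imp, AGSFormula.realize_or,
      AGSFormula.realize_mem, AGSTerm.realize_addB, AGSTerm.realize_varG,
      AGSTerm.realize_varB] at this
    exact ⟨this.1, this.2⟩
  mem_bneg p B := by
    have := transfer hM (a := 0) (g := 1) (b := 1)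
      (.and (.imp (.mem (.varG 0) (.bneg (.varB 0))) (.neg (.mem (.varG 0) (.varB 0))))
        (.imp (.neg (.mem (.varG 0) (.varB 0))) (.mem (.varG 0) (.bneg (.varB 0))))) (by simp)
      (by intro V Γ x p y; simp) ![] ![p] ![B]
    simp only [AGSFormula.realize_and, AGSFormula.realize_imp, AGSFormula.realize_neg,
      AGSFormula.realize_mem, AGSTerm.realize_bneg, AGSTerm.realize_varG,
      AGSTerm.realize_varB] at this
    exact ⟨this.1, this.2⟩
  not_mem_bzero p := by
    simpa using transfer hM (a := 0) (g := 1) (b := 0) (.neg (.mem (.varG 0) zeroB)) (by simp)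
      (by intro V Γ x p y; simp) ![] ![p] ![]
  mem_bone p := by
    simpa using transfer hM (a := 0) (g := 1) (b := 0) (.mem (.varG 0) oneB) (by simp)
      (by intro V Γ x p y; simp) ![] ![p] ![]
  ext B C h := by
    have := transfer hM (a := 0) (g := 0) (b := 2)
      (.imp (.allG (.and (.imp (.mem (.varG 0) (.varB 0)) (.mem (.varG 0) (.varB 1)))
          (.imp (.mem (.varG 0) (.varB 1)) (.mem (.varG 0) (.varB 0)))))
        (.eq .bool (.varB 0) (.varB 1))) (by simp)
      (by
        intro V Γ x p y
        simp only [AGSFormula.realize_imp, AGSFormula.realize_allG, AGSFormula.realize_and,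
          AGSFormula.realize_mem, AGSFormula.realize_eq_bool, AGSTerm.realize_varG,
          AGSTerm.realize_varB]
        exact fun h => graph_bext fun q => ⟨(h q).1, (h q).2⟩) ![] ![] ![B, C]
    simp only [AGSFormula.realize_imp, AGSFormula.realize_allG, AGSFormula.realize_and,
      AGSFormula.realize_mem, AGSFormula.realize_eq_bool, AGSTerm.realize_varG,
      AGSTerm.realize_varB] at this
    exact this fun q => ⟨(h q).1, (h q).2⟩

theorem IsSetLike.mem_foldr (hB : M.IsSetLike) {ι : Type*} (l : List ι) (D : ι → M.B) (p : M.G) :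
    M.mem p (l.foldr (fun i t => M.badd (D i) t) M.bzero) ↔ ∃ i ∈ l, M.mem p (D i) := by
  induction l with
  | nil => simpa using hB.not_mem_bzero p
  | cons i l ih => rw [List.foldr_cons, hB.mem_badd, ih, List.exists_mem_cons_iff]

/-- `M` satisfies `θₖ` iff the graph sort is not covered by `k` independent elements of the
boolean sort. -/
theorem IsSetLike.satisfies_theta (hB : M.IsSetLike) (k : ℕ) : M.Satisfies (theta n k) ↔
    ∀ D : Fin k → M.B, (∀ p, ∃ i, M.mem p (D i)) →
      ∃ p q, M.edge p q ∧ ∃ i, M.mem p (D i) ∧ M.mem q (D i) := by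
  unfold theta AGSStructure.Satisfies
  rw [AGSFormula.realize_allsB]
  refine forall_congr' fun D => ?_
  rw [AGSFormula.realize_imp, AGSFormula.realize_eq_bool, AGSTerm.realize_sumB,
    AGSTerm.realize_oneB]
  refine imp_congr ⟨fun h p => ?_, fun h => hB.ext _ _ fun p => ?_⟩ ?_
  · have := hB.mem_bone p
    rw [← h, hB.mem_foldr] at this
    simpa using this
  · rw [hB.mem_foldr]
    simpa [hB.mem_bone p] using h p
  · simp only [AGSFormula.realize_exG, AGSFormula.realize_and, AGSFormula.realize_edge,
      AGSFormula.realize_disj_map, AGSFormula.realize_mem, AGSTerm.realize_varB,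
      AGSTerm.realize_varG, List.mem_finRange, true_and]
    rfl

theorem noAlg_theta (n k : ℕ) : (theta n k).NoAlgQuantifier := by
  simp [theta]

/-- `C` is the class of a node under the relation `H`. -/
def IsSameClass (M : AGSStructure.{v} n) (C : M.B) : Prop :=
  ∃ p, ∀ q, M.mem q C ↔ M.same p q

/-- The formula stating that, if the last boolean variable is a class of `H` covered by the others,
then one of the others contains an edge of the class. -/
def classFormula (n k : ℕ) : AGSFormula n 0 0 (k + 1) :=
  .imp (.exG (.allG (.and
      (.imp (.mem (.varG 1) (.varB (Fin.last k))) (.same (.varG 0) (.varG 1)))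
      (.imp (.same (.varG 0) (.varG 1)) (.mem (.varG 1) (.varB (Fin.last k)))))))
    (.imp (.allG (.imp (.mem (.varG 0) (.varB (Fin.last k)))
        (.disj ((List.finRange k).map fun i => .mem (.varG 0) (.varB i.castSucc)))))
      (.exG (.exG (.and (.edge (.varG 0) (.varG 1)) (.and (.mem (.varG 0) (.varB (Fin.last k)))
        (.and (.mem (.varG 1) (.varB (Fin.last k)))
        (.disj ((List.finRange k).map fun i => .and (.mem (.varG 0) (.varB i.castSucc))
          (.mem (.varG 1) (.varB i.castSucc))))))))))

theorem realize_classFormula {k : ℕ} (N : AGSStructure.{w} n) (y : Fin (k + 1) → N.B) : (classFormula n k).Realize N Fin.elim0 Fin.elim0 y ↔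
      (N.IsSameClass (y (Fin.last k)) →
      (∀ p, N.mem p (y (Fin.last k)) → ∃ i : Fin k, N.mem p (y i.castSucc)) →
      ∃ p q, N.edge p q ∧ N.mem p (y (Fin.last k)) ∧ N.mem q (y (Fin.last k)) ∧
        ∃ i : Fin k, N.mem p (y i.castSucc) ∧ N.mem q (y i.castSucc)) := by
  simp only [classFormula, AGSFormula.realize_exG, AGSFormula.realize_and, AGSFormula.realize_edge,
    AGSFormula.realize_imp, AGSFormula.realize_allG, AGSFormula.realize_same,
    AGSFormula.realize_disj_map, AGSFormula.realize_mem, AGSTerm.realize_varB,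
    AGSTerm.realize_varG, List.mem_finRange, true_and, ← iff_def]
  rfl

/-- If no finite number of independent elements cover the graph, then the same is true of the
classes of `H`. -/
theorem exists_edge_of_isSameClass (hM : M.Models (theoryU.{u} n))
    (hΘ : M.Models (theoryTheta n)) {C : M.B} (hC : M.IsSameClass C) {k : ℕ} (D : Fin k → M.B)
    (hD : ∀ p, M.mem p C → ∃ i, M.mem p (D i)) :
    ∃ p q, M.edge p q ∧ M.mem p C ∧ M.mem q C ∧ ∃ i, M.mem p (D i) ∧ M.mem q (D i) := by
  have key := hM (.imp (theta n (n * k)) (classFormula n k).allsB)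
    ⟨.of_noAlgQuantifier (by simp [noAlg_theta, classFormula]), fun V Γ hθ => by
      rw [AGSFormula.realize_allsB]
      intro y
      rw [realize_classFormula]
      rintro ⟨⟨x₀, l⟩, hl⟩ hy
      -- The trace of each of the `k` sets on copy `l` is transported to every copy, giving `n * k`
      -- sets that cover `Γ × n`. Each lies in one copy, so an edge inside it comes from `Γ` and can
      -- be moved back to copy `l`.
      obtain ⟨p, q, he, i, hp, hq⟩ := ((isSetLike_graphSystem Γ).satisfies_theta (n * k)).1 hθ
        (fun j => ({p : V × Fin n | p.2 = (finProdFinEquiv.symm j).1 ∧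
          (graphSystem n Γ).mem (p.1, l) (y (finProdFinEquiv.symm j).2.castSucc)} :
            Set (V × Fin n))) (by
          rintro ⟨x, m⟩
          obtain ⟨i, hi⟩ := hy (x, l) ((hl _).2 rfl)
          refine ⟨finProdFinEquiv (m, i), ?_, ?_⟩ <;> rw [Equiv.symm_apply_apply]
          exact hi)
      refine ⟨(p.1, l), (q.1, l), ?_, (hl _).2 rfl, (hl _).2 rfl, _, hp.2, hq.2⟩
      rcases he with he | he
      · exact Or.inl he
      · exact absurd (hp.1.trans hq.1.symm) he⟩
  have := (AGSFormula.realize_allsB M _ _ _ _).1 (key (hΘ _ ⟨_, rfl⟩)) (Fin.snoc D C)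
  rw [realize_classFormula] at this
  simp only [Fin.snoc_last, Fin.snoc_castSucc] at this
  exact this hC hD

/-- The `i`-th copy of `Γ` in `Γ × n`. -/
def classOf {V : Type u} (Γ : SimpleGraph V) (i : Fin n) : (graphSystem n Γ).B :=
  ({p : V × Fin n | p.2 = i} : Set (V × Fin n))

/-- The formula stating that the boolean variables are the classes of `H`, with all the edges
between distinct classes. -/
def copiesFormula (n : ℕ) : AGSFormula n 0 0 n :=
  -- The outer quantifier makes the formula vacuous for the empty graph, where no class has a
  -- representative.
  .allG (.and (.conj ((List.finRange n).map fun i => .exG (.allG (.and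
      (.imp (.mem (.varG 2) (.varB i)) (.same (.varG 1) (.varG 2)))
      (.imp (.same (.varG 1) (.varG 2)) (.mem (.varG 2) (.varB i)))))))
    (.and (.disj ((List.finRange n).map fun i => .mem (.varG 0) (.varB i)))
    (.allG (.conj ((List.finRange n ×ˢ List.finRange n).map fun ij =>
      .imp (.mem (.varG 0) (.varB ij.1)) (.imp (.mem (.varG 1) (.varB ij.2))
        (if ij.1 = ij.2 then .neg .bot else .and (.edge (.varG 0) (.varG 1))
          (.neg (.eq .graph (.varG 0) (.varG 1))))))))))

theorem realize_copiesFormula (N : AGSStructure.{w} n) (y : Fin n → N.B) : (copiesFormula n).Realize N Fin.elim0 Fin.elim0 y ↔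
      ∀ p : N.G, (∀ i, N.IsSameClass (y i)) ∧ (∃ i, N.mem p (y i)) ∧
      (∀ q i j, N.mem p (y i) → N.mem q (y j) → i ≠ j → N.edge p q ∧ p ≠ q) := by
  have hpair : ∀ ij : Fin n × Fin n, ij ∈ List.finRange n ×ˢ List.finRange n :=
    fun ij => List.mem_product.2 ⟨List.mem_finRange _, List.mem_finRange _⟩
  simp only [copiesFormula, AGSFormula.realize_exG, AGSFormula.realize_and, AGSFormula.realize_conj_map,
    AGSFormula.realize_imp, AGSFormula.realize_allG, AGSFormula.realize_same,
    AGSFormula.realize_disj_map, AGSFormula.realize_mem,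
    AGSTerm.realize_varB, AGSTerm.realize_varG, List.mem_finRange, true_and, true_imp_iff,
    hpair, Prod.forall, ← iff_def]
  refine forall_congr' fun p => and_congr Iff.rfl (and_congr Iff.rfl ?_)
  refine forall_congr' fun q => forall_congr' fun i => forall_congr' fun j =>
    imp_congr Iff.rfl (imp_congr Iff.rfl ?_)
  by_cases hij : i = j
  · simp [hij]
  · rw [if_neg hij, AGSFormula.realize_and]
    exact ⟨fun h _ => h, fun h => h hij⟩

/-- If the graph is not empty, its nodes are partitioned into `n` classes of `H`, with all the
edges between distinct classes. -/
theorem exists_copies (hM : M.Models (theoryU.{u} n)) (p₀ : M.G) :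
    ∃ C : Fin n → M.B, (∀ i, M.IsSameClass (C i)) ∧ (∀ p, ∃ i, M.mem p (C i)) ∧
      (∀ p q i j, M.mem p (C i) → M.mem q (C j) → i ≠ j → M.edge p q ∧ p ≠ q) := by
  have key := hM (copiesFormula n).exsB ⟨.of_noAlgQuantifier (by
      simp only [copiesFormula, AGSFormula.noAlg_exsB, AGSFormula.noAlg_allG, AGSFormula.noAlg_and,
        AGSFormula.noAlg_conj, AGSFormula.noAlg_disj, List.forall_mem_map, AGSFormula.noAlg_exG,
        AGSFormula.noAlg_imp, AGSFormula.noAlg_mem, AGSFormula.noAlg_same, implies_true, true_and]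
      intro ij _
      split_ifs <;> simp [AGSFormula.NoAlgQuantifier]), fun V Γ => by
    refine (AGSFormula.realize_exsB _ _ _ _ _).2
      ⟨fun i => classOf Γ i, ?_⟩
    rw [realize_copiesFormula]
    rintro ⟨x, m⟩
    refine ⟨fun i => ⟨(x, i), fun q => eq_comm⟩, ⟨m, rfl⟩, ?_⟩
    rintro ⟨x', m'⟩ i j rfl rfl hne
    exact ⟨Or.inr hne, fun h => hne (congrArg Prod.snd h)⟩⟩
  obtain ⟨C, hC⟩ := (AGSFormula.realize_exsB M _ _ _ _).1 key
  rw [realize_copiesFormula] at hC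
  exact ⟨C, (hC p₀).1, fun p => (hC p).2.1, fun p => (hC p).2.2⟩

/-- In a model of `Φ` the boolean sort is infinite. -/
theorem infinite_of_models_theoryPhi (hM : M.Models (theoryPhi n)) : Infinite M.B := by
  by_contra hfin
  rw [not_infinite_iff_finite] at hfin
  have := hM (phi n (Nat.card M.B + 1)) ⟨_, rfl⟩
  obtain ⟨y, hy⟩ := (AGSFormula.realize_exsB M _ _ _ _).1 this
  rw [AGSFormula.realize_conj] at hy
  simp only [List.forall_mem_map, AGSFormula.realize_neg, AGSFormula.realize_eq_bool,
    AGSTerm.realize_varB, List.mem_filter, decide_eq_true_eq] at hy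
  have hinj : Function.Injective y := by
    intro i j hij
    by_contra hne
    rcases lt_or_gt_of_ne hne with h | h
    · exact hy (i, j) ⟨List.mem_product.2 ⟨List.mem_finRange _, List.mem_finRange _⟩, h⟩ hij
    · exact hy (j, i) ⟨List.mem_product.2 ⟨List.mem_finRange _, List.mem_finRange _⟩, h⟩ hij.symm
  have := Nat.card_le_card_of_injective y hinj
  simp at this

/-! ### Theories of algebras -/

theorem realize_termToAGS (M : AGSStructure.{v} n) {k : ℕ} (x : Fin k → M.A)
    (t : (LPea n).Term (Empty ⊕ Fin k)) (p : Fin 0 → M.G) (y : Fin 0 → M.B) :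
    (termToAGS t).realize M x p y = t.realize (Sum.elim Empty.elim x) := by
  induction t with
  | var i =>
    rcases i with e | i
    · exact e.elim
    · rfl
  | func f ts ih =>
    exact congrArg (FirstOrder.Language.Structure.funMap (L := LPea n) (M := M.A) f) (funext ih)

theorem realize_formulaToAGS (M : AGSStructure.{v} n) {k : ℕ} (x : Fin k → M.A)
    (φ : (LPea n).BoundedFormula Empty k) (p : Fin 0 → M.G) (y : Fin 0 → M.B) :
    (formulaToAGS φ).Realize M x p y ↔ φ.Realize (Empty.elim : Empty → M.A) x := by
  induction φ with
  | falsum => exact Iff.rfl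
  | equal t₁ t₂ =>
    refine Eq.congr ?_ ?_ <;> exact realize_termToAGS M x _ p y
  | rel r _ => exact Empty.elim r
  | imp φ ψ ih₁ ih₂ => exact imp_congr (ih₁ x) (ih₂ x)
  | all φ ih => exact forall_congr' fun z => ih _

theorem models_peaTheoryToAGS (M : AGSStructure.{v} n) (T : (LPea n).Theory) :
    M.Models (peaTheoryToAGS T) ↔ M.A ⊨ T := by
  have key : ∀ φ : (LPea n).Sentence, M.Satisfies (formulaToAGS φ) ↔ M.A ⊨ φ := by
    intro φ
    refine (realize_formulaToAGS M _ φ _ _).trans ?_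
    rw [FirstOrder.Language.Sentence.Realize, FirstOrder.Language.Formula.Realize,
      Subsingleton.elim (default : Empty → M.A) Empty.elim,
      Subsingleton.elim (default : Fin 0 → M.A) Fin.elim0]
  constructor
  · exact fun h => ⟨fun φ hφ => (key φ).1 (h _ ⟨φ, hφ, rfl⟩)⟩
  · rintro h _ ⟨φ, hφ, rfl⟩
    exact (key φ).2 (h.realize_of_mem φ hφ)

theorem models_dfTheoryToAGS (M : AGSStructure.{v} n) (T : (LDf n).Theory) :
    M.Models (dfTheoryToAGS T) ↔ letI := (dfToPea n).reduct M.A; M.A ⊨ T := by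
  let := (dfToPea n).reduct M.A
  have : (dfToPea n).IsExpansionOn M.A := (dfToPea n).isExpansionOn_reduct M.A
  exact (models_peaTheoryToAGS M _).trans (FirstOrder.Language.LHom.onTheory_model _ T)

end AGSStructure

end AlgGraph

namespace AlgGraph

universe w

/-! ## Iterated ultrafilters -/

section IterUltrafilter

variable {Q : Type v}

/-- The ultrafilter of the sets of `m`-tuples containing `𝒰`-many tuples, coordinate by
coordinate. -/
def iterUltrafilter (𝒰 : Ultrafilter Q) : (m : ℕ) → Ultrafilter (Fin m → Q)
  | 0 => pure Fin.elim0
  | m + 1 => 𝒰.bind fun q => (iterUltrafilter 𝒰 m).map (Fin.cons (α := fun _ => Q) q)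

theorem eventually_iterUltrafilter_succ (𝒰 : Ultrafilter Q) (m : ℕ) (p : (Fin (m + 1) → Q) → Prop) :
    (∀ᶠ e in (iterUltrafilter 𝒰 (m + 1) : Filter _), p e) ↔
      ∀ᶠ q in (𝒰 : Filter Q), ∀ᶠ e in (iterUltrafilter 𝒰 m : Filter _),
        p (Fin.cons (α := fun _ => Q) q e) := Iff.rfl

/-- Deleting any coordinate of a generic tuple leaves a generic tuple. This does the work of
Ramsey's theorem: a property of almost all `m`-tuples holds for all facets of almost every `(m +
1)`-tuple simultaneously. -/
theorem eventually_iterUltrafilter_succAbove (𝒰 : Ultrafilter Q) {m : ℕ} (i : Fin (m + 1))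
    {p : (Fin m → Q) → Prop} (h : ∀ᶠ e in (iterUltrafilter 𝒰 m : Filter _), p e) :
    ∀ᶠ e in (iterUltrafilter 𝒰 (m + 1) : Filter _), p (e ∘ i.succAbove) := by
  induction m with
  | zero =>
    rw [eventually_iterUltrafilter_succ]
    refine .of_forall fun q => ?_
    convert h using 3
  | succ m ih =>
    rw [eventually_iterUltrafilter_succ]
    induction i using Fin.cases with
    | zero =>
      refine .of_forall fun q => ?_
      convert h using 3
      exact funext fun k => by simp
    | succ i =>
      rw [eventually_iterUltrafilter_succ] at h
      refine h.mono fun q hq => (ih i hq).mono fun e he => ?_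
      convert he using 1
      funext k
      induction k using Fin.cases <;> simp

theorem eventually_iterUltrafilter_ne {𝒰 : Ultrafilter Q}
    (h𝒰 : ∀ q, ∀ᶠ q' in (𝒰 : Filter Q), q' ≠ q) (m : ℕ) (q : Q) :
    ∀ᶠ e in (iterUltrafilter 𝒰 m : Filter (Fin m → Q)), ∀ k, e k ≠ q := by
  induction m with
  | zero => exact .of_forall fun e k => k.elim0
  | succ m ih =>
    rw [eventually_iterUltrafilter_succ]
    exact (h𝒰 q).mono fun q' hq' => ih.mono fun e he => Fin.cases hq' he

theorem eventually_iterUltrafilter_injective {𝒰 : Ultrafilter Q}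
    (h𝒰 : ∀ q, ∀ᶠ q' in (𝒰 : Filter Q), q' ≠ q) (m : ℕ) :
    ∀ᶠ e in (iterUltrafilter 𝒰 m : Filter (Fin m → Q)), Function.Injective e := by
  induction m with
  | zero => exact .of_forall fun e k => k.elim0
  | succ m ih =>
    rw [eventually_iterUltrafilter_succ]
    refine .of_forall fun q => ((eventually_iterUltrafilter_ne h𝒰 m q).and ih).mono fun e he => ?_
    rw [Fin.cons_injective_iff]
    exact ⟨fun ⟨k, hk⟩ => he.1 k hk, he.2⟩

end IterUltrafilter

/-! ## Representations of diagonal-free reducts -/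

/-- `h` embeds the diagonal-free reduct of the algebra sort into a set algebra. -/
structure IsDfRep {n : ℕ} (M : AGSStructure.{v} n) {U : Fin n → Type v}
    (h : M.A → Set (∀ k, U k)) : Prop where
  map_add : ∀ a b, h (M.add a b) = h a ∪ h b
  map_neg : ∀ a, h (M.neg a) = (h a)ᶜ
  map_zero : h M.zero = ∅
  map_one : h M.one = Set.univ
  map_cyl : ∀ i a, h (M.cyl i a) = cylSet i (h a)
  injective : Function.Injective h

/-- A single factor already separates elements: if it sent a nonzero element to `∅`, it would also
send the cylindrification of that element along `allCoords n`, which is 1, to `∅`. -/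
theorem exists_isDfRep {n : ℕ} {M : AGSStructure.{v} n} (hM : M.Models (theoryU.{u} n))
    (hn : 3 ≤ n) (hA : Nontrivial M.A) (hrep : HasRepresentableDfReduct n M.A) :
    ∃ U : Fin n → Type v, (∀ k, Nonempty (U k)) ∧ ∃ h : M.A → Set (∀ k, U k), IsDfRep M h := by
  obtain ⟨I, U, hU, ⟨f⟩⟩ := hrep
  let := (dfToPea n).reduct M.A
  let := prodStructure (LDf n) (fun i => Set (∀ k, U i k))
  have hadd (i : I) (a b : M.A) : f (M.add a b) i = f a i ∪ f b i :=
    congrFun (f.map_fun (n := 2) (.bool .add) ![a, b]) i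
  have hneg (i : I) (a : M.A) : f (M.neg a) i = (f a i)ᶜ :=
    congrFun (f.map_fun (n := 1) (.bool .neg) ![a]) i
  have hzero (i : I) : f M.zero i = ∅ := congrFun (f.map_fun (n := 0) (.bool .zero) ![]) i
  have hone (i : I) : f M.one i = Set.univ := congrFun (f.map_fun (n := 0) (.bool .one) ![]) i
  have hcyl (i : I) (j : Fin n) (a : M.A) : f (M.cyl j a) i = cylSet j (f a i) :=
    congrFun (f.map_fun (n := 1) (.cyl j) ![a]) i
  have hsep {a b : M.A} (hab : a ≠ b) : ∃ i, f a i ≠ f b i := by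
    by_contra! h
    exact hab (f.injective (funext h))
  obtain ⟨a, b, hab⟩ := hA
  obtain ⟨i, -⟩ := hsep hab
  refine ⟨U i, hU i, fun a => f a i, hadd i, hneg i, hzero i, hone i, hcyl i, fun a b h => ?_⟩
  by_contra hab
  obtain ⟨j, hj⟩ := hsep hab
  -- The symmetric difference of `a` and `b`: nonzero because of factor `j`, but empty in factor
  -- `i`.
  let d := M.add (M.neg (M.add (M.neg a) b)) (M.neg (M.add (M.neg b) a))
  have hd (k : I) : f d k = symmDiff (f a k) (f b k) := by
    simp only [d, hadd, hneg]
    ext x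
    simp [Set.mem_symmDiff]
  have hdj : d ≠ M.zero := by
    intro h0
    apply hj
    rw [← symmDiff_eq_bot, ← hd, h0, hzero]
    rfl
  have h1 := (M.eq_zero_or_cyls_eq_one hM hn d).resolve_left hdj
  have h2 (l : List (Fin n)) : f (M.cyls l d) i = ∅ := by
    induction l with
    | nil =>
      refine (hd i).trans ?_
      rw [show f a i = f b i from h]
      exact symmDiff_self _
    | cons k l ih =>
      refine (hcyl i k (M.cyls l d)).trans ?_
      rw [ih]
      exact Set.eq_empty_of_forall_notMem fun x ⟨y, hy, _⟩ => hy
  have h3 := h2 (allCoords n)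
  rw [h1, hone] at h3
  exact (Set.mem_empty_iff_false _).1 (h3 ▸ Set.mem_univ fun k => (hU i k).some)

namespace IsDfRep

variable {n : ℕ} {M : AGSStructure.{v} n} {U : Fin n → Type v} {h : M.A → Set (∀ k, U k)}

theorem map_mul (hh : IsDfRep M h) (a b : M.A) : h (M.mul a b) = h a ∩ h b := by
  simp [AGSStructure.mul, hh.map_neg, hh.map_add]

theorem mem_prod (hh : IsDfRep M h) {ι : Type} {l : List ι} {f : ι → M.A} {x : ∀ k, U k} :
    x ∈ h (M.prod l f) ↔ ∀ i ∈ l, x ∈ h (f i) := by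
  induction l with
  | nil => simp [AGSStructure.prod, hh.map_one]
  | cons i l ih =>
    rw [List.forall_mem_cons, ← ih]
    exact Set.ext_iff.1 (hh.map_mul (f i) (M.prod l f)) x

theorem subset_of_add_eq (hh : IsDfRep M h) {a b : M.A} (hab : M.add a b = b) : h a ⊆ h b := by
  rw [← hab, hh.map_add]
  exact Set.subset_union_left

theorem update_mem (hh : IsDfRep M h) {a : M.A} {k : Fin n} (ha : M.cyl k a = a) {x : ∀ k, U k}
    (hx : x ∈ h a) (u : U k) : Function.update x k u ∈ h a := by
  rw [← ha, hh.map_cyl]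
  exact ⟨x, hx, fun j hj => by simp [hj]⟩

theorem mem_of_agree (hh : IsDfRep M h) {a : M.A} {J : Set (Fin n)}
    (ha : ∀ k, k ∉ J → M.cyl k a = a) {x y : ∀ k, U k} (hx : x ∈ h a) (hxy : ∀ k ∈ J, x k = y k) :
    y ∈ h a := by
  classical
  have key : ∀ s : Finset (Fin n), s.piecewise y x ∈ h a := by
    intro s
    induction s using Finset.induction_on with
    | empty => simpa using hx
    | insert k s _ ih =>
      rw [Finset.piecewise_insert]
      by_cases hk : k ∈ J
      · rw [← hxy k hk]
        by_cases hks : k ∈ s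
        · rwa [Function.update_eq_self_iff.2]
          simp [hks, hxy k hk]
        · rwa [Function.update_eq_self_iff.2]
          simp [hks]
      · exact hh.update_mem (ha k hk) ih _
  simpa using key Finset.univ

/-- The relation between the `i`-th and the `j`-th coordinate given by the diagonal `d_ij`. -/
def Rel (h : M.A → Set (∀ k, U k)) (i j : Fin n) (u : U i) (v : U j) : Prop :=
  ∃ x ∈ h (M.diag i j), x i = u ∧ x j = v

theorem mem_diag_iff (hM : M.Models (theoryU.{u} n)) (hh : IsDfRep M h) {i j : Fin n}
    {x : ∀ k, U k} : x ∈ h (M.diag i j) ↔ Rel h i j (x i) (x j) := by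
  refine ⟨fun hx => ⟨x, hx, rfl, rfl⟩, fun ⟨y, hy, hi, hj⟩ => ?_⟩
  refine hh.mem_of_agree (J := {i, j}) (fun k hk => M.cyl_diag_of_ne hM ?_ ?_) hy ?_
  · rintro rfl
    simp at hk
  · rintro rfl
    simp at hk
  · rintro k (rfl | rfl)
    exacts [hi, hj]

theorem rel_symm (hM : M.Models (theoryU.{u} n)) {i j : Fin n} {u : U i} {v : U j}
    (huv : Rel h i j u v) : Rel h j i v u := by
  obtain ⟨x, hx, hi, hj⟩ := huv
  exact ⟨x, M.diag_symm hM i j ▸ hx, hj, hi⟩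

theorem exists_rel (hM : M.Models (theoryU.{u} n)) (hh : IsDfRep M h) [∀ k, Nonempty (U k)]
    {i j : Fin n} (hij : i ≠ j) (u : U i) : ∃ v, Rel h i j u v := by
  let x : ∀ k, U k := Function.update (fun k => Classical.arbitrary (U k)) i u
  have hx : x ∈ h (M.cyl j (M.diag j i)) := by
    rw [M.cyl_diag hM hij, hh.map_one]
    trivial
  rw [hh.map_cyl] at hx
  obtain ⟨y, hy, hyx⟩ := hx
  refine ⟨y j, rel_symm hM ⟨y, hy, rfl, ?_⟩⟩
  rw [hyx i hij]
  simp [x]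

theorem rel_comp (hM : M.Models (theoryU.{u} n)) (hh : IsDfRep M h) [∀ k, Nonempty (U k)]
    {i j k : Fin n} (hij : i ≠ j) (hkj : k ≠ j) (hik : i ≠ k) {u : U i} {v : U j} {w : U k}
    (huv : Rel h i j u v) (hvw : Rel h j k v w) : Rel h i k u w := by
  let x : ∀ k, U k := Function.update (Function.update (Function.update
    (fun k => Classical.arbitrary (U k)) i u) j v) k w
  have hi : x i = u := by simp [x, hij, hik]
  have hj : x j = v := by simp [x, hkj.symm]
  have hk : x k = w := by simp [x]
  rw [← hi, ← hj, ← mem_diag_iff hM hh] at huv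
  rw [← hj, ← hk, ← mem_diag_iff hM hh] at hvw
  rw [← hi, ← hk, ← mem_diag_iff hM hh, ← M.cyl_diag_mul_diag hM hij hkj, hh.map_cyl, hh.map_mul]
  exact ⟨x, ⟨huv, hvw⟩, fun _ _ => rfl⟩

theorem exists_rel_rel (hM : M.Models (theoryU.{u} n)) (hh : IsDfRep M h) {i j k : Fin n}
    (hij : i ≠ j) (hkj : k ≠ j) {u : U i} {w : U k} (huw : Rel h i k u w) :
    ∃ v, Rel h i j u v ∧ Rel h j k v w := by
  obtain ⟨x, hx, rfl, rfl⟩ := huw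
  rw [← M.cyl_diag_mul_diag hM hij hkj, hh.map_cyl, hh.map_mul] at hx
  obtain ⟨y, ⟨h1, h2⟩, hyx⟩ := hx
  refine ⟨y j, ?_, ?_⟩
  · rw [← hyx i hij]
    exact (mem_diag_iff hM hh).1 h1
  · rw [← hyx k hkj]
    exact (mem_diag_iff hM hh).1 h2

/-- A third coordinate `k` mediates: `u'` and `v` have a common partner `w` in `U k`, and composing
along distinct indices relates `w` both to `u` and to `v'`. -/
theorem rel_difunctional (hM : M.Models (theoryU.{u} n)) (hh : IsDfRep M h)
    [∀ k, Nonempty (U k)] (hn : 3 ≤ n) {i j : Fin n} (hij : i ≠ j) {u u' : U i} {v v' : U j}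
    (h1 : Rel h i j u v) (h2 : Rel h i j u' v) (h3 : Rel h i j u' v') : Rel h i j u v' := by
  obtain ⟨k, hk⟩ : ∃ k, k ∉ ({i, j} : Finset (Fin n)) := by
    by_contra hcon
    push Not at hcon
    have h1 := Finset.card_le_card (fun k _ => hcon k : (Finset.univ : Finset (Fin n)) ⊆ _)
    have h2 := Finset.card_le_two (a := i) (b := j)
    rw [Finset.card_univ, Fintype.card_fin] at h1
    omega
  simp only [Finset.mem_insert, Finset.mem_singleton, not_or] at hk
  obtain ⟨hki, hkj⟩ := hk
  obtain ⟨w, hw, hwv⟩ := exists_rel_rel hM hh (Ne.symm hki) (Ne.symm hkj) h2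
  have huw := rel_comp hM hh hij hkj (Ne.symm hki) h1 (rel_symm hM hwv)
  have hwv' := rel_comp hM hh hki hij.symm hkj (rel_symm hM hw) h3
  exact rel_comp hM hh (Ne.symm hki) (Ne.symm hkj) hij huw hwv'

/-- An element that does not depend on the coordinate `z` is closed under replacing coordinates
by others with the same diagonal relation to the coordinate `z`. -/
theorem mem_of_rel (hM : M.Models (theoryU.{u} n)) (hh : IsDfRep M h) {z : Fin n} {a : M.A}
    (ha : M.cyl z a = a) {x y : ∀ k, U k} (hx : x ∈ h a)
    (hxy : ∀ i, i ≠ z → ∃ v : U z, Rel h z i v (x i) ∧ Rel h z i v (y i)) : y ∈ h a := by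
  classical
  have key : ∀ s : Finset (Fin n), s.piecewise y x ∈ h a := by
    intro s
    induction s using Finset.induction_on with
    | empty => simpa using hx
    | insert k s hk ih =>
      rw [Finset.piecewise_insert]
      by_cases hkz : k = z
      · subst hkz
        exact hh.update_mem ha ih _
      · obtain ⟨v, hv, hv'⟩ := hxy k hkz
        set x' := s.piecewise y x
        have hx'k : x' k = x k := by simp [x', hk]
        -- The irrelevant coordinate `z` is set to the common partner `v`, which puts the tuple on
        -- `d_kz`. There `a` is determined by its `k`-cylindrification, so `x k` can be exchanged
        -- for `y k`; afterwards `z` is restored.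
        have h1 : Function.update x' z v ∈ h (M.mul (M.diag k z) a) := by
          rw [hh.map_mul]
          refine ⟨(mem_diag_iff hM hh).2 (rel_symm hM ?_), hh.update_mem ha ih _⟩
          simpa [hkz, hx'k] using hv
        have h2 : Function.update (Function.update x' z v) k (y k) ∈ h a := by
          refine hh.subset_of_add_eq (M.diag_mul_cyl_le hM hkz a) ?_
          rw [hh.map_mul, hh.map_cyl]
          refine ⟨(mem_diag_iff hM hh).2 (rel_symm hM ?_), _, h1, fun j hj => by simp [hj]⟩
          simpa [Ne.symm hkz] using hv'
        have h3 := hh.update_mem ha h2 (x' z)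
        convert h3 using 1
        funext j
        by_cases hjk : j = k
        · subst hjk
          simp [hkz]
        · by_cases hjz : j = z
          · subst hjz
            simp [hjk]
          · simp [hjk, hjz]
  simpa using key Finset.univ

/-- In a representation of the diagonal-free reduct there is a set of points on which the
diagonals are represented as usual. -/
theorem exists_points (hM : M.Models (theoryU.{u} n)) (hh : IsDfRep M h) [∀ k, Nonempty (U k)]
    (hn : 3 ≤ n) (z : Fin n) : ∃ (Q : Type v) (r : Q → ∀ k, U k),
      (∀ i j q q', i ≠ j → (Rel h i j (r q i) (r q' j) ↔ q = q')) ∧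
      (∀ i, i ≠ z → ∀ u : U i, ∃ q, Rel h z i (r q z) u) := by
  obtain ⟨o, ho⟩ : ∃ o : Fin n, o ≠ z := Fintype.exists_ne_of_one_lt_card (by simp; omega) _
  have htrans {j : Fin n} (hj : j ≠ z) {u u' : U z} {w : U o} (hu : Rel h z o u w)
      (hu' : Rel h z o u' w) {v : U j} (huv : Rel h z j u v) : Rel h z j u' v := by
    by_cases hjo : j = o
    · subst hjo
      exact rel_difunctional hM hh hn ho.symm hu' hu huv
    · exact rel_comp hM hh ho.symm hjo hj.symm hu'
        (rel_comp hM hh ho hj (Ne.symm hjo) (rel_symm hM hu) huv)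
  have hshared {j : Fin n} (hj : j ≠ z) {u u' : U z} {v : U j} (hu : Rel h z j u v)
      (hu' : Rel h z j u' v) : ∃ w, Rel h z o u w ∧ Rel h z o u' w := by
    by_cases hjo : j = o
    · subst hjo
      exact ⟨v, hu, hu'⟩
    · obtain ⟨w, hw⟩ := exists_rel hM hh hjo v
      exact ⟨w, rel_comp hM hh hj.symm (Ne.symm hjo) ho.symm hu hw,
        rel_comp hM hh hj.symm (Ne.symm hjo) ho.symm hu' hw⟩
  -- Points are classes of elements of `U z` with a common partner in `U o`. By `htrans` and
  -- `hshared` every other coordinate would give the same classes.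
  let s : Setoid (U z) :=
    { r := fun u u' => ∃ w, Rel h z o u w ∧ Rel h z o u' w
      iseqv :=
        ⟨fun u => (exists_rel hM hh ho.symm u).imp fun _ hw => ⟨hw, hw⟩,
          fun ⟨w, h1, h2⟩ => ⟨w, h2, h1⟩,
          fun ⟨_, h1, h2⟩ ⟨w', h3, h4⟩ => ⟨w', htrans ho h2 h1 h3, h4⟩⟩ }
  have hr (q : Quotient s) : ∃ r : ∀ k, U k, r z = q.out ∧ ∀ j, j ≠ z → Rel h z j (r z) (r j) := by
    choose g hg using fun j : {j // j ≠ z} => exists_rel hM hh j.2.symm q.out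
    refine ⟨fun k => if hk : k = z then hk ▸ q.out else g ⟨k, hk⟩, by simp, fun j hj => ?_⟩
    simpa [hj] using hg ⟨j, hj⟩
  choose r hrz hr using hr
  have hz (j : Fin n) (hj : j ≠ z) (q q' : Quotient s) :
      Rel h z j (r q z) (r q' j) ↔ q = q' := by
    constructor
    · intro h1
      have := hshared hj h1 (hr q' j hj)
      rw [hrz, hrz] at this
      exact Quotient.out_equiv_out.1 this
    · rintro rfl
      exact hr q j hj
  refine ⟨Quotient s, r, fun i j q q' hij => ?_, fun i hi u => ?_⟩
  · by_cases hi : i = z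
    · subst hi
      exact hz j hij.symm q q'
    · by_cases hj : j = z
      · subst hj
        rw [eq_comm, ← hz i hi q' q]
        exact ⟨rel_symm hM, rel_symm hM⟩
      · constructor
        · exact fun h1 => (hz j hj q q').1
            (rel_comp hM hh (Ne.symm hi) (Ne.symm hij) (Ne.symm hj) (hr q i hi) h1)
        · rintro rfl
          exact rel_comp hM hh hi hj hij (rel_symm hM (hr q i hi)) (hr q j hj)
  · obtain ⟨w, hw⟩ := exists_rel hM hh hi u
    refine ⟨⟦w⟧, ?_⟩
    obtain ⟨w', h1, h2⟩ : s.r w (Quotient.out ⟦w⟧) := Quotient.exact (Quotient.out_eq _).symm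
    rw [hrz]
    exact htrans hi h1 h2 (rel_symm hM hw)

end IsDfRep

/-! ### The Ramsey argument for infinite chromatic number -/

theorem S_foldr {n : ℕ} {M : AGSStructure.{v} n} (hM : M.Models (theoryU.{u} n))
    {U : Fin n → Type v} {h : M.A → Set (∀ k, U k)} (hh : IsDfRep M h) (i : Fin n) {ι : Type*}
    (l : List ι) (D : ι → M.B) (x : ∀ k, U k) (hx : x ∈ h (M.S i
      (l.foldr (fun j t => M.badd (D j) t) M.bzero))) : ∃ j ∈ l, x ∈ h (M.S i (D j)) := by
  induction l with
  | nil =>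
    exfalso
    have h0 : M.bzero = M.bneg M.bone := (M.isSetLike hM).ext _ _ fun p => by
      simp [(M.isSetLike hM).mem_bneg, (M.isSetLike hM).not_mem_bzero, (M.isSetLike hM).mem_bone]
    simp [h0, M.S_bneg hM, hh.map_mul, hh.map_neg] at hx
  | cons j l ih =>
    rw [List.foldr_cons, M.S_badd hM, hh.map_add] at hx
    rcases hx with hx | hx
    · exact ⟨j, by simp, hx⟩
    · obtain ⟨k, hk, hx⟩ := ih hx
      exact ⟨k, by simp [hk], hx⟩

theorem models_theoryTheta_of_isDfRep {m : ℕ} {M : AGSStructure.{v} (m + 1)}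
    (hM : M.Models (theoryU.{u} (m + 1))) (hn : 3 ≤ m + 1) {U : Fin (m + 1) → Type v}
    [∀ k, Nonempty (U k)] {h : M.A → Set (∀ k, U k)} (hh : IsDfRep M h) (hB : Infinite M.B) :
    M.Models (theoryTheta (m + 1)) := by
  obtain ⟨Q, r, hr, hcov⟩ := IsDfRep.exists_points hM hh hn 0
  let t (e : Fin (m + 1) → Q) : ∀ k, U k := fun k => r (e k) k
  have ht (e : Fin (m + 1) → Q) (i j) (hij : i ≠ j) : t e ∈ h (M.diag i j) ↔ e i = e j :=
    (IsDfRep.mem_diag_iff hM hh).trans (hr i j _ _ hij)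
  have hS (e e' : Fin (m + 1) → Q) (i) (hee' : ∀ k, k ≠ i → e k = e' k) (B : M.B)
      (he : t e ∈ h (M.S i B)) : t e' ∈ h (M.S i B) := by
    have := hh.update_mem (M.cyl_S hM i B) he (r (e' i) i)
    convert this using 1
    funext k
    by_cases hk : k = i
    · subst hk
      simp [t]
    · simp [hk, t, hee' k hk]
  -- If `Q` is finite, there are finitely many sets of `Q`-tuples, and `S 0 B`, hence `B`, is
  -- determined by the `Q`-tuples it contains.
  have hQ : Infinite Q := by
    by_contra hfin
    rw [not_infinite_iff_finite] at hfin
    refine hB.not_finite (Finite.of_injective (fun B => {e | t e ∈ h (M.S 0 B)}) fun B C hBC => ?_)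
    -- For `i ≠ 0` the entry `e i` is a point with the same partner in `U 0` as `x i`. The entry at
    -- 0 is arbitrary, since `S 0 B` does not depend on that coordinate.
    have key (x : ∀ k, U k) : ∃ e, ∀ B, x ∈ h (M.S 0 B) ↔ t e ∈ h (M.S 0 B) := by
      have hex (i : Fin (m + 1)) : ∃ q, i ≠ 0 → IsDfRep.Rel h 0 i (r q 0) (x i) := by
        by_cases hi : i = 0
        · exact ⟨(hcov ⟨1, by omega⟩ (by simp [Fin.ext_iff]) (Classical.arbitrary _)).choose,
            fun h => absurd hi h⟩
        · exact (hcov i hi (x i)).imp fun q hq _ => hq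
      choose e he using hex
      refine ⟨e, fun B => ⟨fun hx => ?_, fun hx => ?_⟩⟩
      · exact IsDfRep.mem_of_rel hM hh (M.cyl_S hM 0 B) hx fun i hi =>
          ⟨_, he i hi, (hr 0 i _ _ (Ne.symm hi)).2 rfl⟩
      · exact IsDfRep.mem_of_rel hM hh (M.cyl_S hM 0 B) hx fun i hi =>
          ⟨_, (hr 0 i _ _ (Ne.symm hi)).2 rfl, he i hi⟩
    refine M.S_injective hM hn 0 (hh.injective (Set.ext fun x => ?_))
    obtain ⟨e, he⟩ := key x
    rw [he, he]
    exact Set.ext_iff.1 hBC e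
  rintro _ ⟨k, rfl⟩
  have hset := M.isSetLike hM
  rw [hset.satisfies_theta]
  intro D hD
  by_contra hcon
  have hD1 : (List.finRange k).foldr (fun i t => M.badd (D i) t) M.bzero = M.bone :=
    hset.ext _ _ fun p => by
      rw [hset.mem_foldr]
      simpa [hset.mem_bone p] using hD p
  obtain ⟨q₀⟩ := hQ.nonempty
  -- `w` has colour `j`; the point `q₀` only fills the coordinate that `S 0` ignores. An injective
  -- `w` has a colour because its tuple lies in `S 0 1`.
  let P (j : Fin k) (w : Fin m → Q) : Prop :=
    t (Fin.cons (α := fun _ => Q) q₀ w) ∈ h (M.S 0 (D j))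
  have hP (w : Fin m → Q) (hw : Function.Injective w) : ∃ j, P j w := by
    have h1 : t (Fin.cons (α := fun _ => Q) q₀ w) ∈ h (M.S 0 M.bone) := by
      refine hh.subset_of_add_eq (M.prod_neg_diag_le hM 0) (hh.mem_prod.2 fun jk hjk => ?_)
      obtain ⟨h1, h2, h3⟩ := AGSStructure.mem_pairsOff.1 hjk
      rw [hh.map_neg, Set.mem_compl_iff, ht _ _ _ h3]
      obtain ⟨j, hj⟩ := Fin.exists_succ_eq.2 h1
      obtain ⟨l, hl⟩ := Fin.exists_succ_eq.2 h2
      rw [← hj, ← hl, Fin.cons_succ, Fin.cons_succ]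
      exact fun h => h3 (by rw [← hj, ← hl, hw h])
    rw [← hD1] at h1
    obtain ⟨j, _, hj⟩ := S_foldr hM hh 0 _ D _ h1
    exact ⟨j, hj⟩
  have hne (q : Q) : ∀ᶠ q' in (Filter.hyperfilter Q : Filter Q), q' ≠ q :=
    Set.Finite.compl_mem_hyperfilter (Set.finite_singleton q)
  obtain ⟨j, hj⟩ : ∃ j, ∀ᶠ w in (iterUltrafilter (Filter.hyperfilter Q) m : Filter _), P j w := by
    by_contra hno
    push Not at hno
    have h1 := Filter.eventually_all.2 fun j => hno j
    obtain ⟨w, hw, hinj⟩ := (h1.and (eventually_iterUltrafilter_injective hne m)).exists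
    obtain ⟨j, hj⟩ := hP w hinj
    exact hw j hj
  obtain ⟨e, he⟩ := (Filter.eventually_all.2 fun i =>
    eventually_iterUltrafilter_succAbove (Filter.hyperfilter Q) i hj).exists
  have hshift (i : Fin (m + 1)) : ∀ e, P j (e ∘ i.succAbove) → t e ∈ h (M.S i (D j)) := by
    induction i using Fin.induction with
    | zero =>
      refine fun e he => hS _ _ 0 (fun k hk => ?_) _ he
      obtain ⟨l, rfl⟩ := Fin.exists_succ_eq.2 hk
      simp
    | succ i ih =>
      intro e he
      -- Omitting place `i` from `e'` gives the same tuple as omitting place `i + 1` from `e`. As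
      -- `e'` repeats a point at these two places, it lies on their diagonal, where `S` passes from
      -- one place to the next.
      let e' := Function.update e i.succ (e i.castSucc)
      have hne : i.castSucc ≠ i.succ := (Fin.castSucc_lt_succ).ne
      have h1 : t e' ∈ h (M.S i.castSucc (D j)) := by
        apply ih
        convert he using 1
        funext l
        rcases lt_trichotomy l i with hl | rfl | hl
        · have h1 : i.castSucc.succAbove l = l.castSucc :=
            Fin.succAbove_of_castSucc_lt _ _ (by simpa using hl)
          have h2 : i.succ.succAbove l = l.castSucc :=
            Fin.succAbove_of_castSucc_lt _ _ (by rw [Fin.lt_def] at hl ⊢; simp; omega)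
          have h3 : l.castSucc ≠ i.succ := by
            intro h
            simp [Fin.ext_iff] at h
            rw [Fin.lt_def] at hl
            omega
          simp [e', h1, h2, h3]
        · simp [e']
        · have h1 : i.castSucc.succAbove l = l.succ :=
            Fin.succAbove_of_le_castSucc _ _ (by simpa using hl.le)
          have h2 : i.succ.succAbove l = l.succ :=
            Fin.succAbove_of_le_castSucc _ _ (by rw [Fin.lt_def] at hl; rw [Fin.le_def]; simp; omega)
          simp [e', h1, h2, hl.ne']
      have h2 : t e' ∈ h (M.S i.succ (D j)) := by
        refine hh.subset_of_add_eq (M.diag_mul_S_le hM i.castSucc i.succ (D j)) ?_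
        rw [hh.map_mul]
        exact ⟨(ht _ _ _ hne).2 (by simp [e', hne]), h1⟩
      exact hS _ _ _ (fun l hl => by simp [e', hl]) _ h2
  have hzero : t e ∈ h M.zero := by
    rw [← M.prod_S_eq_zero hM hn (B := D j) fun p q hp hq hpq => hcon ⟨p, q, hpq, j, hp, hq⟩]
    exact hh.mem_prod.2 fun i _ => hshift i e (he i)
  rw [hh.map_zero] at hzero
  exact hzero

theorem models_theoryTheta {n : ℕ} {M : AGSStructure.{v} n} (hM : M.Models (theoryU.{u} n))
    (hn : 3 ≤ n) (hB : Infinite M.B) (hrep : HasRepresentableDfReduct n M.A) :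
    M.Models (theoryTheta n) := by
  obtain ⟨m, rfl⟩ : ∃ m, n = m + 1 := ⟨n - 1, by omega⟩
  have : Nontrivial M.A := (M.S_injective hM hn 0).nontrivial
  obtain ⟨U, hU, h, hh⟩ := exists_isDfRep hM hn this hrep
  exact models_theoryTheta_of_isDfRep hM hn hh hB

end AlgGraph

namespace AlgGraph

universe w

/-! ## Networks of ultrafilters -/

theorem setoid_eq_of_agree {n : ℕ} {r s : Setoid (Fin n)} {i j : Fin n} (hij : i ≠ j) (hr : r i j)
    (hs : s i j) (h : ∀ k l, k ≠ i → l ≠ i → (r k l ↔ s k l)) : r = s := by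
  have hred : ∀ (r : Setoid (Fin n)), r i j → ∀ k l,
      (r k l ↔ r (if k = i then j else k) (if l = i then j else l)) := by
    intro r hr k l
    by_cases hk : k = i <;> by_cases hl : l = i <;> simp only [hk, hl, if_true, if_false]
    · exact ⟨fun _ => r.refl _, fun _ => r.refl _⟩
    · exact ⟨fun h => r.trans (r.symm hr) h, fun h => r.trans hr h⟩
    · exact ⟨fun h => r.trans h hr, fun h => r.trans h (r.symm hr)⟩
  ext k l
  rw [hred r hr, hred s hs]
  exact h _ _ (by split_ifs with hk; exacts [hij.symm, hk])
    (by split_ifs with hk; exacts [hij.symm, hk])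

theorem setoid_eq_of_isolated {n : ℕ} {r s : Setoid (Fin n)} {i : Fin n}
    (hr : ∀ j, j ≠ i → ¬ r i j) (hs : ∀ j, j ≠ i → ¬ s i j)
    (h : ∀ k l, k ≠ i → l ≠ i → (r k l ↔ s k l)) : r = s := by
  ext k l
  by_cases hk : k = i
  · subst hk
    by_cases hl : l = k
    · subst hl
      exact iff_of_true (r.refl _) (s.refl _)
    · exact iff_of_false (hr l hl) (hs l hl)
  · by_cases hl : l = i
    · subst hl
      exact iff_of_false (fun h => hr k hk (r.symm h)) (fun h => hs k hk (s.symm h))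
    · exact h k l hk hl

/-- Abstract properties of the ultrafilters of the algebra sort: `rel` is the equality type, `col`
the sequence of colours of the facets, `act` the action of the substitutions, `e` the value of
undefined colours, `copy` the copy on which a colour is concentrated, and `wild` a colour without
independent elements in the given copy. -/
structure Frame (n : ℕ) (W C : Type v) where
  rel : W → Setoid (Fin n)
  col : W → Fin n → C
  act : W → (Fin n → Fin n) → W
  e : C
  IsCol : C → Prop
  copy : C → Fin n
  wild : Fin n → C
  act_id : ∀ μ, act μ id = μ
  act_act : ∀ μ σ τ, act (act μ σ) τ = act μ (σ ∘ τ)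
  rel_act : ∀ μ σ, rel (act μ σ) = (rel μ).comap σ
  col_act : ∀ μ σ i, IsDist ((rel μ).comap σ) i → col (act μ σ) i = col μ (missing σ i)
  col_of_not_isDist : ∀ μ i, ¬ IsDist (rel μ) i → col μ i = e
  isCol_col : ∀ μ i, IsDist (rel μ) i → IsCol (col μ i)
  -- A degenerate label is determined by its type and one colour, so only discrete labels involve
  -- choices.
  eq_of_rel : ∀ μ ν i j, rel μ = rel ν → i ≠ j → rel μ i j → col μ i = col ν i → μ = ν
  isCol_wild : ∀ l, IsCol (wild l)
  copy_wild : ∀ l, copy (wild l) = l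
  -- The two alternatives are the two sources of edges: different copies are completely joined, and
  -- elements of a wild colour contain edges.
  exists_col_eq : ∀ (γ : Fin n → C) (i j : Fin n), (∀ k, IsCol (γ k)) → i ≠ j →
    (copy (γ i) ≠ copy (γ j) ∨ ∃ l, γ i = wild l ∧ γ j = wild l) → ∃ μ, rel μ = ⊥ ∧ col μ = γ

/-- Points of the base of the representation: `n` points, and points that extend a tuple `x` by
a new `i`-th coordinate such that the ultrafilter of the resulting tuple is `μ`. -/
inductive Pt (n : ℕ) (W : Type v) : Type v
  | base (i : Fin n) : Pt n W
  | new (x : Fin n → Pt n W) (i : Fin n) (μ : W) : Pt n W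

namespace Pt

variable {n : ℕ} {W : Type v}

def depth : Pt n W → ℕ
  | base _ => 0
  | new x _ _ => (Finset.univ.sup fun k => depth (x k)) + 1

/-- Depth comes first, so a point is younger than its components; the cardinal only breaks ties.
Later only maxima of finite sets are taken. -/
noncomputable def key (p : Pt n W) : ℕ ×ₗ Cardinal.{v} := toLex (p.depth, embeddingToCardinal p)

noncomputable instance : LinearOrder (Pt n W) :=
  LinearOrder.lift' key
    fun _ _ h => embeddingToCardinal.injective (congrArg Prod.snd (toLex.injective h))

theorem lt_new (x : Fin n → Pt n W) (i : Fin n) (μ : W) (k : Fin n) : x k < new x i μ := by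
  change key (x k) < key (new x i μ)
  rw [key, key, Prod.Lex.toLex_lt_toLex]
  left
  change _ < (Finset.univ.sup fun k => depth (x k)) + 1
  exact Nat.lt_succ_of_le (Finset.le_sup (f := fun k => depth (x k)) (Finset.mem_univ k))

theorem base_injective : Function.Injective (base : Fin n → Pt n W) := fun _ _ h => by
  injection h

end Pt

/-- The set of the points of a tuple other than the `i`-th one. -/
def facet {n : ℕ} {X : Type v} (x : Fin n → X) (i : Fin n) : Set X := {p | ∃ j, j ≠ i ∧ x j = p}

/-! ### Facets of tuples -/

section Facet

variable {n : ℕ} {X : Type v}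

theorem facet_congr {x y : Fin n → X} {i : Fin n} (h : ∀ k, k ≠ i → x k = y k) :
    facet x i = facet y i := by
  ext p
  exact exists_congr fun j => and_congr_right fun hj => by rw [h j hj]

theorem facet_comp {x : Fin n → X} {σ : Fin n → Fin n} {i : Fin n}
    (hσ : ∀ j k, j ≠ i → k ≠ i → σ j = σ k → j = k) :
    facet (x ∘ σ) i = facet x (missing σ i) := by
  ext p
  constructor
  · rintro ⟨j, hj, rfl⟩
    exact ⟨σ j, missing_spec σ i j hj, rfl⟩
  · rintro ⟨j, hj, rfl⟩
    by_contra hcon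
    exact hj (missing_unique hσ fun k hk hkj => hcon ⟨k, hk, by simp [hkj]⟩)

theorem facet_subset_range (x : Fin n → X) (i : Fin n) : facet x i ⊆ Set.range x := by
  rintro _ ⟨j, _, rfl⟩
  exact ⟨j, rfl⟩

theorem facet_injective {x : Fin n → X} (hx : Function.Injective x) {i j : Fin n}
    (h : facet x i = facet x j) : i = j := by
  by_contra hij
  have : x j ∈ facet x i := ⟨j, Ne.symm hij, rfl⟩
  rw [h] at this
  obtain ⟨k, hk, hkj⟩ := this
  exact hk (hx hkj)

theorem exists_max_facet [LinearOrder X] (hn : 2 ≤ n) (x : Fin n → X) (i : Fin n) :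
    ∃ z ∈ facet x i, ∀ p ∈ facet x i, p ≤ z := by
  have hfin : (facet x i).Finite := (Set.finite_range x).subset (facet_subset_range x i)
  obtain ⟨j, hj⟩ : ∃ j : Fin n, j ≠ i := Fintype.exists_ne_of_one_lt_card (by simp; omega) _
  obtain ⟨z, hz⟩ := hfin.exists_maximal ⟨x j, j, hj, rfl⟩
  exact ⟨z, hz.1, fun p hp => (le_total p z).elim id fun h => hz.2 hp h⟩

theorem range_eq_of_subset {x y : Fin n → X} (hx : Function.Injective x)
    (h : Set.range x ⊆ Set.range y) : Set.range x = Set.range y := by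
  choose σ hσ using fun k => h ⟨k, rfl⟩
  have hinj : Function.Injective σ := fun k l hkl => hx (by rw [← hσ, ← hσ, hkl])
  refine h.antisymm ?_
  rintro _ ⟨k, rfl⟩
  obtain ⟨l, rfl⟩ := Finite.surjective_of_injective hinj k
  exact ⟨l, (hσ l).symm⟩

end Facet

/-! ### Tuples with prescribed labels -/

namespace Frame

variable {n : ℕ} {W C : Type v} (F : Frame n W C) (μ₀ : W)

/-- The tuple `y` must be labelled with `μ` since it contains its youngest point `z`. -/
inductive Spec : (Fin n → Pt n W) → W → Pt n W → Prop
  -- Every base point counts as youngest in the base tuple, so all facets of that tuple are forced.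
  | base (k : Fin n) : Spec .base μ₀ (.base k)
  | new (x : Fin n → Pt n W) (i : Fin n) (μ : W) (hx : Function.Injective x) :
      Spec (Function.update x i (.new x i μ)) μ (.new x i μ)

variable {μ₀}

theorem update_new_injective {x : Fin n → Pt n W} (hx : Function.Injective x) (i : Fin n) (μ : W) :
    Function.Injective (Function.update x i (.new x i μ)) := by
  intro j k h
  by_cases hj : j = i <;> by_cases hk : k = i
  · rw [hj, hk]
  · subst hj
    simp only [Function.update_self, ne_eq, hk, not_false_eq_true, Function.update_of_ne] at h
    exact absurd h (Pt.lt_new x j μ k).ne'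
  · subst hk
    simp only [Function.update_self, ne_eq, hj, not_false_eq_true, Function.update_of_ne] at h
    exact absurd h (Pt.lt_new x k μ j).ne
  · simpa [hj, hk, hx.eq_iff] using h

theorem Spec.injective {y : Fin n → Pt n W} {μ : W} {z : Pt n W} (h : Spec μ₀ y μ z) :
    Function.Injective y := by
  cases h with
  | base k => exact Pt.base_injective
  | new x i μ hx => exact update_new_injective hx i μ

theorem Spec.mem_range {y : Fin n → Pt n W} {μ : W} {z : Pt n W} (h : Spec μ₀ y μ z) :
    z ∈ Set.range y := by
  cases h with
  | base k => exact ⟨k, rfl⟩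
  | new x i μ hx => exact ⟨i, by simp⟩

/-- A point remembers the tuple and the label for which it was created. -/
theorem Spec.unique {y y' : Fin n → Pt n W} {μ μ' : W} {z : Pt n W} (h : Spec μ₀ y μ z)
    (h' : Spec μ₀ y' μ' z) : y = y' ∧ μ = μ' := by
  cases h <;> cases h' <;> exact ⟨rfl, rfl⟩

/-- A new point is already the maximum of its tuple, and base points are interchangeable. This lets
the youngest point be taken to be the maximum of any facet that contains one. -/
theorem Spec.of_le {y : Fin n → Pt n W} {μ : W} {z z' : Pt n W} (h : Spec μ₀ y μ z)
    (hz : z ≤ z') (hz' : z' ∈ Set.range y) : Spec μ₀ y μ z' := by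
  obtain ⟨k, rfl⟩ := hz'
  cases h with
  | base l => exact .base k
  | new x i μ hx =>
    by_cases hk : k = i
    · subst hk
      simpa using Spec.new x k μ hx
    · simp only [ne_eq, hk, not_false_eq_true, Function.update_of_ne] at hz
      exact absurd hz (Pt.lt_new x i μ k).not_ge

theorem Spec.unique_of_range {y y' : Fin n → Pt n W} {μ μ' : W} {z z' : Pt n W}
    (h : Spec μ₀ y μ z) (h' : Spec μ₀ y' μ' z') (hr : Set.range y = Set.range y') :
    y = y' ∧ μ = μ' := by
  rcases le_total z z' with hle | hle
  · exact (h.of_le hle (hr ▸ h'.mem_range)).unique h'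
  · exact h.unique (h'.of_le hle (hr ▸ h.mem_range))

variable (μ₀) in
/-- A facet of a tuple with prescribed label that contains the youngest point of the tuple. -/
def Special (w : Set (Pt n W)) : Prop :=
  ∃ (q : (Fin n → Pt n W) × W × Fin n) (z : Pt n W),
    Spec μ₀ q.1 q.2.1 z ∧ z ∈ w ∧ w = facet q.1 q.2.2

variable (μ₀) in
-- At most one tuple is prescribed by `z`, and exactly one of its `n` facets omits `z`. The other `n
-- - 1` colours cannot occupy all `n` copies; this is what the factor `n` in `Γ × n` is for.
theorem exists_freeCopy (z : Pt n W) : ∃ l : Fin n, ∀ y μ j, Spec μ₀ y μ z →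
    z ∈ facet y j → F.copy (F.col μ j) ≠ l := by
  by_cases h : ∃ y μ, Spec μ₀ y μ z
  · obtain ⟨y, μ, h⟩ := h
    obtain ⟨k, hk⟩ := h.mem_range
    obtain ⟨l, hl⟩ := exists_missing (fun j => F.copy (F.col μ j)) k
    refine ⟨l, fun y' μ' j h' hz => ?_⟩
    obtain ⟨rfl, rfl⟩ := h.unique h'
    obtain ⟨m, hm, hmz⟩ := hz
    refine hl j ?_
    rintro rfl
    exact hm (h.injective (hmz.trans hk.symm))
  -- Nothing is forced here; the case split merely extracts some element of `Fin n`.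
  · cases z with
    | base i => exact ⟨i, fun y μ j hs => absurd ⟨y, μ, hs⟩ h⟩
    | new x i μ => exact ⟨i, fun y μ j hs => absurd ⟨y, μ, hs⟩ h⟩

end Frame

end AlgGraph

namespace AlgGraph

universe w

theorem isDist_bot {n : ℕ} (i : Fin n) : IsDist (⊥ : Setoid (Fin n)) i :=
  fun _ _ _ _ hjk h => hjk h

theorem exists_ne_ne {n : ℕ} (hn : 3 ≤ n) (i j : Fin n) : ∃ k, k ≠ i ∧ k ≠ j := by
  obtain ⟨k, hk⟩ := Finset.exists_mem_notMem_of_card_lt_card (s := {i, j}) (t := Finset.univ)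
    (Finset.card_le_two.trans_lt (by simp; omega))
  exact ⟨k, by simpa using hk⟩

/-! ### Colours of facets and labels of injective tuples -/

namespace Frame

variable {n : ℕ} {W C : Type v} (F : Frame n W C) (μ₀ : W)

noncomputable def freeCopy (z : Pt n W) : Fin n := Classical.choose (F.exists_freeCopy μ₀ z)

open Classical in
/-- The colour of a set of `n - 1` points. -/
noncomputable def bd (w : Set (Pt n W)) : C :=
  -- Neither `Special` nor this definition refers to validity, so the colours exist beforehand and
  -- `Valid` is a plain recursion on points.
  if h : Special μ₀ w then F.col h.choose.2.1 h.choose.2.2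
  else if h : ∃ z ∈ w, ∀ p ∈ w, p ≤ z then F.wild (F.freeCopy μ₀ h.choose)
  else F.e

/-- A point `new x i μ` is legitimate if so are its components, and `μ` fits the colour of the
`i`-th facet of `x`. -/
def Valid : Pt n W → Prop
  | .base _ => True
  | .new x i μ => (∀ k, Valid (x k)) ∧ Function.Injective x ∧ F.rel μ = ⊥ ∧
      F.col μ i = F.bd μ₀ (facet x i)

/-- The tuple `y` may be labelled with `μ`. -/
structure Adm (y : Fin n → Pt n W) (μ : W) : Prop where
  injective : Function.Injective y
  valid : ∀ k, F.Valid μ₀ (y k)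
  rel_eq : F.rel μ = ⊥
  col_eq : ∀ j, F.col μ j = F.bd μ₀ (facet y j)

variable {F μ₀}

/-- The forced colour is well defined: two tuples that force it share the maximum of the facet as
youngest point, so they coincide, and an injective tuple has distinct facets at distinct places. -/
theorem bd_of_spec (hn : 3 ≤ n) {y : Fin n → Pt n W} {μ : W} {z : Pt n W} {j : Fin n}
    (h : Spec μ₀ y μ z) (hz : z ∈ facet y j) : F.bd μ₀ (facet y j) = F.col μ j := by
  have hs : Special μ₀ (facet y j) := ⟨(y, μ, j), z, h, hz, rfl⟩
  rw [bd, dif_pos hs]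
  obtain ⟨z', hs', hz', hw⟩ := hs.choose_spec
  obtain ⟨m, hm, hmax⟩ := exists_max_facet (by omega) y j
  have h1 := h.of_le (hmax z hz) (facet_subset_range _ _ hm)
  have h2 := hs'.of_le (hmax z' hz') (facet_subset_range _ _ (hw ▸ hm))
  obtain ⟨he, hμ⟩ := h1.unique h2
  rw [← hμ]
  congr 1
  rw [← he] at hw
  exact (facet_injective h.injective hw).symm

theorem bd_of_not_special {w : Set (Pt n W)} {z : Pt n W} (h : ¬ Special μ₀ w) (hz : z ∈ w)
    (hmax : ∀ p ∈ w, p ≤ z) : F.bd μ₀ w = F.wild (F.freeCopy μ₀ z) := by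
  have hex : ∃ z ∈ w, ∀ p ∈ w, p ≤ z := ⟨z, hz, hmax⟩
  rw [bd, dif_neg h, dif_pos hex,
    le_antisymm (hmax _ hex.choose_spec.1) (hex.choose_spec.2 z hz)]

/-- Facets through a youngest point have the right colour by `bd_of_spec`. The one facet that omits
a new point is the facet of the old tuple, where validity of the new point demands the colour. -/
theorem Spec.adm (hn : 3 ≤ n) (hμ₀ : F.rel μ₀ = ⊥) {y : Fin n → Pt n W} {μ : W} {z : Pt n W}
    (h : Spec μ₀ y μ z) (hz : F.Valid μ₀ z) : F.Adm μ₀ y μ := by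
  refine ⟨h.injective, ?_, ?_, ?_⟩
  · cases h with
    | base k => exact fun _ => trivial
    | new x i μ hx =>
      intro k
      by_cases hk : k = i
      · subst hk
        simpa using hz
      · simpa [hk] using hz.1 k
  · cases h with
    | base k => exact hμ₀
    | new x i μ hx => exact hz.2.2.1
  · intro j
    cases h with
    | base k =>
      obtain ⟨l, hl, -⟩ := exists_ne_ne hn j j
      exact (bd_of_spec hn (.base l) ⟨l, hl, rfl⟩).symm
    | new x i μ hx =>
      by_cases hj : j = i
      · subst hj
        rw [hz.2.2.2]
        congr 1
        exact facet_congr fun k hk => by simp [hk]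
      · exact (bd_of_spec hn (.new x i μ hx) ⟨i, Ne.symm hj, by simp⟩).symm

theorem isCol_bd (hn : 3 ≤ n) (hμ₀ : F.rel μ₀ = ⊥) {y : Fin n → Pt n W}
    (hy : ∀ k, F.Valid μ₀ (y k)) (j : Fin n) : F.IsCol (F.bd μ₀ (facet y j)) := by
  by_cases h : Special μ₀ (facet y j)
  · obtain ⟨⟨y', μ', j'⟩, z, hs, hz, hw⟩ := h
    have hv : F.Valid μ₀ z := by
      obtain ⟨k, -, rfl⟩ := hz
      exact hy k
    simp only at hs hw
    rw [hw, bd_of_spec hn hs (hw ▸ hz)]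
    exact F.isCol_col _ _ ((hs.adm hn hμ₀ hv).rel_eq ▸ isDist_bot _)
  · obtain ⟨z, hz, hmax⟩ := exists_max_facet (by omega) y j
    rw [bd_of_not_special h hz hmax]
    exact F.isCol_wild _

theorem Adm.rel_act {y : Fin n → Pt n W} {μ : W} (h : F.Adm μ₀ y μ) (σ : Fin n → Fin n)
    (k l : Fin n) : F.rel (F.act μ σ) k l ↔ (y ∘ σ) k = (y ∘ σ) l := by
  rw [F.rel_act, h.rel_eq, Setoid.comap_rel]
  exact h.injective.eq_iff.symm

theorem Adm.col_act {y : Fin n → Pt n W} {μ : W} (h : F.Adm μ₀ y μ) (σ : Fin n → Fin n)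
    (i : Fin n) (hi : IsDist (F.rel (F.act μ σ)) i) :
    F.col (F.act μ σ) i = F.bd μ₀ (facet (y ∘ σ) i) := by
  rw [F.rel_act] at hi
  rw [F.col_act _ _ _ hi, h.col_eq, facet_comp]
  intro j k hj hk hjk
  by_contra hne
  exact hi j k hj hk hne (by rw [Setoid.comap_rel, hjk])

theorem Adm.act {y : Fin n → Pt n W} {μ : W} (h : F.Adm μ₀ y μ) {σ : Fin n → Fin n}
    (hσ : Function.Injective σ) : F.Adm μ₀ (y ∘ σ) (F.act μ σ) := by
  have hr : F.rel (F.act μ σ) = ⊥ := by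
    ext k l
    rw [h.rel_act]
    exact (h.injective.comp hσ).eq_iff
  exact ⟨h.injective.comp hσ, fun k => h.valid _, hr,
    fun j => h.col_act σ j (hr ▸ isDist_bot j)⟩

theorem exists_adm (hn : 3 ≤ n) (hμ₀ : F.rel μ₀ = ⊥) {y : Fin n → Pt n W}
    (hinj : Function.Injective y) (hy : ∀ k, F.Valid μ₀ (y k)) : ∃ μ, F.Adm μ₀ y μ := by
  by_cases hA : ∃ y' μ' z', Spec μ₀ y' μ' z' ∧ F.Valid μ₀ z' ∧ Set.range y' = Set.range y
  · obtain ⟨y', μ', z', hs, hz, hr⟩ := hA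
    choose σ hσ using fun k => (hr ▸ Set.mem_range_self k : y k ∈ Set.range y')
    obtain rfl : y' ∘ σ = y := funext hσ
    exact ⟨_, (hs.adm hn hμ₀ hz).act (Function.Injective.of_comp hinj)⟩
  · have : Nonempty (Fin n) := ⟨⟨0, by omega⟩⟩
    obtain ⟨k₀, hk₀⟩ := Finite.exists_max y
    have hmem : ∀ {j}, j ≠ k₀ → y k₀ ∈ facet y j := fun hj => ⟨k₀, hj.symm, rfl⟩
    have hmax : ∀ {j}, ∀ p ∈ facet y j, p ≤ y k₀ := by
      rintro j _ ⟨k, -, rfl⟩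
      exact hk₀ k
    -- Two special facets through the maximum `y k₀` would be forced by one and the same tuple.
    -- Together they exhaust `y`, so that tuple would have the range of `y`, against `hA`. Two such
    -- facets exist because `n ≥ 3`.
    obtain ⟨j₁, hj₁, hs₁⟩ : ∃ j, j ≠ k₀ ∧ ¬ Special μ₀ (facet y j) := by
      by_contra hcon
      push Not at hcon
      obtain ⟨j₁, hj₁, -⟩ := exists_ne_ne hn k₀ k₀
      obtain ⟨j₂, hj₂, hj⟩ := exists_ne_ne hn k₀ j₁
      obtain ⟨⟨y₁, μ₁, l₁⟩, z₁, hs₁, hz₁, hw₁⟩ := hcon j₁ hj₁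
      obtain ⟨⟨y₂, μ₂, l₂⟩, z₂, hs₂, hz₂, hw₂⟩ := hcon j₂ hj₂
      simp only at hs₁ hs₂ hw₁ hw₂
      have hsub₁ : facet y j₁ ⊆ Set.range y₁ := hw₁ ▸ facet_subset_range _ _
      have hsub₂ : facet y j₂ ⊆ Set.range y₂ := hw₂ ▸ facet_subset_range _ _
      have h₁ := hs₁.of_le (hmax _ hz₁) (hsub₁ (hmem hj₁))
      have h₂ := hs₂.of_le (hmax _ hz₂) (hsub₂ (hmem hj₂))
      obtain ⟨rfl, -⟩ := h₁.unique h₂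
      refine hA ⟨y₁, μ₁, z₁, hs₁, ?_, (range_eq_of_subset hinj ?_).symm⟩
      · obtain ⟨k, -, rfl⟩ := hz₁
        exact hy k
      · rintro _ ⟨k, rfl⟩
        by_cases hk : k = j₁
        · exact hsub₂ ⟨k, hk ▸ hj.symm, rfl⟩
        · exact hsub₁ ⟨k, hk, rfl⟩
    obtain ⟨j₂, hj₂, hj⟩ := exists_ne_ne hn k₀ j₁
    have hb₁ : F.bd μ₀ (facet y j₁) = F.wild (F.freeCopy μ₀ (y k₀)) :=
      bd_of_not_special hs₁ (hmem hj₁) hmax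
    -- Facet `j₁` is wild on the free copy of `y k₀`. Facet `j₂` is either wild with the same
    -- colour, or forced and then on another copy by the choice of the free copy.
    obtain ⟨μ, hμ, hcol⟩ := F.exists_col_eq (fun j => F.bd μ₀ (facet y j)) j₁ j₂
      (isCol_bd hn hμ₀ hy) hj.symm (by
        by_cases hs₂ : Special μ₀ (facet y j₂)
        · left
          obtain ⟨⟨y', μ', j'⟩, z, hs, hz, hw⟩ := hs₂
          simp only at hs hw
          have h := hs.of_le (hmax _ hz) (facet_subset_range _ j' (hw ▸ hmem hj₂))
          have hm : y k₀ ∈ facet y' j' := hw ▸ hmem hj₂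
          rw [hb₁, F.copy_wild, hw, bd_of_spec hn h hm]
          exact (Classical.choose_spec (F.exists_freeCopy μ₀ (y k₀)) y' μ' j' h hm).symm
        · exact Or.inr ⟨_, hb₁, bd_of_not_special hs₂ (hmem hj₂) hmax⟩)
    exact ⟨μ, hinj, hy, hμ, fun j => congrFun hcol j⟩

/-! ### Gluing the labels of injective tuples -/

variable (F μ₀) in
/-- `Y` is the range of an injective tuple of valid points. -/
def IsBase (Y : Set (Pt n W)) : Prop :=
  ∃ y : Fin n → Pt n W, Function.Injective y ∧ (∀ k, F.Valid μ₀ (y k)) ∧ Set.range y = Y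

theorem exists_chart (hn : 3 ≤ n) (hμ₀ : F.rel μ₀ = ⊥) (Y : Set (Pt n W)) :
    ∃ q : (Fin n → Pt n W) × W, F.IsBase μ₀ Y → F.Adm μ₀ q.1 q.2 ∧ Set.range q.1 = Y ∧
      ∀ y μ z, Spec μ₀ y μ z → F.Valid μ₀ z → Set.range y = Y → q = (y, μ) := by
  by_cases hA : ∃ y μ z, Spec μ₀ y μ z ∧ F.Valid μ₀ z ∧ Set.range y = Y
  · obtain ⟨y, μ, z, hs, hz, rfl⟩ := hA
    refine ⟨(y, μ), fun _ => ⟨hs.adm hn hμ₀ hz, rfl, fun y' μ' z' hs' _ hr => ?_⟩⟩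
    obtain ⟨rfl, rfl⟩ := hs.unique_of_range hs' hr.symm
    rfl
  · by_cases hY : F.IsBase μ₀ Y
    · obtain ⟨y, hy, hv, hr⟩ := hY
      obtain ⟨μ, hμ⟩ := exists_adm hn hμ₀ hy hv
      exact ⟨(y, μ), fun _ => ⟨hμ, hr, fun y' μ' z' hs hz hr' =>
        absurd ⟨y', μ', z', hs, hz, hr'⟩ hA⟩⟩
    · exact ⟨(.base, μ₀), fun h => absurd h hY⟩

theorem exists_isBase {x : Fin n → Pt n W} (hx : ∀ k, F.Valid μ₀ (x k)) :
    ∃ Y, F.IsBase μ₀ Y ∧ Set.range x ⊆ Y := by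
  classical
  obtain ⟨u, hu₁, hu₂, hu⟩ := Finset.exists_subsuperset_card_eq (n := n)
    (s := Finset.univ.image x) (t := Finset.univ.image x ∪ Finset.univ.image Pt.base)
    Finset.subset_union_left (Finset.card_image_le.trans (by simp))
    (le_trans (by rw [Finset.card_image_of_injective _ Pt.base_injective]; simp)
      (Finset.card_le_card Finset.subset_union_right))
  have e := u.equivFinOfCardEq hu
  refine ⟨u, ⟨fun k => e.symm k, fun k l h => e.symm.injective (Subtype.ext h), fun k => ?_, ?_⟩,
    ?_⟩
  · change F.Valid μ₀ (e.symm k)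
    have := hu₂ (e.symm k).2
    simp only [Finset.mem_union, Finset.mem_image, Finset.mem_univ, true_and] at this
    rcases this with ⟨l, hl⟩ | ⟨l, hl⟩
    · exact hl ▸ hx l
    · rw [← hl]
      trivial
  · ext p
    exact ⟨fun ⟨k, hk⟩ => hk ▸ (e.symm k).2, fun hp => ⟨e ⟨p, hp⟩, by simp⟩⟩
  · rintro _ ⟨k, rfl⟩
    exact hu₁ (by simp)

/-- An injective tuple determines its chart and its coordinates. A degenerate one may lie in several
charts, but its label is determined by the type, which is its kernel, and by one colour, which
depends only on a facet. -/
theorem act_eq_act {q : Set (Pt n W) → (Fin n → Pt n W) × W} {Y Y' : Set (Pt n W)}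
    (hq : F.Adm μ₀ (q Y).1 (q Y).2) (hq' : F.Adm μ₀ (q Y').1 (q Y').2)
    (hY : Set.range (q Y).1 = Y) (hY' : Set.range (q Y').1 = Y') {σ σ' : Fin n → Fin n}
    (h : (q Y).1 ∘ σ = (q Y').1 ∘ σ') : F.act (q Y).2 σ = F.act (q Y').2 σ' := by
  by_cases hinj : Function.Injective ((q Y).1 ∘ σ)
  · have hs := Finite.surjective_of_injective (Function.Injective.of_comp hinj)
    have hs' := Finite.surjective_of_injective (Function.Injective.of_comp (h ▸ hinj))
    obtain rfl : Y = Y' := by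
      rw [← hY, ← hY', ← hs.range_comp, h, hs'.range_comp]
    rw [hq.injective.comp_left h]
  · rw [Function.not_injective_iff] at hinj
    obtain ⟨i, j, hij, hne⟩ := hinj
    have hr : F.rel (F.act (q Y).2 σ) = F.rel (F.act (q Y').2 σ') := by
      ext k l
      rw [hq.rel_act, hq'.rel_act, h]
    refine F.eq_of_rel _ _ i j hr hne ((hq.rel_act σ i j).2 hij) ?_
    by_cases hi : IsDist (F.rel (F.act (q Y).2 σ)) i
    · rw [hq.col_act σ i hi, hq'.col_act σ' i (hr ▸ hi), h]
    · rw [F.col_of_not_isDist _ _ hi, F.col_of_not_isDist _ _ (hr ▸ hi)]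

variable (F μ₀) in
/-- `N` labels all tuples of valid points in a coherent way. -/
structure IsLabelling (N : (Fin n → Pt n W) → W) : Prop where
  rel_iff : ∀ x, (∀ k, F.Valid μ₀ (x k)) → ∀ i j, F.rel (N x) i j ↔ x i = x j
  comp : ∀ x τ, (∀ k, F.Valid μ₀ (x k)) → N (x ∘ τ) = F.act (N x) τ
  col_eq : ∀ x i, (∀ k, F.Valid μ₀ (x k)) → IsDist (F.rel (N x)) i →
    F.col (N x) i = F.bd μ₀ (facet x i)
  of_spec : ∀ x μ z, Spec μ₀ x μ z → F.Valid μ₀ z → N x = μ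

/-- Each `n`-element set of valid points gets one chart, an enumeration with a label, prescribed if
possible. Every tuple of valid points is pulled back from a chart, and `act_eq_act` makes the result
independent of the chart. -/
theorem exists_isLabelling (hn : 3 ≤ n) (hμ₀ : F.rel μ₀ = ⊥) : ∃ N, F.IsLabelling μ₀ N := by
  choose q hq using exists_chart hn hμ₀
  have hcover : ∀ x : Fin n → Pt n W, ∃ Y σ, (∀ k, F.Valid μ₀ (x k)) →
      F.IsBase μ₀ Y ∧ x = (q Y).1 ∘ σ := by
    intro x
    by_cases hx : ∀ k, F.Valid μ₀ (x k)
    · obtain ⟨Y, hY, hxY⟩ := exists_isBase hx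
      choose σ hσ using fun k => (((hq Y hY).2.1).symm ▸ hxY (Set.mem_range_self k) :
        x k ∈ Set.range (q Y).1)
      exact ⟨Y, σ, fun _ => ⟨hY, (funext hσ).symm⟩⟩
    · exact ⟨∅, id, fun h => absurd h hx⟩
  choose Y σ hcover using hcover
  have heq : ∀ x, (∀ k, F.Valid μ₀ (x k)) → ∀ Y' σ', F.IsBase μ₀ Y' → x = (q Y').1 ∘ σ' →
      F.act (q (Y x)).2 (σ x) = F.act (q Y').2 σ' := by
    intro x hx Y' σ' hY' h'
    obtain ⟨hY, h⟩ := hcover x hx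
    exact act_eq_act (hq _ hY).1 (hq _ hY').1 (hq _ hY).2.1 (hq _ hY').2.1 (h ▸ h')
  refine ⟨fun x => F.act (q (Y x)).2 (σ x), fun x hx i j => ?_, fun x τ hx => ?_,
    fun x i hx hi => ?_, fun x μ z hs hz => ?_⟩
  · obtain ⟨hY, h⟩ := hcover x hx
    rw [(hq _ hY).1.rel_act, ← h]
  · obtain ⟨hY, h⟩ := hcover x hx
    rw [F.act_act]
    refine heq (x ∘ τ) (fun k => hx _) _ _ hY ?_
    conv_lhs => rw [h]
    rfl
  · obtain ⟨hY, h⟩ := hcover x hx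
    rw [(hq _ hY).1.col_act _ _ hi, ← h]
  · have ha := hs.adm hn hμ₀ hz
    have hY : F.IsBase μ₀ (Set.range x) := ⟨x, ha.injective, ha.valid, rfl⟩
    have hqx := (hq _ hY).2.2 x μ z hs hz rfl
    have := heq x ha.valid _ id hY (by rw [hqx]; rfl)
    simpa [hqx, F.act_id] using this

theorem IsLabelling.col_congr {N : (Fin n → Pt n W) → W} (hN : F.IsLabelling μ₀ N)
    {x y : Fin n → Pt n W} (hx : ∀ k, F.Valid μ₀ (x k)) (hy : ∀ k, F.Valid μ₀ (y k)) {i : Fin n}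
    (h : ∀ k, k ≠ i → x k = y k) : F.col (N x) i = F.col (N y) i := by
  have hd : IsDist (F.rel (N x)) i ↔ IsDist (F.rel (N y)) i := by
    refine forall_congr' fun j => forall_congr' fun k => forall_congr' fun hj =>
      forall_congr' fun hk => ?_
    rw [hN.rel_iff x hx, hN.rel_iff y hy, h j hj, h k hk]
  by_cases hi : IsDist (F.rel (N x)) i
  · rw [hN.col_eq x i hx hi, hN.col_eq y i hy (hd.1 hi), facet_congr h]
  · rw [F.col_of_not_isDist _ _ hi, F.col_of_not_isDist _ _ (mt hd.2 hi)]

/-! ### One-point extensions -/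

theorem exists_base_ne (x : Fin n → Pt n W) (i : Fin n) : ∃ b, ∀ k, k ≠ i → x k ≠ .base b := by
  obtain ⟨b, hb⟩ := exists_missing (fun k => match x k with | .base b => b | .new _ _ _ => k) i
  refine ⟨b, fun k hk h => hb k hk ?_⟩
  simp only [h]

theorem valid_update {x : Fin n → Pt n W} (hx : ∀ k, F.Valid μ₀ (x k)) {p : Pt n W}
    (hp : F.Valid μ₀ p) (i k : Fin n) : F.Valid μ₀ (Function.update x i p k) := by
  by_cases hk : k = i
  · subst hk
    simpa using hp
  · simpa [hk] using hx k

/-- After an unused base point is put in place `i`, the tuple `y` is injective, and `new y i ν` was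
adjoined for exactly this request. -/
theorem IsLabelling.exists_update_of_bot {N : (Fin n → Pt n W) → W} (hN : F.IsLabelling μ₀ N)
    {x : Fin n → Pt n W} (hx : ∀ k, F.Valid μ₀ (x k)) {i : Fin n} {ν : W} (hν : F.rel ν = ⊥)
    (hinj : ∀ j k, j ≠ i → k ≠ i → x j = x k → j = k) (hcol : F.col ν i = F.col (N x) i) :
    ∃ p, F.Valid μ₀ p ∧ N (Function.update x i p) = ν := by
  obtain ⟨b, hb⟩ := exists_base_ne x i
  set y := Function.update x i (.base b) with hy
  have hyx : ∀ k, k ≠ i → y k = x k := fun k hk => by simp [hy, hk]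
  have hyi : y i = .base b := by simp [hy]
  have hyv : ∀ k, F.Valid μ₀ (y k) := fun k => valid_update hx (by trivial) i k
  have hyinj : Function.Injective y := by
    intro j k h
    by_cases hj : j = i <;> by_cases hk : k = i
    · rw [hj, hk]
    · rw [hj, hyi, hyx k hk] at h
      exact absurd h.symm (hb k hk)
    · rw [hk, hyi, hyx j hj] at h
      exact absurd h (hb j hj)
    · rw [hyx j hj, hyx k hk] at h
      exact hinj j k hj hk h
  have hd : IsDist (F.rel (N y)) i := fun j k _ _ hjk h => hjk (hyinj ((hN.rel_iff y hyv j k).1 h))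
  have hp : F.Valid μ₀ (.new y i ν) := by
    refine ⟨hyv, hyinj, hν, ?_⟩
    rw [hcol, hN.col_congr hx hyv fun k hk => (hyx k hk).symm, hN.col_eq y i hyv hd]
  refine ⟨_, hp, ?_⟩
  have := hN.of_spec _ _ _ (Spec.new y i ν hyinj) hp
  rwa [hy, Function.update_idem] at this

/-- If `ν` identifies `i` with `j`, the point `x j` serves; if `ν` is discrete, a new point does.
Otherwise `i` is isolated and some `j ∼ k` off `i`, and it is enough to get the colour at `j` right
with a point not among the others. -/
theorem IsLabelling.exists_update (hn : 3 ≤ n) {N : (Fin n → Pt n W) → W}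
    (hN : F.IsLabelling μ₀ N) {x : Fin n → Pt n W} (hx : ∀ k, F.Valid μ₀ (x k)) {i : Fin n} {ν : W}
    (hrel : ∀ j k, j ≠ i → k ≠ i → (F.rel ν j k ↔ x j = x k))
    (hcol : F.col ν i = F.col (N x) i) :
    ∃ p, F.Valid μ₀ p ∧ N (Function.update x i p) = ν := by
  have hup : ∀ (p : Pt n W) k, k ≠ i → Function.update x i p k = x k := fun p k hk => by simp [hk]
  have hoff : ∀ p, F.Valid μ₀ p → ∀ k l, k ≠ i → l ≠ i →
      (F.rel (N (Function.update x i p)) k l ↔ F.rel ν k l) := by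
    intro p hp k l hk hl
    rw [hN.rel_iff _ (valid_update hx hp i), hup p k hk, hup p l hl, hrel k l hk hl]
  by_cases h1 : ∃ j, j ≠ i ∧ F.rel ν i j
  · obtain ⟨j, hj, hr⟩ := h1
    have hv := valid_update hx (hx j) i
    have hij : F.rel (N (Function.update x i (x j))) i j := by
      rw [hN.rel_iff _ hv]
      simp [hj]
    refine ⟨x j, hx j, F.eq_of_rel _ _ i j ?_ hj.symm hij ?_⟩
    · exact setoid_eq_of_agree hj.symm hij hr (hoff _ (hx j))
    · rw [hcol]
      exact hN.col_congr hv hx (hup _)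
  push Not at h1
  by_cases h2 : F.rel ν = ⊥
  · refine hN.exists_update_of_bot hx h2 (fun j k hj hk hjk => ?_) hcol
    have := (hrel j k hj hk).2 hjk
    rwa [h2] at this
  obtain ⟨j, k, hjk, hne⟩ : ∃ j k, F.rel ν j k ∧ j ≠ k := by
    by_contra hcon
    push Not at hcon
    refine h2 ?_
    ext j k
    exact ⟨hcon j k, fun h => h ▸ (F.rel ν).refl _⟩
  have hji : j ≠ i := by
    rintro rfl
    exact h1 k hne.symm hjk
  have hki : k ≠ i := by
    rintro rfl
    exact h1 j hne ((F.rel ν).symm hjk)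
  have key : ∀ p, F.Valid μ₀ p → (∀ l, l ≠ i → p ≠ x l) →
      F.col (N (Function.update x i p)) j = F.col ν j → N (Function.update x i p) = ν := by
    intro p hp hpx hc
    have hr : F.rel (N (Function.update x i p)) = F.rel ν := by
      refine setoid_eq_of_isolated (i := i) (fun l hl h => ?_) h1 (hoff p hp)
      rw [hN.rel_iff _ (valid_update hx hp i), hup p l hl, Function.update_self] at h
      exact hpx l hl h
    exact F.eq_of_rel _ _ j k hr hne (hr ▸ hjk) hc
  have hbase : ∀ b, F.Valid μ₀ (.base b) := fun _ => trivial
  by_cases hd : IsDist (F.rel ν) j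
  -- Replacing `x j` by an unused base point removes the repetition without touching facet `j`, so
  -- the discrete case applies to `x₁`.
  · obtain ⟨b, hb⟩ := exists_base_ne x j
    set x₁ := Function.update x j (.base b) with hx₁
    have hx₁x : ∀ l, l ≠ j → x₁ l = x l := fun l hl => by simp [hx₁, hl]
    have hx₁v : ∀ l, F.Valid μ₀ (x₁ l) := fun l => valid_update hx (hbase b) j l
    have hx₁j : x₁ j = .base b := by simp [hx₁]
    have hinj : ∀ l m, l ≠ i → m ≠ i → x₁ l = x₁ m → l = m := by
      intro l m hl hm h
      by_cases hlj : l = j <;> by_cases hmj : m = j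
      · rw [hlj, hmj]
      · rw [hlj, hx₁j, hx₁x m hmj] at h
        exact absurd h.symm (hb m hmj)
      · rw [hmj, hx₁j, hx₁x l hlj] at h
        exact absurd h (hb l hlj)
      · rw [hx₁x l hlj, hx₁x m hmj] at h
        by_contra hlm
        exact hd l m hlj hmj hlm ((hrel l m hl hm).2 h)
    have hdi : IsDist (F.rel (N x₁)) i := fun l m hl hm hlm h =>
      hlm (hinj l m hl hm ((hN.rel_iff x₁ hx₁v l m).1 h))
    have : Nontrivial (Fin n) := Fin.nontrivial_iff_two_le.2 (by omega)
    obtain ⟨c, hc⟩ := exists_ne (F.copy (F.col ν j))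
    -- The colours at `i` and `j` are dictated; all others are wild on a copy different from that of
    -- the colour at `j`, so that `j` and `k` supply the edges.
    obtain ⟨ν', hν', hcol'⟩ := F.exists_col_eq
      (fun l => if l = i then F.col (N x₁) i else if l = j then F.col ν j else F.wild c) j k
      (fun l => by
        split_ifs
        exacts [F.isCol_col _ _ hdi, F.isCol_col _ _ hd, F.isCol_wild _]) hne
      (Or.inl (by simpa [hji, hki, hne.symm, F.copy_wild] using hc.symm))
    obtain ⟨p, hp, hpν⟩ := hN.exists_update_of_bot hx₁v hν' hinj (by simp [hcol'])
    have hv₁ := valid_update hx₁v hp i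
    have hpx₁ : ∀ l, l ≠ i → p ≠ x₁ l := by
      intro l hl h
      have h' := (hN.rel_iff _ hv₁ i l).2 (by simpa [hl] using h)
      rw [hpν, hν'] at h'
      exact hl (show i = l from h').symm
    refine ⟨p, hp, key p hp (fun l hl h => ?_) ?_⟩
    · by_cases hlj : l = j
      · refine hpx₁ k hki ?_
        rw [h, hlj, hx₁x k hne.symm]
        exact (hrel j k hji hki).1 hjk
      · exact hpx₁ l hl (by rw [h, hx₁x l hlj])
    · rw [hN.col_congr (y := Function.update x₁ i p) (valid_update hx hp i) hv₁, hpν, hcol']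
      · simp [hji]
      · intro l hl
        by_cases hli : l = i
        · subst hli
          simp
        · simp [hli, hx₁x l hl]
  · obtain ⟨b, hb⟩ := exists_base_ne x i
    refine ⟨.base b, hbase b, key _ (hbase b) (fun l hl h => hb l hl h.symm) ?_⟩
    rw [F.col_of_not_isDist _ _ hd, F.col_of_not_isDist]
    intro hd'
    refine hd fun l m hl hm hlm h => ?_
    by_cases hli : l = i
    · subst hli
      exact h1 m hlm.symm h
    by_cases hmi : m = i
    · subst hmi
      exact h1 l hlm ((F.rel ν).symm h)
    exact hd' l m hl hm hlm ((hoff _ (hbase b) l m hli hmi).2 h)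

variable (F) in
-- A degenerate `μ` with `i ∼ j` is fixed by its type and its colour at `i`, so a discrete label
-- with that colour at `missing σ i` does, where `σ` picks class representatives. Thus `μ` appears
-- in a network whose base tuple is discrete.
theorem exists_act_eq (hn : 3 ≤ n) (μ : W) : ∃ μ' σ, F.rel μ' = ⊥ ∧ F.act μ' σ = μ := by
  classical
  by_cases h : F.rel μ = ⊥
  · exact ⟨μ, id, h, F.act_id μ⟩
  obtain ⟨i, j, hij, hne⟩ : ∃ i j, F.rel μ i j ∧ i ≠ j := by
    by_contra hcon
    push Not at hcon
    refine h ?_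
    ext j k
    exact ⟨hcon j k, fun h => h ▸ (F.rel μ).refl _⟩
  let σ : Fin n → Fin n := fun k => (Quotient.mk (F.rel μ) k).out
  have hσ : ∀ k l, σ k = σ l ↔ F.rel μ k l := fun k l =>
    Quotient.out_inj.trans Quotient.eq
  have : Nontrivial (Fin n) := Fin.nontrivial_iff_two_le.2 (by omega)
  obtain ⟨m, hm⟩ := exists_ne (missing σ i)
  set γ : C := if IsDist (F.rel μ) i then F.col μ i else F.wild i with hγ
  have hγc : F.IsCol γ := by
    rw [hγ]
    split_ifs with hd
    exacts [F.isCol_col _ _ hd, F.isCol_wild _]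
  obtain ⟨c, hc⟩ := exists_ne (F.copy γ)
  obtain ⟨μ', hμ', hcol⟩ := F.exists_col_eq (fun l => if l = missing σ i then γ else F.wild c)
    (missing σ i) m (fun l => by
      split_ifs
      exacts [hγc, F.isCol_wild _]) hm.symm (Or.inl (by simpa [hm, F.copy_wild] using hc.symm))
  have hr : F.rel (F.act μ' σ) = F.rel μ := by
    ext k l
    rw [F.rel_act, hμ', Setoid.comap_rel]
    exact hσ k l
  refine ⟨μ', σ, hμ', F.eq_of_rel _ _ i j hr hne (hr ▸ hij) ?_⟩
  by_cases hd : IsDist (F.rel μ) i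
  · rw [F.col_act _ _ _ (by rwa [← F.rel_act, hr]), hcol]
    simp [hγ, hd]
  · rw [F.col_of_not_isDist _ _ hd, F.col_of_not_isDist _ _ (hr ▸ hd)]

/-- Every `μ` labels a tuple of a coherently labelled complete network. -/
theorem exists_network (F : Frame n W C) (hn : 3 ≤ n) (μ : W) :
    ∃ (X : Type v) (N : (Fin n → X) → W), (∃ x, N x = μ) ∧
      (∀ x i j, F.rel (N x) i j ↔ x i = x j) ∧
      (∀ x τ, N (x ∘ τ) = F.act (N x) τ) ∧
      (∀ x y i, (∀ k, k ≠ i → x k = y k) → F.col (N x) i = F.col (N y) i) ∧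
      ∀ x i ν, (∀ j k, j ≠ i → k ≠ i → (F.rel ν j k ↔ x j = x k)) → F.col ν i = F.col (N x) i →
        ∃ p, N (Function.update x i p) = ν := by
  obtain ⟨μ₀, σ, hμ₀, rfl⟩ := F.exists_act_eq hn μ
  obtain ⟨N, hN⟩ := exists_isLabelling hn hμ₀
  have hv : ∀ x : Fin n → {p // F.Valid μ₀ p}, ∀ k, F.Valid μ₀ ((Subtype.val ∘ x) k) :=
    fun x k => (x k).2
  refine ⟨{p // F.Valid μ₀ p}, fun x => N (Subtype.val ∘ x), ⟨fun k => ⟨.base (σ k), trivial⟩, ?_⟩,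
    fun x i j => ?_, fun x τ => hN.comp _ τ (hv x), fun x y i h => ?_, fun x i ν hr hc => ?_⟩
  · have h0 : N .base = μ₀ := hN.of_spec _ _ _ (.base ⟨0, by omega⟩) trivial
    have := hN.comp .base σ fun _ => trivial
    rwa [h0] at this
  · rw [hN.rel_iff _ (hv x)]
    exact Subtype.val_injective.eq_iff
  · exact hN.col_congr (hv x) (hv y) fun k hk => congrArg Subtype.val (h k hk)
  · obtain ⟨p, hp, hpν⟩ := hN.exists_update hn (hv x)
      (fun j k hj hk => (hr j k hj hk).trans Subtype.val_injective.eq_iff.symm) hc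
    refine ⟨⟨p, hp⟩, ?_⟩
    rw [← hpν]
    exact congrArg N (Function.comp_update ..)

end Frame

end AlgGraph

namespace AlgGraph

universe w

namespace AGSStructure

variable {n : ℕ} {M : AGSStructure.{v} n}

/-! ### Ultrafilters of the algebra sort -/

/-- The order of the algebra sort, as a distributive lattice. -/
@[reducible] def distribLattice (hM : M.Models (theoryU.{u} n)) : DistribLattice M.A :=
  { @Lattice.mk' M.A ⟨M.add⟩ ⟨M.mul⟩ (add_comm hM) (add_assoc hM) (mul_comm hM) (mul_assoc hM)
      (add_mul_self hM) (mul_add_self hM) with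
    le_sup_inf := add_distrib hM }

theorem le_def (hM : M.Models (theoryU.{u} n)) {a b : M.A} :
    letI := distribLattice hM
    a ≤ b ↔ M.add a b = b := Iff.rfl

theorem le_of_mul_neg_eq_zero (hM : M.Models (theoryU.{u} n)) {a b : M.A}
    (h : M.mul a (M.neg b) = M.zero) :
    letI := distribLattice hM
    a ≤ b := by
  let := distribLattice hM
  have h1 : a ⊓ (b ⊔ M.neg b) = a := inf_eq_left.2 (by
    change M.add a (M.add b (M.neg b)) = M.add b (M.neg b)
    rw [add_neg hM, add_one hM])
  have h2 : a ⊓ M.neg b = M.zero := h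
  have h3 : M.zero ≤ b := zero_add hM b
  rw [← h1, inf_sup_left, h2]
  exact sup_le inf_le_right h3

/-- `s` is an ultrafilter of the algebra sort. -/
structure IsUltrafilter (M : AGSStructure.{v} n) (s : Set M.A) : Prop where
  neg_mem : ∀ a, M.neg a ∈ s ↔ a ∉ s
  add_mem : ∀ a b, M.add a b ∈ s ↔ a ∈ s ∨ b ∈ s

namespace IsUltrafilter

variable {s t : Set M.A}

theorem mul_mem (hs : M.IsUltrafilter s) (a b : M.A) : M.mul a b ∈ s ↔ a ∈ s ∧ b ∈ s := by
  rw [mul, hs.neg_mem, hs.add_mem, hs.neg_mem, hs.neg_mem]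
  tauto

theorem one_mem (hs : M.IsUltrafilter s) (hM : M.Models (theoryU.{u} n)) : M.one ∈ s := by
  rw [← add_neg hM M.one, hs.add_mem, hs.neg_mem]
  exact em _

theorem zero_notMem (hs : M.IsUltrafilter s) (hM : M.Models (theoryU.{u} n)) : M.zero ∉ s := by
  rw [← mul_neg hM M.one, hs.mul_mem, hs.neg_mem]
  exact fun h => h.2 h.1

theorem mem_of_le (hs : M.IsUltrafilter s) {a b : M.A} (h : M.add a b = b) (ha : a ∈ s) : b ∈ s := by
  rw [← h, hs.add_mem]
  exact Or.inl ha

theorem prod_mem (hs : M.IsUltrafilter s) (hM : M.Models (theoryU.{u} n)) {ι : Type} (l : List ι)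
    (f : ι → M.A) : M.prod l f ∈ s ↔ ∀ i ∈ l, f i ∈ s := by
  induction l with
  | nil => simpa [prod] using hs.one_mem hM
  | cons i l ih =>
    rw [List.forall_mem_cons, ← ih]
    exact hs.mul_mem _ _

theorem eq_of_subset (hs : M.IsUltrafilter s) (ht : M.IsUltrafilter t) (h : s ⊆ t) : s = t := by
  refine h.antisymm fun a ha => ?_
  by_contra has
  exact (ht.neg_mem a).1 (h ((hs.neg_mem a).2 has)) ha

end IsUltrafilter

/-- The prime ideal theorem, applied to the filter generated by the downward directed set `T`; the
ultrafilter is the complement of the prime ideal. -/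
theorem exists_isUltrafilter (hM : M.Models (theoryU.{u} n)) {T : Set M.A} (hne : T.Nonempty)
    (hT : ∀ a ∈ T, ∀ b ∈ T, ∃ c ∈ T, M.add c a = a ∧ M.add c b = b) (h0 : M.zero ∉ T) :
    ∃ s, M.IsUltrafilter s ∧ T ⊆ s := by
  let := distribLattice hM
  have hzero : ∀ a : M.A, M.zero ≤ a := zero_add hM
  have hF : Order.IsPFilter {a : M.A | ∃ t ∈ T, t ≤ a} := by
    refine .of_def ?_ ?_ ?_
    · obtain ⟨t, ht⟩ := hne
      exact ⟨t, t, ht, le_rfl⟩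
    · rintro a ⟨t, ht, hta⟩ b ⟨t', ht', htb⟩
      obtain ⟨c, hc, hct, hct'⟩ := hT t ht t' ht'
      exact ⟨c, ⟨c, hc, le_rfl⟩, le_trans (le_def hM |>.2 hct) hta,
        le_trans (le_def hM |>.2 hct') htb⟩
    · rintro a b hab ⟨t, ht, hta⟩
      exact ⟨t, ht, hta.trans hab⟩
  have hdisj : Disjoint (hF.toPFilter : Set M.A) (Order.Ideal.principal M.zero : Set M.A) := by
    rw [Set.disjoint_left]
    rintro a ⟨t, ht, hta⟩ (ha : a ≤ M.zero)
    exact h0 (le_antisymm (hta.trans ha) (hzero t) ▸ ht)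
  obtain ⟨J, hJ, -, hFJ⟩ := DistribLattice.prime_ideal_of_disjoint_filter_ideal hdisj
  rw [Set.disjoint_left] at hFJ
  have hadd : ∀ a b, M.add a b ∈ J ↔ a ∈ J ∧ b ∈ J := fun a b => Order.Ideal.sup_mem_iff
  refine ⟨{a | a ∉ J}, ⟨fun a => ?_, fun a b => ?_⟩, fun a ha => hFJ ⟨a, ha, le_rfl⟩⟩
  · change M.neg a ∉ J ↔ ¬ a ∉ J
    rw [not_not]
    constructor
    · intro h
      have : a ⊓ M.neg a ∈ J := by
        change M.mul a (M.neg a) ∈ J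
        rw [mul_neg hM]
        obtain ⟨b, hb⟩ := J.nonempty
        exact J.lower (hzero b) hb
      exact (hJ.mem_or_mem this).resolve_right h
    · intro h h'
      have h1 : M.one ∈ J := add_neg hM a ▸ (hadd _ _).2 ⟨h, h'⟩
      obtain ⟨t, ht⟩ := hne
      exact hFJ ⟨t, ht, add_one hM t⟩ h1
  · change M.add a b ∉ J ↔ a ∉ J ∨ b ∉ J
    rw [hadd, not_and_or]

theorem exists_isUltrafilter_mem (hM : M.Models (theoryU.{u} n)) {a : M.A} (ha : a ≠ M.zero) :
    ∃ s, M.IsUltrafilter s ∧ a ∈ s := by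
  let := distribLattice hM
  obtain ⟨s, hs, has⟩ := exists_isUltrafilter hM (T := {a}) ⟨a, rfl⟩
    (by
      rintro _ rfl _ rfl
      exact ⟨_, rfl, sup_idem _, sup_idem _⟩) (fun h => ha h.symm)
  exact ⟨s, hs, has rfl⟩

theorem prod_le_prod (hM : M.Models (theoryU.{u} n)) {ι : Type} (l : List ι) {f g : ι → M.A}
    (h : ∀ i, M.add (f i) (g i) = g i) : M.add (M.prod l f) (M.prod l g) = M.prod l g := by
  let := distribLattice hM
  rw [← le_def hM]
  induction l with
  | nil => exact le_rfl
  | cons i l ih => exact inf_le_inf ((le_def hM).2 (h i)) ih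

/-! ### Colours -/

/-- `γ` is an ultrafilter of the boolean sort. -/
structure IsColour (M : AGSStructure.{v} n) (γ : Set M.B) : Prop where
  neg_mem : ∀ B, M.bneg B ∈ γ ↔ B ∉ γ
  add_mem : ∀ B C, M.badd B C ∈ γ ↔ B ∈ γ ∨ C ∈ γ

namespace IsColour

variable {γ δ : Set M.B}

theorem eq_of_subset (hγ : M.IsColour γ) (hδ : M.IsColour δ) (h : γ ⊆ δ) : γ = δ := by
  refine h.antisymm fun B hB => ?_
  by_contra hBγ
  exact (hδ.neg_mem B).1 (h ((hγ.neg_mem B).2 hBγ)) hB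

theorem mem_of_forall_mem (hγ : M.IsColour γ) (hB : M.IsSetLike) {B : M.B}
    (h : ∀ p, M.mem p B) : B ∈ γ := by
  have : B = M.badd B (M.bneg B) := hB.ext _ _ fun p => by simp [hB.mem_badd, h p]
  rw [this, hγ.add_mem, hγ.neg_mem]
  exact em _

theorem mem_of_subset (hγ : M.IsColour γ) (hB : M.IsSetLike) {B C : M.B}
    (h : ∀ p, M.mem p B → M.mem p C) (hBγ : B ∈ γ) : C ∈ γ := by
  have := hγ.mem_of_forall_mem hB (B := M.badd (M.bneg B) C) fun p => by
    rw [hB.mem_badd, hB.mem_bneg]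
    exact not_or_of_imp (h p)
  rw [hγ.add_mem, hγ.neg_mem] at this
  exact this.resolve_left (not_not.2 hBγ)

theorem exists_inter (hγ : M.IsColour γ) (hB : M.IsSetLike) {B C : M.B} (hBγ : B ∈ γ)
    (hCγ : C ∈ γ) : ∃ D ∈ γ, ∀ p, M.mem p D ↔ M.mem p B ∧ M.mem p C := by
  refine ⟨M.bneg (M.badd (M.bneg B) (M.bneg C)), ?_, fun p => ?_⟩
  · rw [hγ.neg_mem, hγ.add_mem, hγ.neg_mem, hγ.neg_mem]
    tauto
  · rw [hB.mem_bneg, hB.mem_badd, hB.mem_bneg, hB.mem_bneg]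
    tauto

theorem exists_mem_inter (hγ : M.IsColour γ) (hB : M.IsSetLike) {B C : M.B} (hBγ : B ∈ γ)
    (hCγ : C ∈ γ) : ∃ p, M.mem p B ∧ M.mem p C := by
  by_contra hcon
  push Not at hcon
  exact (hγ.neg_mem C).1 (hγ.mem_of_subset hB (fun p hp => (hB.mem_bneg p C).2 (hcon p hp)) hBγ) hCγ

theorem exists_mem_of_cover (hγ : M.IsColour γ) (hB : M.IsSetLike) {k : ℕ} {C : Fin k → M.B}
    (h : ∀ p, ∃ i, M.mem p (C i)) : ∃ i, C i ∈ γ := by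
  have hl : ∀ l : List (Fin k), l.foldr (fun i t => M.badd (C i) t) M.bzero ∈ γ →
      ∃ i, C i ∈ γ := by
    intro l
    induction l with
    | nil =>
      intro h0
      obtain ⟨p, hp, -⟩ := hγ.exists_mem_inter hB h0 h0
      exact absurd hp (hB.not_mem_bzero p)
    | cons i l ih =>
      intro hil
      rw [List.foldr_cons, hγ.add_mem] at hil
      exact hil.elim (fun h => ⟨i, h⟩) ih
  exact hl (List.finRange k) (hγ.mem_of_forall_mem hB fun p =>
    (hB.mem_foldr _ _ p).2 (by simpa using h p))

end IsColour

theorem S_mono (hM : M.Models (theoryU.{u} n)) {B C : M.B} (h : ∀ p, M.mem p B → M.mem p C)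
    (i : Fin n) : M.add (M.S i B) (M.S i C) = M.S i C := by
  have hB := isSetLike hM
  rw [← S_badd hM]
  congr 1
  exact hB.ext _ _ fun p => by
    rw [hB.mem_badd]
    exact ⟨fun hp => hp.elim (h p) id, Or.inr⟩

/-- A class of `H` carries a colour all elements of which contain edges. -/
theorem exists_isColour_of_isSameClass (hM : M.Models (theoryU.{u} n))
    (hΘ : M.Models (theoryTheta n)) {C : M.B} (hC : M.IsSameClass C) :
    ∃ γ, M.IsColour γ ∧ C ∈ γ ∧ ∀ B ∈ γ, ∃ p q, M.mem p B ∧ M.mem q B ∧ M.edge p q := by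
  classical
  have hB := isSetLike hM
  let indep (D : M.B) : Prop := ∀ p q, M.mem p D → M.mem q D → ¬ M.edge p q
  -- An ultrafilter on the nodes that contains the class and avoids all independent elements. An
  -- empty finite intersection would cover the class by finitely many independent elements.
  obtain ⟨𝒰, h𝒰⟩ := Ultrafilter.exists_ultrafilter_of_finite_inter_nonempty
    ({{p | M.mem p C}} ∪ {s | ∃ D, indep D ∧ s = {p | ¬ M.mem p D}}) (by
      intro T hT
      by_contra hcon
      rw [Set.not_nonempty_iff_eq_empty, Set.eq_empty_iff_forall_notMem] at hcon
      -- The default `0` is independent, so it does no harm in the cover.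
      let D (t : Set M.G) : M.B :=
        if h : ∃ D, indep D ∧ t = {p | ¬ M.mem p D} then h.choose else M.bzero
      have hD : ∀ t, indep (D t) := by
        intro t
        by_cases h : ∃ D, indep D ∧ t = {p | ¬ M.mem p D}
        · simpa only [D, dif_pos h] using h.choose_spec.1
        · simp only [D, dif_neg h]
          exact fun p q hp => absurd hp (hB.not_mem_bzero p)
      obtain ⟨p, q, he, -, -, i, hp, hq⟩ := exists_edge_of_isSameClass hM hΘ hC
        (fun i : Fin T.card => D (T.equivFin.symm i)) (by
          intro p hp
          have := hcon p
          rw [Set.mem_sInter] at this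
          push Not at this
          obtain ⟨t, ht, hpt⟩ := this
          refine ⟨T.equivFin ⟨t, ht⟩, ?_⟩
          rw [Equiv.symm_apply_apply]
          rcases hT ht with rfl | (h : ∃ D, indep D ∧ t = {p | ¬ M.mem p D})
          · exact absurd hp hpt
          · have h2 := h.choose_spec.2
            rw [h2] at hpt
            simpa only [D, dif_pos h] using not_not.1 hpt)
      exact hD _ p q hp hq he)
  refine ⟨{B | {p | M.mem p B} ∈ 𝒰}, ⟨fun B => ?_, fun B C => ?_⟩, h𝒰 (Or.inl rfl),
    fun B hBU => ?_⟩
  · have : {p | M.mem p (M.bneg B)} = {p | M.mem p B}ᶜ := by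
      ext p
      exact hB.mem_bneg p B
    change {p | M.mem p (M.bneg B)} ∈ 𝒰 ↔ {p | M.mem p B} ∉ 𝒰
    rw [this, Ultrafilter.compl_mem_iff_notMem]
  · have : {p | M.mem p (M.badd B C)} = {p | M.mem p B} ∪ {p | M.mem p C} := by
      ext p
      exact hB.mem_badd p B C
    change {p | M.mem p (M.badd B C)} ∈ 𝒰 ↔ {p | M.mem p B} ∈ 𝒰 ∨ {p | M.mem p C} ∈ 𝒰
    rw [this, Ultrafilter.union_mem_iff]
  · by_contra hcon
    push Not at hcon
    have h1 : {p | M.mem p B}ᶜ ∈ 𝒰 := h𝒰 (Or.inr ⟨B, hcon, rfl⟩)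
    exact Ultrafilter.compl_mem_iff_notMem.1 h1 hBU

/-! ### The colours of an ultrafilter -/

namespace IsUltrafilter

variable {s t : Set M.A}

/-- The equality type of an ultrafilter. -/
def rel (hM : M.Models (theoryU.{u} n)) (hs : M.IsUltrafilter s) : Setoid (Fin n) where
  r i j := M.diag i j ∈ s
  iseqv :=
    { refl := fun i => (diag_self hM i).symm ▸ hs.one_mem hM
      symm := fun {i j} h => diag_symm hM i j ▸ h
      trans := fun {i j k} h h' => hs.mem_of_le (diag_trans hM i j k) ((hs.mul_mem _ _).2 ⟨h, h'⟩) }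

theorem S_one_mem_iff (hM : M.Models (theoryU.{u} n)) (hs : M.IsUltrafilter s) (i : Fin n) :
    M.S i M.bone ∈ s ↔ IsDist (hs.rel hM) i := by
  constructor
  · intro h j k hj hk hjk hr
    refine hs.zero_notMem hM ?_
    rw [← S_mul_diag hM hj hk hjk M.bone, hs.mul_mem]
    exact ⟨h, hr⟩
  · intro h
    refine hs.mem_of_le (prod_neg_diag_le hM i) ((hs.prod_mem hM _ _).2 ?_)
    intro jk hjk
    rw [mem_pairsOff] at hjk
    exact (hs.neg_mem _).2 (h _ _ hjk.1 hjk.2.1 hjk.2.2)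

theorem S_one_mem_of_S_mem (hM : M.Models (theoryU.{u} n)) (hs : M.IsUltrafilter s) {i : Fin n}
    {B : M.B} (h : M.S i B ∈ s) : M.S i M.bone ∈ s :=
  hs.mem_of_le (S_mono hM (fun p _ => (isSetLike hM).mem_bone p) i) h

theorem isColour (hM : M.Models (theoryU.{u} n)) (hs : M.IsUltrafilter s) {i : Fin n}
    (hi : M.S i M.bone ∈ s) : M.IsColour {B | M.S i B ∈ s} where
  neg_mem B := by
    change M.S i (M.bneg B) ∈ s ↔ M.S i B ∉ s
    rw [S_bneg hM, hs.mul_mem, hs.neg_mem]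
    exact and_iff_right hi
  add_mem B C := by
    change M.S i (M.badd B C) ∈ s ↔ _
    rw [S_badd hM, hs.add_mem]
    rfl

theorem subst (hM : M.Models (theoryU.{u} n)) (hs : M.IsUltrafilter s) (σ : Fin n → Fin n) :
    M.IsUltrafilter {a | M.subst σ a ∈ s} where
  neg_mem a := by
    change M.subst σ (M.neg a) ∈ s ↔ _
    rw [subst_neg hM, hs.neg_mem]
    rfl
  add_mem a b := by
    change M.subst σ (M.add a b) ∈ s ↔ _
    rw [subst_add hM, hs.add_mem]
    rfl

theorem typeOff_mem_iff (hM : M.Models (theoryU.{u} n)) (hs : M.IsUltrafilter s)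
    (r : Setoid (Fin n)) [DecidableRel r] (i : Fin n) :
    M.typeOff r i ∈ s ↔ ∀ j k, j ≠ i → k ≠ i → (hs.rel hM j k ↔ r j k) := by
  rw [typeOff, hs.prod_mem hM]
  constructor
  · intro h j k hj hk
    by_cases hjk : j = k
    · subst hjk
      exact iff_of_true (Setoid.refl' _ _) (Setoid.refl' _ _)
    · have := h (j, k) (mem_pairsOff.2 ⟨hj, hk, hjk⟩)
      split_ifs at this with hr
      · exact iff_of_true this hr
      · exact iff_of_false ((hs.neg_mem _).1 this) hr
  · rintro h ⟨j, k⟩ hjk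
    obtain ⟨hj, hk, -⟩ := mem_pairsOff.1 hjk
    simp only
    split_ifs with hr
    · exact (h j k hj hk).2 hr
    · exact (hs.neg_mem _).2 (mt (h j k hj hk).1 hr)

/-- If `Fᵢ` belongs to `s`, the element `R i a` of the common colour carries `cᵢ a` over, by `S_R`;
otherwise the type off `i` alone does, by `typeOff_le_cyl`. -/
theorem cyl_mem (hM : M.Models (theoryU.{u} n)) (hs : M.IsUltrafilter s) (ht : M.IsUltrafilter t)
    {i : Fin n} (hcol : {B | M.S i B ∈ s} = {B | M.S i B ∈ t})
    (hrel : ∀ j k, j ≠ i → k ≠ i → (hs.rel hM j k ↔ ht.rel hM j k)) {a : M.A} (ha : a ∈ s) :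
    M.cyl i a ∈ t := by
  classical
  by_cases hi : M.S i M.bone ∈ s
  · have h : M.R i a ∈ {B | M.S i B ∈ s} := by
      change M.S i (M.R i a) ∈ s
      rw [S_R hM, hs.mul_mem]
      exact ⟨hi, hs.mem_of_le (le_cyl hM i a) ha⟩
    rw [hcol] at h
    change M.S i (M.R i a) ∈ t at h
    rw [S_R hM, ht.mul_mem] at h
    exact h.2
  · rw [hs.S_one_mem_iff hM] at hi
    rcases typeOff_le_cyl hM (hs.rel hM) i hi a with h | h
    · refine absurd ?_ (hs.zero_notMem hM)
      rw [← h, hs.mul_mem, hs.typeOff_mem_iff hM]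
      exact ⟨ha, fun _ _ _ _ => Iff.rfl⟩
    · refine ht.mem_of_le h ((typeOff_mem_iff hM ht _ i).2 fun j k hj hk => ?_)
      exact (hrel j k hj hk).symm

theorem exists_of_cyl_mem (hM : M.Models (theoryU.{u} n)) (hs : M.IsUltrafilter s) {i : Fin n}
    {a : M.A} (ha : M.cyl i a ∈ s) : ∃ (t : Set M.A) (ht : M.IsUltrafilter t), a ∈ t ∧
      {B | M.S i B ∈ t} = {B | M.S i B ∈ s} ∧
      ∀ j k, j ≠ i → k ≠ i → (ht.rel hM j k ↔ hs.rel hM j k) := by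
  classical
  let := distribLattice hM
  have hB := isSetLike hM
  by_cases hi : M.S i M.bone ∈ s
  · have hγ := hs.isColour hM hi
    -- Since `S i B` is `i`-closed, `a · S i B = 0` would give `cᵢ a · S i B = 0`, although both
    -- factors lie in `s`.
    obtain ⟨t, ht, hT⟩ := exists_isUltrafilter hM (T := {b | ∃ B, M.S i B ∈ s ∧ b = M.mul a (M.S i B)})
      ⟨_, _, hi, rfl⟩ (by
        rintro _ ⟨B, hBs, rfl⟩ _ ⟨C, hCs, rfl⟩
        obtain ⟨D, hD, hDBC⟩ := hγ.exists_inter hB hBs hCs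
        refine ⟨_, ⟨D, hD, rfl⟩, ?_, ?_⟩
        · exact inf_le_inf (le_refl a) (S_mono hM (fun p hp => ((hDBC p).1 hp).1) i)
        · exact inf_le_inf (le_refl a) (S_mono hM (fun p hp => ((hDBC p).1 hp).2) i)) (by
        rintro ⟨B, hBs, h0⟩
        refine hs.zero_notMem hM ?_
        rw [← cyl_zero hM i, h0, ← cyl_S hM i B, cyl_mul_cyl hM, hs.mul_mem, cyl_S hM]
        exact ⟨ha, hBs⟩)
    have hat : a ∈ t := ((ht.mul_mem _ _).1 (hT ⟨_, hi, rfl⟩)).1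
    have hSt : ∀ B, M.S i B ∈ s → M.S i B ∈ t := fun B hBs =>
      ((ht.mul_mem _ _).1 (hT ⟨B, hBs, rfl⟩)).2
    have hit := hSt _ hi
    refine ⟨t, ht, hat, (hγ.eq_of_subset (ht.isColour hM hit) hSt).symm, fun j k hj hk => ?_⟩
    by_cases hjk : j = k
    · subst hjk
      exact iff_of_true (Setoid.refl' _ _) (Setoid.refl' _ _)
    · exact iff_of_false ((ht.S_one_mem_iff hM i).1 hit j k hj hk hjk)
        ((hs.S_one_mem_iff hM i).1 hi j k hj hk hjk)
  · obtain ⟨t, ht, hat⟩ := exists_isUltrafilter_mem hM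
      (a := M.mul a (M.typeOff (hs.rel hM) i)) (by
        intro h0
        refine hs.zero_notMem hM ?_
        rw [← cyl_zero hM i, ← h0, ← cyl_typeOff hM, cyl_mul_cyl hM, hs.mul_mem, cyl_typeOff hM,
          hs.typeOff_mem_iff hM]
        exact ⟨ha, fun _ _ _ _ => Iff.rfl⟩)
    rw [ht.mul_mem, ht.typeOff_mem_iff hM] at hat
    refine ⟨t, ht, hat.1, ?_, hat.2⟩
    have hit : M.S i M.bone ∉ t := by
      rw [hs.S_one_mem_iff hM] at hi
      rw [ht.S_one_mem_iff hM]
      exact fun h => hi fun j k hj hk hjk hr => h j k hj hk hjk ((hat.2 j k hj hk).2 hr)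
    ext B
    exact iff_of_false (fun h => hit (ht.S_one_mem_of_S_mem hM h))
      (fun h => hi (hs.S_one_mem_of_S_mem hM h))

/-- For `a ∈ s`, the element `d_ij · cᵢ(d_ij · a)` belongs to `t` and is below `a`. -/
theorem eq_of_rel (hM : M.Models (theoryU.{u} n)) (hs : M.IsUltrafilter s) (ht : M.IsUltrafilter t)
    {i j : Fin n} (hrel : hs.rel hM = ht.rel hM) (hij : i ≠ j) (hr : hs.rel hM i j)
    (hcol : {B | M.S i B ∈ s} = {B | M.S i B ∈ t}) : s = t := by
  refine hs.eq_of_subset ht fun a ha => ht.mem_of_le (diag_mul_cyl_le hM hij a) ?_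
  rw [ht.mul_mem]
  refine ⟨?_, hs.cyl_mem hM ht hcol (fun _ _ _ _ => by rw [hrel]) ((hs.mul_mem _ _).2 ⟨hr, ha⟩)⟩
  have : ht.rel hM i j := hrel ▸ hr
  exact this

end IsUltrafilter

/-- Colours of which two can always be joined by an edge are the colours of an ultrafilter. -/
theorem exists_isUltrafilter_of_colours (hM : M.Models (theoryU.{u} n)) (hn : 3 ≤ n)
    {γ : Fin n → Set M.B} (hγ : ∀ k, M.IsColour (γ k)) {i j : Fin n} (hij : i ≠ j)
    (he : ∀ B ∈ γ i, ∀ C ∈ γ j, ∃ p q, M.mem p B ∧ M.mem q C ∧ M.edge p q) :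
    ∃ (s : Set M.A) (hs : M.IsUltrafilter s), hs.rel hM = ⊥ ∧ ∀ k, {B | M.S k B ∈ s} = γ k := by
  have hB := isSetLike hM
  have hone : ∀ k, M.bone ∈ γ k := fun k => (hγ k).mem_of_forall_mem hB hB.mem_bone
  obtain ⟨s, hs, hT⟩ := exists_isUltrafilter hM
    (T := {a | ∃ B : Fin n → M.B, (∀ k, B k ∈ γ k) ∧
      a = M.prod (List.finRange n) fun k => M.S k (B k)}) ⟨_, _, hone, rfl⟩ (by
      rintro _ ⟨B, hBγ, rfl⟩ _ ⟨C, hCγ, rfl⟩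
      choose D hD hDBC using fun k => (hγ k).exists_inter hB (hBγ k) (hCγ k)
      exact ⟨_, ⟨D, hD, rfl⟩,
        prod_le_prod hM _ fun k => S_mono hM (fun p hp => ((hDBC k p).1 hp).1) k,
        prod_le_prod hM _ fun k => S_mono hM (fun p hp => ((hDBC k p).1 hp).2) k⟩) (by
      rintro ⟨B, hBγ, h0⟩
      choose p hp _ using fun k => (hγ k).exists_mem_inter hB (hBγ k) (hBγ k)
      obtain ⟨q, r, hq, hr, hqr⟩ := he _ (hBγ i) _ (hBγ j)
      -- Arbitrary nodes of the `B k`, except that the places `i` and `j` receive the ends of an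
      -- edge.
      refine prod_S_ne_zero hM B (Function.update (Function.update p j r) i q) (i := i) (j := j)
        (fun k => ?_) (by simpa [hij.symm] using hqr) h0.symm
      by_cases hki : k = i
      · subst hki
        simpa using hq
      · by_cases hkj : k = j
        · subst hkj
          simpa [hki] using hr
        · simpa [hki, hkj] using hp k)
  have hsub : ∀ k, γ k ⊆ {B | M.S k B ∈ s} := by
    intro k B hBk
    have := hT ⟨Function.update (fun _ => M.bone) k B, fun l => ?_, rfl⟩
    · rw [hs.prod_mem hM] at this
      simpa using this k (List.mem_finRange k)
    · by_cases hl : l = k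
      · subst hl
        simpa using hBk
      · simpa [hl] using hone l
  have hS : ∀ k, M.S k M.bone ∈ s := fun k => hsub k (hone k)
  refine ⟨s, hs, ?_, fun k => ((hγ k).eq_of_subset (hs.isColour hM (hS k)) (hsub k)).symm⟩
  ext k l
  refine ⟨fun h => ?_, fun h => h ▸ (hs.rel hM).refl _⟩
  by_contra hkl
  obtain ⟨m, hmk, hml⟩ := exists_ne_ne hn k l
  exact (hs.S_one_mem_iff hM m).1 (hS m) k l hmk.symm hml.symm hkl h

end AGSStructure

end AlgGraph

namespace AlgGraph

universe w

/-! ## Representability -/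

namespace AGSStructure

variable {n : ℕ} {M : AGSStructure.{v} n}

theorem exists_frame (hM : M.Models (theoryU.{u} n)) (hn : 3 ≤ n)
    (hΘ : M.Models (theoryTheta n)) :
    ∃ F : Frame n {s : Set M.A // M.IsUltrafilter s} (Set M.B),
      (∀ s i j, F.rel s i j ↔ s.2.rel hM i j) ∧ (∀ s i, F.col s i = {B | M.S i B ∈ s.1}) ∧
      ∀ s σ, (F.act s σ).1 = {a | M.subst σ a ∈ s.1} := by
  classical
  have hB := isSetLike hM
  -- `θ₁` yields an edge, hence a node, so the partition into classes is available.
  obtain ⟨p₀, -, -, -⟩ := (hB.satisfies_theta 1).1 (hΘ _ ⟨1, rfl⟩) (fun _ => M.bone)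
    fun p => ⟨0, hB.mem_bone p⟩
  obtain ⟨C, hC, hcover, hedge⟩ := exists_copies hM p₀
  choose wild hwild hCwild hwildE using fun l => exists_isColour_of_isSameClass hM hΘ (hC l)
  let copy (γ : Set M.B) : Fin n := if h : ∃ l, C l ∈ γ then h.choose else ⟨0, by omega⟩
  have hcopy : ∀ γ, M.IsColour γ → C (copy γ) ∈ γ := by
    intro γ hγ
    have h := hγ.exists_mem_of_cover hB hcover
    simp only [copy, dif_pos h]
    exact h.choose_spec
  have hedge' : ∀ γ, M.IsColour γ → ∀ l, C l ∈ γ → l = copy γ := by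
    intro γ hγ l hl
    by_contra hne
    obtain ⟨p, hp, hp'⟩ := hγ.exists_mem_inter hB hl (hcopy γ hγ)
    exact (hedge p p _ _ hp hp' hne).2 rfl
  refine ⟨{
    rel := fun s => s.2.rel hM
    col := fun s i => {B | M.S i B ∈ s.1}
    act := fun s σ => ⟨_, s.2.subst hM σ⟩
    e := ∅
    IsCol := M.IsColour
    copy := copy
    wild := wild
    act_id := fun s => Subtype.ext ?_
    act_act := fun s σ τ => Subtype.ext ?_
    rel_act := fun s σ => ?_
    col_act := fun s σ i hi => ?_
    col_of_not_isDist := fun s i hi => ?_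
    isCol_col := fun s i hi => s.2.isColour hM ((s.2.S_one_mem_iff hM i).2 hi)
    eq_of_rel := fun s t i j hrel hij hr hcol =>
      Subtype.ext (s.2.eq_of_rel hM t.2 hrel hij hr hcol)
    isCol_wild := hwild
    copy_wild := fun l => (hedge' _ (hwild l) l (hCwild l)).symm
    exists_col_eq := fun γ i j hγ hij h => ?_ }, fun _ _ _ => Iff.rfl, fun _ _ => rfl, fun _ _ => rfl⟩
  · ext a
    change M.subst id a ∈ s.1 ↔ _
    rw [subst_id hM]
  · ext a
    change M.subst σ (M.subst τ a) ∈ s.1 ↔ M.subst (σ ∘ τ) a ∈ s.1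
    rw [subst_subst hM]
  · ext i j
    change M.subst σ (M.diag i j) ∈ s.1 ↔ M.diag (σ i) (σ j) ∈ s.1
    rw [subst_diag hM]
  · have hd : IsDist ((s.2.subst hM σ).rel hM) i := by
      convert hi using 1
      ext i j
      change M.subst σ (M.diag i j) ∈ s.1 ↔ M.diag (σ i) (σ j) ∈ s.1
      rw [subst_diag hM]
    have h1 : M.subst σ (M.S i M.bone) ∈ s.1 := ((s.2.subst hM σ).S_one_mem_iff hM i).2 hd
    ext B
    change M.subst σ (M.S i B) ∈ s.1 ↔ M.S (missing σ i) B ∈ s.1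
    rw [subst_S hM, s.2.mul_mem]
    exact and_iff_right h1
  · refine Set.eq_empty_iff_forall_notMem.2 fun B hBs => hi ?_
    exact (s.2.S_one_mem_iff hM i).1 (s.2.S_one_mem_of_S_mem hM hBs)
  · obtain ⟨s, hs, hr, hcol⟩ := exists_isUltrafilter_of_colours hM hn hγ hij (by
      intro B hBi D hDj
      -- On different copies, intersect both elements with their classes; for a common wild colour,
      -- take an edge inside the intersection of the two elements.
      rcases h with h | ⟨l, hi, hj⟩
      · obtain ⟨p, hp, hpC⟩ := (hγ i).exists_mem_inter hB hBi (hcopy _ (hγ i))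
        obtain ⟨q, hq, hqC⟩ := (hγ j).exists_mem_inter hB hDj (hcopy _ (hγ j))
        exact ⟨p, q, hp, hq, (hedge p q _ _ hpC hqC h).1⟩
      · rw [hi] at hBi
        rw [hj] at hDj
        obtain ⟨D', hD', hmem⟩ := (hwild l).exists_inter hB hBi hDj
        obtain ⟨p, q, hp, hq, hpq⟩ := hwildE l D' hD'
        exact ⟨p, q, ((hmem p).1 hp).1, ((hmem q).1 hq).2, hpq⟩)
    exact ⟨⟨s, hs⟩, hr, funext hcol⟩

/-- A map to the subsets of `ⁿX` that preserves the operations. -/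
structure IsSetRep (M : AGSStructure.{v} n) {X : Type v} (h : M.A → Set (Fin n → X)) : Prop where
  map_zero : h M.zero = ∅
  map_one : h M.one = Set.univ
  map_add : ∀ a b, h (M.add a b) = h a ∪ h b
  map_neg : ∀ a, h (M.neg a) = (h a)ᶜ
  map_cyl : ∀ i a, h (M.cyl i a) = cylSet i (h a)
  map_diag : ∀ i j, h (M.diag i j) = {x | x i = x j}
  map_subst : ∀ σ a, h (M.subst σ a) = {x | x ∘ σ ∈ h a}

/-- An element is represented by the tuples whose label contains it. The network starts from an
ultrafilter containing `a`, and its extension property realises the ultrafilters supplied by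
`exists_of_cyl_mem`. -/
theorem exists_isSetRep (hM : M.Models (theoryU.{u} n)) (hn : 3 ≤ n)
    (hΘ : M.Models (theoryTheta n)) {a : M.A} (ha : a ≠ M.zero) :
    ∃ (X : Type v) (h : M.A → Set (Fin n → X)), M.IsSetRep h ∧ (h a).Nonempty := by
  obtain ⟨F, hrel, hcol, hact⟩ := exists_frame hM hn hΘ
  obtain ⟨s, hs, has⟩ := exists_isUltrafilter_mem hM ha
  obtain ⟨X, N, ⟨x, hx⟩, h1, h2, h3, h4⟩ := F.exists_network hn ⟨s, hs⟩
  simp only [hrel, hcol] at h1 h3 h4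
  refine ⟨X, fun b => {x | b ∈ (N x).1}, ⟨?_, ?_, fun b c => ?_, fun b => ?_, fun i b => ?_,
    fun i j => ?_, fun σ b => ?_⟩, x, ?_⟩
  · exact Set.eq_empty_iff_forall_notMem.2 fun x => (N x).2.zero_notMem hM
  · exact Set.eq_univ_of_forall fun x => (N x).2.one_mem hM
  · ext x
    exact (N x).2.add_mem b c
  · ext x
    exact (N x).2.neg_mem b
  · ext x
    constructor
    · intro hb
      obtain ⟨t, ht, hbt, hc, hr⟩ := (N x).2.exists_of_cyl_mem hM hb
      obtain ⟨p, hp⟩ := h4 x i ⟨t, ht⟩ (fun j k hj hk => (hr j k hj hk).trans (h1 x j k)) hc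
      refine ⟨Function.update x i p, ?_, fun j hj => by simp [hj]⟩
      change b ∈ (N _).1
      rwa [hp]
    · rintro ⟨y, hy, hyx⟩
      exact (N y).2.cyl_mem hM (N x).2 (h3 y x i hyx)
        (fun j k hj hk => by rw [h1, h1, hyx j hj, hyx k hk]) hy
  · ext x
    exact h1 x i j
  · ext x
    change M.subst σ b ∈ (N x).1 ↔ b ∈ (N (x ∘ σ)).1
    rw [h2, hact]
    rfl
  · change a ∈ (N x).1
    rwa [hx]

/-- If the graph has infinite chromatic number in the sense of the boolean sort, then the algebra
is representable. -/
theorem isRPEA (hM : M.Models (theoryU.{u} n)) (hn : 3 ≤ n) (hΘ : M.Models (theoryTheta n)) :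
    IsRPEA n M.A := by
  choose X h hh hne using fun a : {a : M.A // a ≠ M.zero} => exists_isSetRep hM hn hΘ a.2
  have hX : ∀ a, Nonempty (X a) := fun a => (hne a).elim fun x _ => ⟨x ⟨0, by omega⟩⟩
  let := prodStructure (LPea n) fun a => Set (Fin n → X a)
  -- There is one factor for each nonzero element; a nonzero `b · -c` would be nonempty in its own
  -- factor.
  have hle : ∀ b c : M.A, (∀ a, h a b = h a c) → M.mul b (M.neg c) = M.zero := by
    intro b c hbc
    have h0 : ∀ a, h a (M.mul b (M.neg c)) = ∅ := fun a => by
      rw [mul, (hh a).map_neg, (hh a).map_add, (hh a).map_neg, (hh a).map_neg, (hh a).map_neg, hbc]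
      simp
    by_contra hne0
    exact (hne ⟨_, hne0⟩).ne_empty (h0 _)
  refine ⟨_, X, hX, ⟨⟨⟨fun b a => h a b, fun b c hbc => ?_⟩, ?_, ?_⟩⟩⟩
  · let := distribLattice hM
    exact le_antisymm (le_of_mul_neg_eq_zero hM (hle b c (congrFun hbc)))
      (le_of_mul_neg_eq_zero hM (hle c b (congrFun hbc.symm)))
  · intro k f x
    funext a
    have hh' := hh a
    change h a (FirstOrder.Language.Structure.funMap f x) = peaSetOp f fun l => h a (x l)
    have h0 : ∀ x : Fin 0 → M.A, x = ![] := fun x => Subsingleton.elim _ _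
    have h1 : ∀ x : Fin 1 → M.A, x = ![x 0] := fun x => by
      funext l
      fin_cases l
      rfl
    have h2 : ∀ x : Fin 2 → M.A, x = ![x 0, x 1] := fun x => by
      funext l
      fin_cases l <;> rfl
    match k, f, x with
    | _, .df (.bool .zero), x => rw [h0 x]; exact hh'.map_zero
    | _, .df (.bool .one), x => rw [h0 x]; exact hh'.map_one
    | _, .df (.bool .add), x => rw [h2 x]; exact hh'.map_add _ _
    | _, .df (.bool .neg), x => rw [h1 x]; exact hh'.map_neg _
    | _, .df (.cyl i), x => rw [h1 x]; exact hh'.map_cyl _ _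
    | _, .diag i j, x => rw [h0 x]; exact hh'.map_diag _ _
    | _, .subst σ, x => rw [h1 x]; exact hh'.map_subst _ _
  · intro k r
    exact r.elim

end AGSStructure

end AlgGraph

/-- The theories `U`, `Φ` (the boolean sort is infinite), `Θ` (infinite chromatic number in the
sense of the boolean sort), any axiomatisation `D` of the representable diagonal-free cylindric
algebras and any universal axiomatisation `P` of the representable polyadic equality algebras
satisfy `U ∪ Φ ∪ D ⊨ Θ` and `U ∪ Θ ⊨ P`. Both parts are also given in terms of representability
itself. -/
theorem mainTheorem3 (n : ℕ) (hn : 3 ≤ n) :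
    (∀ D : (AlgGraph.LDf n).Theory, AlgGraph.AxiomatisesRDf.{v} n D →
      AlgGraph.Entails.{v}
        (AlgGraph.theoryU.{u} n ∪ AlgGraph.theoryPhi n ∪ AlgGraph.dfTheoryToAGS D)
        (AlgGraph.theoryTheta n)) ∧
    (∀ P : (AlgGraph.LPea n).Theory, P.IsUniversal → AlgGraph.AxiomatisesRPEA.{v} n P →
      AlgGraph.Entails.{v}
        (AlgGraph.theoryU.{u} n ∪ AlgGraph.theoryTheta n)
        (AlgGraph.peaTheoryToAGS P)) ∧
    (∀ M : AlgGraph.AGSStructure.{v} n, M.Models (AlgGraph.theoryU.{u} n) → Infinite M.B →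
      AlgGraph.HasRepresentableDfReduct n M.A → M.Models (AlgGraph.theoryTheta n)) ∧
    (∀ M : AlgGraph.AGSStructure.{v} n, M.Models (AlgGraph.theoryU.{u} n) →
      M.Models (AlgGraph.theoryTheta n) → AlgGraph.IsRPEA n M.A) := by
  refine ⟨fun D hD M hM => ?_, fun P _ hP M hM => ?_,
    fun M hM hB hrep => AlgGraph.models_theoryTheta hM hn hB hrep,
    fun M hM hΘ => AlgGraph.AGSStructure.isRPEA hM hn hΘ⟩
  · have hU : M.Models (AlgGraph.theoryU.{u} n) := fun φ h => hM φ (Or.inl (Or.inl h))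
    have hΦ : M.Models (AlgGraph.theoryPhi n) := fun φ h => hM φ (Or.inl (Or.inr h))
    have hDf := (AlgGraph.AGSStructure.models_dfTheoryToAGS M D).1 fun φ h => hM φ (Or.inr h)
    let := (AlgGraph.dfToPea n).reduct M.A
    exact AlgGraph.models_theoryTheta hU hn
      (AlgGraph.AGSStructure.infinite_of_models_theoryPhi hΦ) ((hD M.A).1 hDf)
  · exact (AlgGraph.AGSStructure.models_peaTheoryToAGS M P).2 ((hP M.A).2
      (AlgGraph.AGSStructure.isRPEA (fun φ h => hM φ (Or.inl h)) hn fun φ h => hM φ (Or.inr h)))
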